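/- Let $r, n, k$ be integers with $r \ge 2$, $n \ge 1$ and $0 \le k \le n$. For $m \ge 0$ let $G_m$ be the group of $m \times m$ monomial complex matrices whose nonzero entries are $r$-th roots of unity, acting on $\mathbb{C}[\mathbf{x}_m] = \mathbb{C}[x_1,\dots,x_m]$ by linear substitutions, $(g.f)(v) = f(g^{-1}v)$. Let $e_d(\mathbf{x}_m^r)$ be the $d$-th elementary symmetric polynomial in $x_1^r, \dots, x_m^r$, and for $k \le m$ consider the graded $G_m$-modules $$R_{m,k} = \mathbb{C}[\mathbf{x}_m]/\langle x_1^{kr+1}, \dots, x_m^{kr+1}, e_m(\mathbf{x}_m^r), e_{m-1}(\mathbf{x}_m^r), \dots, e_{m-k+1}(\mathbf{x}_m^r)\rangle,$$ $$S_{m,k} = \mathbb{C}[\mathbf{x}_m]/\langle x_1^{kr}, \dots, x_m^{kr}, e_m(\mathbf{x}_m^r), e_{m-1}(\mathbf{x}_m^r), \dots, e_{m-k+1}(\mathbf{x}_m^r)\rangle.$$ Let $G_{(n-z,z)} = G_{n-z} \times G_z \subseteq G_n$ be the subgroup of block diagonal matrices, and let $\mathbb{C}_{krz}$ be the trivial one-dimensional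 representation of $G_z$ placed in degree $krz$. Then there is an isomorphism of graded $G_n$-modules $$R_{n,k} \cong \bigoplus_{z=0}^{n-k} \mathrm{Ind}_{G_{(n-z,z)}}^{G_n}\bigl(S_{n-z,k} \otimes \mathbb{C}_{krz}\bigr).$$ Equivalently, $$\mathrm{grFrob}(R_{n,k};q) = \sum_{z=0}^{n-k} q^{krz}\, \boldsymbol{s}_{(\varnothing,\dots,\varnothing,(z))}(\mathbf{x}) \cdot \mathrm{grFrob}(S_{n-z,k};q).$$ Here, for an $r$-tuple of partitions $\boldsymbol\lambda = (\lambda^{(1)},\dots,\lambda^{(r)})$ of total size $m$, $\boldsymbol{s}_{\boldsymbol\lambda}(\mathbf{x}) = s_{\lambda^{(1)}}(\mathbf{x}^{(1)}) \cdots s_{\lambda^{(r)}}(\mathbf{x}^{(r)})$ is the product of Schur functions in $r$ separate infinite sets of variables; with $\alpha_i = |\lambda^{(i)}|$, $\boldsymbol{S}^{\boldsymbol\lambda} = \mathrm{Ind}_{G_{\alpha_1} \times \cdots \times G_{\alpha_r}}^{G_m}\bigl((V_1 \wr S^{\lambda^{(1)}}) \otimes \cdots \otimes (V_r \wr S^{\lambda^{(r)}})\bigr)$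 is the corresponding irreducible $G_m$-module, where $S^{\lambda^{(i)}}$ is the Specht module of the symmetric group $\mathfrak{S}_{\alpha_i}$ and $V_i \wr S^{\lambda^{(i)}}$ is the vector space $S^{\lambda^{(i)}}$ on which permutation matrices act as permutations and a diagonal matrix acts by $(\text{product of its diagonal entries})^{-i}$; and for a graded $G_m$-module $V = \bigoplus_{d \ge 0} V_d$ with finite-dimensional pieces, $\mathrm{grFrob}(V;q) = \sum_{d \ge 0} q^d \sum_{\boldsymbol\lambda} m_{\boldsymbol\lambda}(V_d)\, \boldsymbol{s}_{\boldsymbol\lambda}(\mathbf{x})$, where $m_{\boldsymbol\lambda}(V_d)$ is the multiplicity of $\boldsymbol{S}^{\boldsymbol\lambda}$ in $V_d$. -/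

import Mathlib

open scoped TensorProduct DirectSum

noncomputable section

/-! ### The groups `G_n = G(r,1,n)` of monomial matrices -/

/-- A monomial matrix all of whose nonzero entries are `r`-th roots of unity. -/
structure IsColoredMonomial (r : ℕ) {ι : Type} (A : Matrix ι ι ℂ) : Prop where
  row : ∀ i, ∃! j, A i j ≠ 0
  col : ∀ j, ∃! i, A i j ≠ 0
  root : ∀ i j, A i j ≠ 0 → A i j ^ r = 1

section Monomial

variable {r : ℕ} {ι : Type} [Fintype ι] [DecidableEq ι]

theorem isColoredMonomial_iff (A : Matrix ι ι ℂ) :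
    IsColoredMonomial r A ↔ ∃ (σ : Equiv.Perm ι) (c : ι → ℂ), (∀ j, c j ≠ 0 ∧ c j ^ r = 1) ∧
      A = Matrix.of fun i j => if i = σ j then c j else 0 := by
  constructor
  · intro h
    choose f hf hf' using h.col
    choose f2 hf2 hf2' using h.row
    have h1 : ∀ j, f2 (f j) = j := fun j => (hf2' _ _ (hf j)).symm
    have h2 : ∀ i, f (f2 i) = i := fun i => (hf' _ _ (hf2 i)).symm
    refine ⟨⟨f, f2, h1, h2⟩, fun j => A (f j) j, fun j => ⟨hf j, h.root _ _ (hf j)⟩, ?_⟩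
    ext i j
    by_cases hij : i = f j
    · simp [hij]
    · have : A i j = 0 := by
        by_contra h0
        exact hij (hf' _ _ h0)
      simp [hij, this]
  · rintro ⟨σ, c, hc, rfl⟩
    refine ⟨fun i => ⟨σ.symm i, by simp [(hc _).1], ?_⟩, fun j => ⟨σ j, by simp [(hc _).1], ?_⟩, ?_⟩
    · intro j hj
      by_cases hij : i = σ j
      · simp [hij]
      · simp [hij] at hj
    · intro i hi
      by_cases hij : i = σ j
      · exact hij
      · simp [hij] at hi
    · intro i j hj
      by_cases hij : i = σ j
      · simp [hij, (hc j).2]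
      · simp [hij] at hj

theorem IsColoredMonomial.one : IsColoredMonomial r (1 : Matrix ι ι ℂ) := by
  rw [isColoredMonomial_iff]
  refine ⟨1, fun _ => 1, by simp, ?_⟩
  ext i j
  rw [Matrix.one_apply]
  simp only [Matrix.of_apply, Equiv.Perm.one_apply]
  rfl

theorem IsColoredMonomial.mul {A B : Matrix ι ι ℂ} (hA : IsColoredMonomial r A)
    (hB : IsColoredMonomial r B) : IsColoredMonomial r (A * B) := by
  rw [isColoredMonomial_iff] at *
  obtain ⟨σ, c, hc, rfl⟩ := hA
  obtain ⟨τ, d, hd, rfl⟩ := hB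
  refine ⟨σ * τ, fun j => c (τ j) * d j, fun j => ⟨mul_ne_zero (hc _).1 (hd _).1, ?_⟩, ?_⟩
  · rw [mul_pow, (hc _).2, (hd _).2, one_mul]
  · ext i j
    by_cases hij : i = σ (τ j) <;> simp [Matrix.mul_apply, hij]

theorem IsColoredMonomial.inv {A B : Matrix ι ι ℂ} (hA : IsColoredMonomial r A)
    (hAB : B * A = 1) : IsColoredMonomial r B := by
  rw [isColoredMonomial_iff] at *
  obtain ⟨σ, c, hc, rfl⟩ := hA
  refine ⟨σ⁻¹, fun j => (c (σ⁻¹ j))⁻¹, fun j => ⟨inv_ne_zero (hc _).1, ?_⟩, ?_⟩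
  · rw [inv_pow, (hc _).2, inv_one]
  · rw [mul_eq_one_comm] at hAB
    refine (left_inv_eq_right_inv ?_ hAB).symm
    ext i j
    by_cases hij : i = j
    · subst hij
      simp [Matrix.mul_apply, (hc _).1]
    · simp [Matrix.mul_apply, Matrix.one_apply, hij]

end Monomial

/-- The subgroup of `GL` of monomial matrices whose nonzero entries are `r`-th roots of unity. -/
def monomialGroup (r : ℕ) (ι : Type) [Fintype ι] [DecidableEq ι] : Subgroup (GL ι ℂ) where
  carrier := {g | IsColoredMonomial r (g : Matrix ι ι ℂ)}
  one_mem' := IsColoredMonomial.one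
  mul_mem' ha hb := IsColoredMonomial.mul ha hb
  inv_mem' {g} hg := IsColoredMonomial.inv (A := (g : Matrix ι ι ℂ)) hg (by simp)

/-- `GG r (Fin n)` is the group `G_n`. -/
abbrev GG (r : ℕ) (ι : Type) [Fintype ι] [DecidableEq ι] : Type := ↥(monomialGroup r ι)

section Monomial

variable {r : ℕ} {ι κ : Type} [Fintype ι] [DecidableEq ι] [Fintype κ] [DecidableEq κ]

/-- The matrix of an element of `G_n`. -/
def GG.mat (g : GG r ι) : Matrix ι ι ℂ := ((g : GL ι ℂ) : Matrix ι ι ℂ)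

theorem GG.exists_form (g : GG r ι) :
    ∃ (σ : Equiv.Perm ι) (c : ι → ℂ), (∀ j, c j ≠ 0 ∧ c j ^ r = 1) ∧
      g.mat = Matrix.of fun i j => if i = σ j then c j else 0 :=
  (isColoredMonomial_iff _).1 g.2

/-- The permutation underlying a monomial matrix: `g e_j` is a multiple of `e_{perm g j}`. -/
def GG.perm (g : GG r ι) : Equiv.Perm ι := g.exists_form.choose

theorem GG.mat_perm_ne_zero (g : GG r ι) (j : ι) : g.mat (g.perm j) j ≠ 0 := by
  obtain ⟨c, hc, h⟩ := g.exists_form.choose_spec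
  have : g.mat (g.perm j) j = c j := by
    rw [h]
    simp [GG.perm]
  rw [this]
  exact (hc j).1

theorem GG.perm_eq_of_ne_zero (g : GG r ι) {i j : ι} (h : g.mat i j ≠ 0) : g.perm j = i :=
  (g.2.col j).unique (g.mat_perm_ne_zero j) h

theorem GG.mat_eq (g : GG r ι) (i j : ι) :
    g.mat i j = if i = g.perm j then g.mat (g.perm j) j else 0 := by
  by_cases h : i = g.perm j
  · simp [h]
  · rw [if_neg h]
    by_contra h0
    exact h (g.perm_eq_of_ne_zero h0).symm

theorem GG.mat_mul (g h : GG r ι) : (g * h).mat = g.mat * h.mat := rfl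

theorem GG.mat_one : (1 : GG r ι).mat = 1 := rfl

theorem GG.mat_mul_apply (g h : GG r ι) (j : ι) :
    (g * h).mat (g.perm (h.perm j)) j = g.mat (g.perm (h.perm j)) (h.perm j) * h.mat (h.perm j) j := by
  rw [GG.mat_mul, Matrix.mul_apply, Finset.sum_eq_single (h.perm j)]
  · intro b _ hb
    rw [GG.mat_eq h b j, if_neg hb, mul_zero]
  · simp

theorem GG.perm_mul (g h : GG r ι) : (g * h).perm = g.perm * h.perm := by
  ext j
  apply GG.perm_eq_of_ne_zero
  rw [Equiv.Perm.mul_apply, GG.mat_mul_apply]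
  exact mul_ne_zero (g.mat_perm_ne_zero _) (h.mat_perm_ne_zero _)

/-- The underlying permutation, as a group homomorphism. -/
def GG.permHom : GG r ι →* Equiv.Perm ι where
  toFun := GG.perm
  map_one' := by
    ext j
    apply GG.perm_eq_of_ne_zero
    simp [GG.mat_one]
  map_mul' := GG.perm_mul

/-- `χ(g)`, the product of the nonzero entries of `g`. -/
def GG.chi : GG r ι →* ℂ where
  toFun g := ∏ j, g.mat (g.perm j) j
  map_one' := by
    have : (1 : GG r ι).perm = 1 := map_one GG.permHom
    simp [this, GG.mat_one]
  map_mul' g h := by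
    have h1 : ∏ j, g.mat (g.perm j) j = ∏ j, g.mat (g.perm (h.perm j)) (h.perm j) :=
      (Equiv.prod_comp h.perm fun j => g.mat (g.perm j) j).symm
    rw [h1, ← Finset.prod_mul_distrib]
    refine Finset.prod_congr rfl fun j _ => ?_
    rw [GG.perm_mul, Equiv.Perm.mul_apply, GG.mat_mul_apply]

/-- Transport of `G_n` along a bijection of the index sets. -/
def GG.reindex (e : ι ≃ κ) : GG r ι →* GG r κ :=
  ((Units.map (Matrix.reindexRingEquiv ℂ e : Matrix ι ι ℂ →* Matrix κ κ ℂ)).comp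
    (monomialGroup r ι).subtype).codRestrict (monomialGroup r κ) (by
      intro g
      obtain ⟨σ, c, hc, h⟩ := GG.exists_form g
      change IsColoredMonomial r (Matrix.reindex e e (GG.mat g))
      rw [isColoredMonomial_iff]
      refine ⟨(e.symm.trans σ).trans e, c ∘ e.symm, fun j => hc _, ?_⟩
      ext i j
      simp [h, Equiv.symm_apply_eq]
      rfl)

/-- The block diagonal matrix with two given blocks. -/
def GG.blockProd : GG r ι × GG r κ →* GG r (ι ⊕ κ) where
  toFun g :=
    ⟨⟨Matrix.fromBlocks g.1.mat 0 0 g.2.mat, Matrix.fromBlocks g.1⁻¹.mat 0 0 g.2⁻¹.mat,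
      by simp [Matrix.fromBlocks_multiply, ← GG.mat_mul, GG.mat_one],
      by simp [Matrix.fromBlocks_multiply, ← GG.mat_mul, GG.mat_one]⟩, by
      obtain ⟨σ, c, hc, h⟩ := g.1.exists_form
      obtain ⟨τ, d, hd, h'⟩ := g.2.exists_form
      change IsColoredMonomial r (Matrix.fromBlocks g.1.mat 0 0 g.2.mat)
      rw [isColoredMonomial_iff]
      refine ⟨Equiv.sumCongr σ τ, Sum.elim c d, ?_, ?_⟩
      · rintro (j | j)
        · exact hc j
        · exact hd j
      · ext (i | i) (j | j) <;> simp [h, h']⟩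
  map_one' := by
    apply Subtype.ext
    apply Units.ext
    exact Matrix.fromBlocks_one
  map_mul' g h := by
    apply Subtype.ext
    apply Units.ext
    change Matrix.fromBlocks (g.1 * h.1).mat 0 0 (g.2 * h.2).mat =
      Matrix.fromBlocks g.1.mat 0 0 g.2.mat * Matrix.fromBlocks h.1.mat 0 0 h.2.mat
    simp [Matrix.fromBlocks_multiply, GG.mat_mul]

/-- The block diagonal matrix with a given family of blocks. -/
def GG.blockPi {I : Type} [Fintype I] [DecidableEq I] {α : I → Type} [∀ i, Fintype (α i)]
    [∀ i, DecidableEq (α i)] : (∀ i, GG r (α i)) →* GG r (Σ i, α i) where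
  toFun g :=
    ⟨⟨Matrix.blockDiagonal' fun i => (g i).mat, Matrix.blockDiagonal' fun i => (g i)⁻¹.mat,
      by simp [← Matrix.blockDiagonal'_mul, ← GG.mat_mul, GG.mat_one, ← Pi.one_def],
      by simp [← Matrix.blockDiagonal'_mul, ← GG.mat_mul, GG.mat_one, ← Pi.one_def]⟩, by
      choose σ c hc h using fun i => (g i).exists_form
      change IsColoredMonomial r (Matrix.blockDiagonal' fun i => (g i).mat)
      rw [isColoredMonomial_iff]
      refine ⟨Equiv.sigmaCongrRight σ, fun x => c x.1 x.2, fun x => hc _ _, ?_⟩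
      ext ⟨i, a⟩ ⟨j, b⟩
      by_cases hij : i = j
      · subst hij
        simp [h]
      · rw [Matrix.blockDiagonal'_apply_ne _ _ _ hij]
        simp [hij]⟩
  map_one' := by
    apply Subtype.ext
    apply Units.ext
    exact Matrix.blockDiagonal'_one
  map_mul' g h := by
    apply Subtype.ext
    apply Units.ext
    change Matrix.blockDiagonal' (fun i => (g i * h i).mat) =
      Matrix.blockDiagonal' (fun i => (g i).mat) * Matrix.blockDiagonal' (fun i => (h i).mat)
    simp [← Matrix.blockDiagonal'_mul, GG.mat_mul]

end Monomial

/-- The inclusion of the block diagonal subgroup `G_{(m,z)} = G_m × G_z` in `G_n`,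
where `m + z = n`. -/
def parabolicTwo (r : ℕ) {m z n : ℕ} (h : m + z = n) :
    GG r (Fin m) × GG r (Fin z) →* GG r (Fin n) :=
  (GG.reindex (finSumFinEquiv.trans (finCongr h))).comp GG.blockProd

/-- The inclusion of the block diagonal subgroup `G_α = G_{α_1} × ⋯ × G_{α_s}` in `G_n`, where
`α` is a composition of `n`. -/
def parabolic (r : ℕ) {s n : ℕ} (α : Fin s → ℕ) (h : ∑ i, α i = n) :
    (∀ i, GG r (Fin (α i))) →* GG r (Fin n) :=
  (GG.reindex (finSigmaFinEquiv.trans (finCongr h))).comp GG.blockPi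

/-! ### The action on polynomials and the rings `R_{n,k}`, `S_{n,k}` -/

section Poly

variable {ι : Type} [Fintype ι] [DecidableEq ι]

/-- The linear substitution `x_i ↦ ∑_j A_{ij} x_j`. -/
def linSubst (A : Matrix ι ι ℂ) : MvPolynomial ι ℂ →ₐ[ℂ] MvPolynomial ι ℂ :=
  MvPolynomial.aeval fun i => ∑ j, MvPolynomial.C (A i j) * MvPolynomial.X j

theorem linSubst_X (A : Matrix ι ι ℂ) (i : ι) :
    linSubst A (MvPolynomial.X i) = ∑ j, MvPolynomial.C (A i j) * MvPolynomial.X j :=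
  MvPolynomial.aeval_X _ _

theorem linSubst_one : linSubst (1 : Matrix ι ι ℂ) = 1 := by
  refine MvPolynomial.algHom_ext fun i => ?_
  rw [linSubst_X, Finset.sum_eq_single i]
  · rw [Matrix.one_apply_eq, MvPolynomial.C_1, one_mul]
    rfl
  · intro j _ hj
    rw [Matrix.one_apply_ne hj.symm, MvPolynomial.C_0, zero_mul]
  · intro h
    exact absurd (Finset.mem_univ i) h

theorem linSubst_mul (A B : Matrix ι ι ℂ) : linSubst (A * B) = linSubst B * linSubst A := by
  refine MvPolynomial.algHom_ext fun i => ?_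
  rw [AlgHom.mul_apply, linSubst_X, linSubst_X, map_sum]
  simp only [map_mul, MvPolynomial.algHom_C, MvPolynomial.algebraMap_eq, linSubst_X,
    Matrix.mul_apply, map_sum, Finset.sum_mul, Finset.mul_sum]
  rw [Finset.sum_comm]
  simp only [mul_assoc]

/-- The action of `GL` on polynomial functions by linear substitutions,
`(g f)(v) = f(g⁻¹ v)`; that is `g x_i = ∑_j (g⁻¹)_{ij} x_j`. -/
def glAct : GL ι ℂ →* (MvPolynomial ι ℂ →ₐ[ℂ] MvPolynomial ι ℂ) where
  toFun g := linSubst ((g⁻¹ : GL ι ℂ) : Matrix ι ι ℂ)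
  map_one' := by
    rw [inv_one, Units.val_one, linSubst_one]
  map_mul' g h := by
    rw [mul_inv_rev, Units.val_mul, linSubst_mul]

theorem glAct_isHomogeneous (g : GL ι ℂ) {p : MvPolynomial ι ℂ} {d : ℕ} (hp : p.IsHomogeneous d) :
    (glAct g p).IsHomogeneous d := by
  have := hp.aeval (n := 1)
    (fun i => ∑ j, MvPolynomial.C ((g⁻¹ : GL ι ℂ) i j) * MvPolynomial.X j)
    (fun i => MvPolynomial.IsHomogeneous.sum _ _ _ fun j _ => by
      simpa using (MvPolynomial.isHomogeneous_C ι _).mul (MvPolynomial.isHomogeneous_X ℂ j))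
  rw [one_mul] at this
  exact this

theorem glAct_X {r : ℕ} (g : GG r ι) (i : ι) :
    ∃ (c : ℂ), c ^ r = 1 ∧
      glAct (g : GL ι ℂ) (MvPolynomial.X i) =
        MvPolynomial.C c * MvPolynomial.X (g.perm i) := by
  have hp : (g⁻¹).perm = g.perm⁻¹ := map_inv GG.permHom g
  have key : ∀ j, (g⁻¹).mat i j = if j = g.perm i then (g⁻¹).mat i (g.perm i) else 0 := by
    intro j
    by_cases hj : j = g.perm i
    · simp [hj]
    · rw [if_neg hj, GG.mat_eq, if_neg]
      rw [hp]
      intro h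
      exact hj (by rw [h]; simp)
  refine ⟨(g⁻¹).mat i (g.perm i), ?_, ?_⟩
  · apply (g⁻¹).2.root
    have := (g⁻¹).mat_perm_ne_zero (g.perm i)
    rw [hp] at this
    have h2 : g.perm⁻¹ (g.perm i) = i := by simp
    rwa [h2] at this
  · change linSubst _ _ = _
    rw [linSubst_X]
    change ∑ j, MvPolynomial.C ((g⁻¹).mat i j) * MvPolynomial.X j = _
    rw [Finset.sum_eq_single (g.perm i)]
    · intro j _ hj
      rw [key, if_neg hj]
      simp
    · simp

end Poly

/-- The ideal `⟨x_1^a, …, x_n^a, e_n(x^r), e_{n-1}(x^r), …, e_{n-k+1}(x^r)⟩` of `ℂ[x_1, …, x_n]`,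
where `e_d(x^r)` is the `d`-th elementary symmetric polynomial in `x_1^r, …, x_n^r`. -/
def coinvIdeal (r n k a : ℕ) : Ideal (MvPolynomial (Fin n) ℂ) :=
  Ideal.span ({f | ∃ i, f = MvPolynomial.X i ^ a} ∪
    {f | ∃ d, n < d + k ∧ d ≤ n ∧ f = MvPolynomial.expand r (MvPolynomial.esymm (Fin n) ℂ d)})

theorem coinvIdeal_stable (r n k a : ℕ) (g : GG r (Fin n)) :
    coinvIdeal r n k a ≤ (coinvIdeal r n k a).comap (glAct (g : GL (Fin n) ℂ)) := by
  unfold coinvIdeal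
  rw [Ideal.span_le]
  rintro f (⟨i, rfl⟩ | ⟨d, hd, hd', rfl⟩) <;> rw [SetLike.mem_coe, Ideal.mem_comap]
  · obtain ⟨c, -, hc⟩ := glAct_X g i
    rw [map_pow, hc, mul_pow]
    exact Ideal.mul_mem_left _ _ (Ideal.subset_span (Or.inl ⟨_, rfl⟩))
  · have h : (glAct (g : GL (Fin n) ℂ)).comp (MvPolynomial.expand r) =
        (MvPolynomial.expand r).comp (MvPolynomial.rename g.perm) := by
      ext i : 1
      obtain ⟨c, hc1, hc⟩ := glAct_X g i
      simp only [AlgHom.comp_apply, MvPolynomial.expand_X, MvPolynomial.rename_X]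
      rw [map_pow, hc, mul_pow, ← map_pow MvPolynomial.C, hc1, map_one, one_mul]
    have h2 := congrArg (fun F => F (MvPolynomial.esymm (Fin n) ℂ d)) h
    simp only [AlgHom.comp_apply] at h2
    rw [h2, MvPolynomial.esymm_isSymmetric]
    exact Ideal.subset_span (Or.inr ⟨d, hd, hd', rfl⟩)

/-- The quotient of `ℂ[x_1, …, x_n]` by `coinvIdeal r n k a`. -/
abbrev CoinvQuot (r n k a : ℕ) : Type := MvPolynomial (Fin n) ℂ ⧸ coinvIdeal r n k a

/-- The action of `G_n` on the quotient. -/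
def quotRep (r n k a : ℕ) : Representation ℂ (GG r (Fin n)) (CoinvQuot r n k a) where
  toFun g := (Ideal.quotientMapₐ (coinvIdeal r n k a) (glAct (g : GL (Fin n) ℂ))
    (coinvIdeal_stable r n k a g)).toLinearMap
  map_one' := by
    refine LinearMap.ext fun x => ?_
    obtain ⟨p, rfl⟩ := Ideal.Quotient.mk_surjective x
    change Ideal.Quotient.mk _ (glAct 1 p) = Ideal.Quotient.mk _ p
    rw [map_one glAct]
    rfl
  map_mul' g h := by
    refine LinearMap.ext fun x => ?_
    obtain ⟨p, rfl⟩ := Ideal.Quotient.mk_surjective x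
    change Ideal.Quotient.mk _ (glAct ((g : GL (Fin n) ℂ) * (h : GL (Fin n) ℂ)) p) =
      Ideal.Quotient.mk _ (glAct (g : GL (Fin n) ℂ) (glAct (h : GL (Fin n) ℂ) p))
    rw [map_mul glAct]
    rfl

/-- The degree `d` piece of the quotient: the classes of homogeneous polynomials of degree `d`. -/
def quotGrading (r n k a : ℕ) (d : ℕ) : Submodule ℂ (CoinvQuot r n k a) :=
  (MvPolynomial.homogeneousSubmodule (Fin n) ℂ d).map
    (Ideal.Quotient.mkₐ ℂ (coinvIdeal r n k a)).toLinearMap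

theorem quotGrading_stable (r n k a d : ℕ) (g : GG r (Fin n)) :
    quotGrading r n k a d ≤ (quotGrading r n k a d).comap (quotRep r n k a g) := by
  rintro _ ⟨p, hp, rfl⟩
  exact ⟨glAct (g : GL (Fin n) ℂ) p, glAct_isHomogeneous _ hp, rfl⟩

/-- `R_{n,k} = ℂ[x_1, …, x_n] / ⟨x_i^{kr+1}, e_n(x^r), …, e_{n-k+1}(x^r)⟩` as a `G_n`-module. -/
abbrev repR (r n k : ℕ) : Representation ℂ (GG r (Fin n)) (CoinvQuot r n k (k * r + 1)) :=
  quotRep r n k (k * r + 1)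

/-- The grading of `R_{n,k}` by degree. -/
abbrev gradR (r n k : ℕ) : ℕ → Submodule ℂ (CoinvQuot r n k (k * r + 1)) :=
  quotGrading r n k (k * r + 1)

/-- `S_{n,k} = ℂ[x_1, …, x_n] / ⟨x_i^{kr}, e_n(x^r), …, e_{n-k+1}(x^r)⟩` as a `G_n`-module. -/
abbrev repS (r n k : ℕ) : Representation ℂ (GG r (Fin n)) (CoinvQuot r n k (k * r)) :=
  quotRep r n k (k * r)

/-- The grading of `S_{n,k}` by degree. -/
abbrev gradS (r n k : ℕ) : ℕ → Submodule ℂ (CoinvQuot r n k (k * r)) :=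
  quotGrading r n k (k * r)

/-! ### Constructions on graded modules -/

/-- The grading of a vector space concentrated in the single degree `e`. -/
def concGrading (V : Type) [AddCommGroup V] [Module ℂ V] (e d : ℕ) : Submodule ℂ V :=
  if d = e then ⊤ else ⊥

/-- The grading of a tensor product: `(V ⊗ W)_d = ⨁_{a + b = d} V_a ⊗ W_b`. -/
def tensorGrading {V W : Type} [AddCommGroup V] [Module ℂ V] [AddCommGroup W] [Module ℂ W]
    (𝒱 : ℕ → Submodule ℂ V) (𝒲 : ℕ → Submodule ℂ W) (d : ℕ) : Submodule ℂ (V ⊗[ℂ] W) :=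
  ⨆ p ∈ Finset.HasAntidiagonal.antidiagonal d, LinearMap.range (TensorProduct.mapIncl (𝒱 p.1) (𝒲 p.2))

/-- The grading of an induced module `ℂ[H] ⊗ V`, in which `ℂ[H]` sits in degree `0`. -/
def indGrading {G H V : Type} [Group G] [Group H] (φ : G →* H) [AddCommGroup V] [Module ℂ V]
    (ρ : Representation ℂ G V) (𝒱 : ℕ → Submodule ℂ V) (d : ℕ) :
    Submodule ℂ (Representation.IndV φ ρ) :=
  ⨆ h : H, (𝒱 d).map (Representation.IndV.mk φ ρ h)

/-- The grading of a direct sum of graded vector spaces. -/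
def sumGrading {I : Type} [DecidableEq I] {V : I → Type} [∀ i, AddCommGroup (V i)]
    [∀ i, Module ℂ (V i)] (𝒱 : ∀ i, ℕ → Submodule ℂ (V i)) (d : ℕ) : Submodule ℂ (⨁ i, V i) :=
  ⨅ i, (𝒱 i d).comap (DirectSum.component ℂ I V i)

/-- Isomorphism of graded `G`-modules: an equivariant linear isomorphism which maps the degree `d`
piece onto the degree `d` piece, for every `d`. -/
def GradedIso {G V W : Type} [Group G] [AddCommGroup V] [Module ℂ V] [AddCommGroup W] [Module ℂ W]
    (ρ : Representation ℂ G V) (𝒱 : ℕ → Submodule ℂ V)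
    (σ : Representation ℂ G W) (𝒲 : ℕ → Submodule ℂ W) : Prop :=
  ∃ e : ρ.Equiv σ, ∀ d, (𝒱 d).map e.toLinearEquiv.toLinearMap = 𝒲 d

/-- The outer tensor product `S_{m,k} ⊗ ℂ_{krz}` as a module over `G_m × G_z`, where `ℂ_{krz}` is
the trivial representation of `G_z` in degree `krz`. -/
abbrev repSC (r k m z : ℕ) :
    Representation ℂ (GG r (Fin m) × GG r (Fin z)) (CoinvQuot r m k (k * r) ⊗[ℂ] ℂ) :=
  Representation.tprod ((repS r m k).comp (MonoidHom.fst _ _))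
    ((Representation.trivial ℂ (GG r (Fin z)) ℂ).comp (MonoidHom.snd _ _))

/-- The grading of `S_{m,k} ⊗ ℂ_{krz}`. -/
abbrev gradSC (r k m z : ℕ) : ℕ → Submodule ℂ (CoinvQuot r m k (k * r) ⊗[ℂ] ℂ) :=
  tensorGrading (gradS r m k) (concGrading ℂ (k * r * z))

/-- The `z`-th summand `Ind_{G_{(n-z,z)}}^{G_n} (S_{n-z,k} ⊗ ℂ_{krz})`, `z ≤ n`. -/
abbrev repInd (r n k z : ℕ) (hz : z ≤ n) :=
  Representation.ind (parabolicTwo r (Nat.sub_add_cancel hz)) (repSC r k (n - z) z)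

/-- The grading of the `z`-th summand. -/
abbrev gradInd (r n k z : ℕ) (hz : z ≤ n) :=
  indGrading (parabolicTwo r (Nat.sub_add_cancel hz)) (repSC r k (n - z) z) (gradSC r k (n - z) z)

theorem summand_le {n k : ℕ} (z : Fin (n - k + 1)) : (z : ℕ) ≤ n := by omega

/-! ### Specht modules and the irreducible representations of `G_n` -/

section Specht

variable {ι : Type} [Fintype ι] [DecidableEq ι]

/-- The permutation representation on the span of all functions `ι → ℕ`. Such a function is read
as a tabloid with entries in `ι`, the value at `x` being the row that contains `x`. -/
def tabloidRep (ι : Type) [Fintype ι] [DecidableEq ι] :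
    Representation ℂ (Equiv.Perm ι) ((ι → ℕ) →₀ ℂ) where
  toFun σ := Finsupp.lmapDomain ℂ ℂ fun f x => f (σ⁻¹ x)
  map_one' := by
    ext f : 2
    simp
  map_mul' σ τ := by
    ext f : 2
    simp

/-- A tableau of shape `μ` with entries in `ι` is a bijection from `ι` to the cells of `μ`. Its
polytabloid is the signed sum, over the permutations `q` that preserve its columns, of the tabloids
of its images under `q`. Cells are pairs (row, column). -/
def polytabloid (μ : YoungDiagram) (T : ι ≃ μ.cells) : (ι → ℕ) →₀ ℂ :=
  ∑ q : Equiv.Perm ι, if ∀ x, (T (q x)).1.2 = (T x).1.2 then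
    Finsupp.single (fun x => (T (q⁻¹ x)).1.1) ((Equiv.Perm.sign q : ℤ) : ℂ) else 0

theorem tabloidRep_polytabloid (μ : YoungDiagram) (T : ι ≃ μ.cells) (σ : Equiv.Perm ι) :
    tabloidRep ι σ (polytabloid μ T) = polytabloid μ (σ⁻¹.trans T) := by
  unfold polytabloid
  rw [map_sum]
  refine Fintype.sum_equiv (MulAut.conj σ).toEquiv _ _ fun q => ?_
  have hc : (∀ x, ((Equiv.trans σ⁻¹ T) ((MulAut.conj σ).toEquiv q x)).1.2 =
      ((Equiv.trans σ⁻¹ T) x).1.2) ↔ ∀ x, (T (q x)).1.2 = (T x).1.2 := by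
    constructor
    · intro h x
      simpa using h (σ x)
    · intro h x
      simpa using h (σ⁻¹ x)
  by_cases h : ∀ x, (T (q x)).1.2 = (T x).1.2
  · rw [if_pos h, if_pos (hc.2 h)]
    have hs : Equiv.Perm.sign ((MulAut.conj σ).toEquiv q) = Equiv.Perm.sign q := by
      change Equiv.Perm.sign (σ * q * σ⁻¹) = _
      rw [map_mul, map_mul, Equiv.Perm.sign_inv, mul_comm, ← mul_assoc, Int.units_mul_self, one_mul]
    rw [hs]
    change Finsupp.lmapDomain ℂ ℂ _ (Finsupp.single _ _) = _
    rw [Finsupp.lmapDomain_apply, Finsupp.mapDomain_single]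
    congr 1
    funext x
    change (T (q⁻¹ (σ⁻¹ x))).1.1 = (T (σ⁻¹ ((σ * q * σ⁻¹)⁻¹ x))).1.1
    simp
  · rw [if_neg h, if_neg (fun h' => h (hc.1 h')), map_zero]

/-- The Specht module `S^μ`: the span of the polytabloids of all tableaux of shape `μ`. -/
def spechtSubmodule (μ : YoungDiagram) (ι : Type) [Fintype ι] [DecidableEq ι] :
    Submodule ℂ ((ι → ℕ) →₀ ℂ) :=
  Submodule.span ℂ (Set.range fun T : ι ≃ μ.cells => polytabloid μ T)

/-- The Specht module of shape `μ` as a representation of the symmetric group on `ι`, where `ι` is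
meant to have as many elements as `μ` has cells. -/
def spechtRep (μ : YoungDiagram) (ι : Type) [Fintype ι] [DecidableEq ι] :
    Representation ℂ (Equiv.Perm ι) (spechtSubmodule μ ι) :=
  (tabloidRep ι).subrepresentation (spechtSubmodule μ ι) (by
    intro σ
    unfold spechtSubmodule
    rw [Submodule.span_le]
    rintro _ ⟨T, rfl⟩
    rw [SetLike.mem_coe, Submodule.mem_comap]
    rw [tabloidRep_polytabloid]
    exact Submodule.subset_span ⟨_, rfl⟩)

/-- The module `V_i ≀ U = V_i^{⊗n} ⊗ U` over `G_n`, where `U` is a module over the symmetric group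
and `V_i = ℂ` with `ζ` acting by `ζ^{-i}`. Since `V_i^{⊗n}` is one-dimensional, the space is `U`;
a diagonal matrix acts by the product of the `(-i)`-th powers of its entries, and a permutation
matrix acts through `U`. -/
def wreathRep (r i : ℕ) {U : Type} [AddCommMonoid U] [Module ℂ U]
    (ρ : Representation ℂ (Equiv.Perm ι) U) : Representation ℂ (GG r ι) U where
  toFun g := ((GG.chi g)⁻¹ ^ i) • ρ (GG.permHom g)
  map_one' := by simp
  map_mul' g h := by
    ext x
    simp [mul_pow, smul_smul, mul_comm]

end Specht

/-- The outer tensor product of a finite family of representations. -/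
def outerTensor {I : Type} {G : I → Type} [∀ i, Group (G i)] {V : I → Type}
    [∀ i, AddCommMonoid (V i)] [∀ i, Module ℂ (V i)] (ρ : ∀ i, Representation ℂ (G i) (V i)) :
    Representation ℂ (∀ i, G i) (⨂[ℂ] i, V i) where
  toFun g := PiTensorProduct.map fun i => ρ i (g i)
  map_one' := by
    simp only [Pi.one_apply, map_one]
    exact PiTensorProduct.map_one
  map_mul' g h := by
    simp only [Pi.mul_apply, map_mul]
    exact PiTensorProduct.map_mul _ _

/-- The `r`-partitions of `n`: `r`-tuples of Young diagrams with `n` cells in total. The entry with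
index `i : Fin r` is the component with number `i + 1`. -/
abbrev RPartition (r n : ℕ) : Type := {l : Fin r → YoungDiagram // ∑ i, (l i).card = n}

theorem youngDiagram_cells_subset (μ : YoungDiagram) {n : ℕ} (h : μ.card ≤ n) :
    μ.cells ⊆ Finset.range n ×ˢ Finset.range n := by
  rintro ⟨i, j⟩ hc
  have h1 : (Finset.range (i + 1)).image (fun a => (a, j)) ⊆ μ.cells := by
    intro x hx
    obtain ⟨a, ha, rfl⟩ := Finset.mem_image.1 hx
    exact μ.up_left_mem (Nat.lt_succ_iff.1 (Finset.mem_range.1 ha)) le_rfl hc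
  have h2 : (Finset.range (j + 1)).image (fun a => (i, a)) ⊆ μ.cells := by
    intro x hx
    obtain ⟨a, ha, rfl⟩ := Finset.mem_image.1 hx
    exact μ.up_left_mem le_rfl (Nat.lt_succ_iff.1 (Finset.mem_range.1 ha)) hc
  have h3 := Finset.card_le_card h1
  have h4 := Finset.card_le_card h2
  rw [Finset.card_image_of_injective _ (fun a b hab => (Prod.ext_iff.1 hab).1),
    Finset.card_range] at h3
  rw [Finset.card_image_of_injective _ (fun a b hab => (Prod.ext_iff.1 hab).2),
    Finset.card_range] at h4
  have h5 : μ.cells.card ≤ n := h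
  simp only [Finset.mem_product, Finset.mem_range]
  omega

instance rPartition_finite (r n : ℕ) : Finite (RPartition r n) := by
  let F : RPartition r n → (Fin r → (Finset.range n ×ˢ Finset.range n).powerset) := fun l i =>
    ⟨(l.1 i).cells, Finset.mem_powerset.2 (youngDiagram_cells_subset _ (by
      have := Finset.single_le_sum (f := fun i => (l.1 i).card) (fun _ _ => Nat.zero_le _)
        (Finset.mem_univ i)
      exact this.trans l.2.le))⟩
  refine Finite.of_injective F fun a b hab => ?_
  apply Subtype.ext
  funext i
  apply YoungDiagram.ext
  exact congrArg Subtype.val (congrFun hab i)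

instance rPartition_fintype (r n : ℕ) : Fintype (RPartition r n) := Fintype.ofFinite _

/-- The vector space `S^{λ^{(1)}} ⊗ ⋯ ⊗ S^{λ^{(r)}}`. -/
abbrev SpechtTensor {r : ℕ} (l : Fin r → YoungDiagram) : Type :=
  ⨂[ℂ] i, spechtSubmodule (l i) (Fin (l i).card)

instance spechtTensorAddCommGroup {r : ℕ} (l : Fin r → YoungDiagram) :
    AddCommGroup (SpechtTensor l) :=
  Module.addCommMonoidToAddCommGroup ℂ

/-- The module `(V_1 ≀ S^{λ^{(1)}}) ⊗ ⋯ ⊗ (V_r ≀ S^{λ^{(r)}})` over `G_α = G_{α_1} × ⋯ × G_{α_r}`,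
where `α_i = |λ^{(i)}|`. -/
abbrev wreathTensor {r : ℕ} (l : Fin r → YoungDiagram) :
    Representation ℂ (∀ i, GG r (Fin (l i).card)) (SpechtTensor l) :=
  outerTensor fun i : Fin r => wreathRep r ((i : ℕ) + 1) (spechtRep (l i) (Fin (l i).card))

/-- The irreducible `G_n`-module attached to an `r`-partition `λ` of `n`, the induction from `G_α`
to `G_n` of the module `wreathTensor λ`. -/
abbrev irrRep {r n : ℕ} (l : RPartition r n) :
    Representation ℂ (GG r (Fin n))
      (Representation.IndV (A := SpechtTensor l.1) (parabolic r (fun i => (l.1 i).card) l.2)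
        (wreathTensor l.1)) :=
  Representation.ind (A := SpechtTensor l.1) (parabolic r (fun i => (l.1 i).card) l.2)
    (wreathTensor l.1)

/-! ### Schur functions and graded Frobenius characters -/

/-- The ring of formal power series in `r` infinite sets of variables, in which symmetric functions
live. The variable with index `(i, j)` is the variable with number `j + 1` in the set with number
`i + 1`. -/
abbrev SymSeries (r : ℕ) : Type := MvPowerSeries (Fin r × ℕ) ℚ

/-- The Schur function of an `r`-tuple of partitions, the sum of the monomials of all `r`-tuples of
semistandard tableaux of these shapes: the coefficient of a monomial counts the tuples in which
the entry `j` occurs in the component `i` as often as the exponent of the variable `(i, j)` says. -/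
def rSchur {r : ℕ} (l : Fin r → YoungDiagram) : SymSeries r := fun m =>
  (Nat.card {T : ∀ i, SemistandardYoungTableau (l i) //
    ∀ i j, ((l i).cells.filter fun c => T i c.1 c.2 = j).card = m (i, j)} : ℚ)

/-- The Frobenius character of a finite-dimensional `G_n`-module: the sum of the Schur functions of
all `r`-partitions, each weighted by the multiplicity of the corresponding irreducible module, that
is by the dimension of the space of equivariant maps from that irreducible module. -/
def frob {r n : ℕ} {V : Type} [AddCommGroup V] [Module ℂ V]
    (ρ : Representation ℂ (GG r (Fin n)) V) : SymSeries r :=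
  ∑ l : RPartition r n,
    (Module.finrank ℂ (Representation.IntertwiningMap (irrRep l) ρ) : ℚ) • rSchur l.1

/-- The graded Frobenius character `∑_d Frob(V_d) q^d` of a graded `G_n`-module. -/
def grFrob {r n : ℕ} {V : Type} [AddCommGroup V] [Module ℂ V]
    (ρ : Representation ℂ (GG r (Fin n)) V) (𝒱 : ℕ → Submodule ℂ V)
    (h𝒱 : ∀ d g, 𝒱 d ≤ (𝒱 d).comap (ρ g)) : PowerSeries (SymSeries r) :=
  PowerSeries.mk fun d => frob (ρ.subrepresentation (𝒱 d) (h𝒱 d))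

/-- The Young diagram with a single row of length `z`, empty if `z = 0`. -/
def oneRow (z : ℕ) : YoungDiagram := YoungDiagram.ofRowLens [z] (List.sortedGE_iff_pairwise.2 (List.pairwise_singleton _ _))

/-- The `r`-tuple `(∅, …, ∅, (z))`. -/
def lastRow (r z : ℕ) : Fin r → YoungDiagram := fun i => if (i : ℕ) + 1 = r then oneRow z else ⊥

end

/-! The isomorphism. Fix a set `T` of `z` variables. From a polynomial keep the monomials in which
every variable of `T` has exponent exactly `kr`, and divide them by `∏_{i ∈ T} x_i^{kr}`. This
extraction descends to a map `R_{n,k} → S_{n-z,k}` (`extract_mem_coinvIdeal`). Multiples of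
`x_i^{kr+1}` with `i ∈ T` are never seen. By the recursion `e_d(U ∪ i) = e_d(U) + x_i^r e_{d-1}(U)`,
where `e_d(U)` is taken in the `r`-th powers, the symmetric generators for all variables lie in the
ideal of those for the complement of `T`. The block group `G_{n-z} × G_z` acts on the target through
its first factor, because roots of unity enter from `T` only with exponent `kr` (`extract_glAct`).
Summing over the translates by `G_n` gives an equivariant map `R_{n,k} → ⨁_z Ind(S_{n-z,k} ⊗
ℂ_{krz})` (`toSumInd`).

Injectivity is `mem_coinvIdeal_of_extract`. Filter by the number `t` of exponents that are at least
`kr`. A monomial with exactly `t` of them either has one above `kr`, and is zero in `R_{n,k}`, or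
has all of them equal to `kr`. So the leading part is a sum of terms `∏_{i ∈ T} x_i^{kr} · s_T`,
where `s_T` is the extraction at `T`. If `s_T` lies in the ideal of `S_{n-z,k}`, the term can be
pushed to `t + 1`, since `x_i^{kr} e_d(U)` lies in the ideal of `U ∪ i` (`X_pow_mul_powEsymm_mem`).

Surjectivity is `exists_lift_projS`. Represent an element of `S_{n-z,k}` by a polynomial with all
exponents below `kr` and multiply it by `∏_{i ∈ T} x_i^{kr}`. In each monomial `T` is exactly the
set of variables with exponent at least `kr`, so every extraction at another set vanishes in the
quotient. The image is supported on a single coset of a single summand. All these maps respect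
degrees up to the shift `krz`.

The Frobenius characters. The key is `coeff_frob`: the coefficient of `x^m` in `frob V` is the
dimension of the space of equivariant maps from `V` to a monomial representation on words of content
`m`. It follows from Frobenius reciprocity and Young's rule for the symmetric groups. The latter is
proved by James's method: the equivariant maps from `S^μ` to words of content `c` are counted by
semistandard tableaux, where Garnir relations give the upper bound and a triangular family of maps
gives the lower one. This count also shows that the Specht characters are orthonormal, and there are
enough of them to span the class functions. With `coeff_frob`, additivity of `frob` is clear,
multiplicativity under induction amounts to cutting words in two (`frob_ind_parabolicTwo`), and the
character of the trivial module is an orbit count (`frob_trivial`). The decomposition is then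
applied to each homogeneous component. -/

open scoped TensorProduct DirectSum

noncomputable section

set_option linter.unusedSectionVars false

/-! ### Words and rearrangements -/

section Sorting

variable {ι : Type} [Fintype ι] [DecidableEq ι]

/-- A function that is weakly increasing on the fibres of `a`, as measured by `b`, agrees with any
rearrangement that preserves the fibres of `a` and has the same property. -/
theorem comp_perm_eq_self_of_sorted {a b f : ι → ℕ} (hab : ∀ x y, a x = a y → b x = b y → x = y)
    {p : Equiv.Perm ι} (hp : ∀ x, a (p x) = a x)
    (hf : ∀ x y, a x = a y → b x < b y → f x ≤ f y)
    (hfp : ∀ x y, a x = a y → b x < b y → f (p x) ≤ f (p y)) : ∀ x, f (p x) = f x := by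
  have key : ∀ (f g : ι → ℕ) (p : Equiv.Perm ι), (∀ x, a (p x) = a x) → (∀ x, g x = f (p x)) →
      (∀ x y, a x = a y → b x < b y → f x ≤ f y) →
      (∀ x y, a x = a y → b x < b y → g x ≤ g y) → ∀ x, g x ≤ f x := by
    intro f g p hp hg hf hfp x
    by_contra! hlt
    -- A rearrangement inside the fibre of `x` does not change the number of values that are at most
    -- `f x`. But sortedness and `f x < g x` make the set for `g` a subset of the set for `f` that
    -- misses `x`.
    have h1 : (Finset.univ.filter fun z => a z = a x ∧ g z ≤ f x).card =
        (Finset.univ.filter fun z => a z = a x ∧ f z ≤ f x).card := by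
      refine Finset.card_bij (fun z _ => p z) ?_ (fun _ _ _ _ h => p.injective h) ?_
      · intro z hz
        simp only [Finset.mem_filter, Finset.mem_univ, true_and] at hz ⊢
        rw [hp, ← hg]
        exact hz
      · intro z hz
        refine ⟨p.symm z, ?_, by simp⟩
        have h := hp (p.symm z)
        simp only [Finset.mem_filter, Finset.mem_univ, true_and, Equiv.apply_symm_apply, hg]
          at hz h ⊢
        exact ⟨h ▸ hz.1, hz.2⟩
    have h2 : (Finset.univ.filter fun z => a z = a x ∧ g z ≤ f x) ⊂
        (Finset.univ.filter fun z => a z = a x ∧ f z ≤ f x) := by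
      rw [Finset.ssubset_iff_of_subset]
      · exact ⟨x, by simp, by simpa using hlt⟩
      · intro z hz
        simp only [Finset.mem_filter, Finset.mem_univ, true_and] at hz ⊢
        refine ⟨hz.1, ?_⟩
        rcases lt_trichotomy (b z) (b x) with h | h | h
        · exact hf _ _ hz.1 h
        · rw [hab _ _ hz.1 h]
        · have := hfp _ _ hz.1.symm h
          omega
    exact absurd h1 (Finset.card_lt_card h2).ne
  intro x
  apply le_antisymm
  · exact key f (fun x => f (p x)) p hp (fun _ => rfl) hf hfp x
  · refine key (fun x => f (p x)) f p⁻¹ (fun x => ?_) (fun x => by simp) hfp hf x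
    have := hp (p⁻¹ x)
    simpa using this.symm

/-- Among the rearrangements of `f` inside the fibres of `a`, the sum `∑ b f` is largest for the
sorted one, and only for it. -/
theorem sum_mul_comp_perm_le_of_sorted {a b f : ι → ℕ}
    (hab : ∀ x y, a x = a y → b x = b y → x = y)
    {p : Equiv.Perm ι} (hp : ∀ x, a (p x) = a x)
    (hf : ∀ x y, a x = a y → b x < b y → f x ≤ f y) :
    ∑ x, b x * f (p x) ≤ ∑ x, b x * f x ∧
      (∑ x, b x * f (p x) = ∑ x, b x * f x → ∀ x, f (p x) = f x) := by
  obtain ⟨B, hB⟩ : ∃ B, ∀ x, b x < B ∧ f x < B := by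
    refine ⟨∑ x, (b x + f x) + 1, fun x => ?_⟩
    have := Finset.single_le_sum (f := fun x => b x + f x) (fun _ _ => Nat.zero_le _)
      (Finset.mem_univ x)
    omega
  have hmono : ∀ x y, a x < a y → a x * B + B ≤ a y * B := by
    intro x y h
    calc a x * B + B = (a x + 1) * B := by ring
      _ ≤ a y * B := Nat.mul_le_mul_right _ h
  -- Shifting the fibre `a = i` by `i * B`, with `B` above all values, makes the two functions
  -- similarly ordered on the whole set. The rearrangement inequality then applies, and the extra
  -- terms are unchanged by `p` because `p` preserves `a`.
  have hmv : Monovary (fun x => b x + a x * B) (fun x => f x + a x * B) := by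
    intro x y hxy
    dsimp only at hxy ⊢
    rcases lt_trichotomy (a x) (a y) with h | h | h
    · have := hmono x y h
      have := hB x
      omega
    · rw [h] at hxy ⊢
      by_contra! hlt
      have := hf y x h.symm (by omega)
      omega
    · have := hmono y x h
      have := hB y
      omega
  have hexp : ∀ g : ι → ℕ, ∑ x, (b x + a x * B) * (g x + a x * B) =
      ∑ x, b x * g x + B * ∑ x, a x * g x + ∑ x, (b x + a x * B) * (a x * B) := by
    intro g
    rw [Finset.mul_sum, ← Finset.sum_add_distrib, ← Finset.sum_add_distrib]
    exact Finset.sum_congr rfl fun x _ => by ring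
  have hperm : ∑ x, a x * f (p x) = ∑ x, a x * f x := by
    rw [← Equiv.sum_comp p fun x => a x * f x]
    exact Finset.sum_congr rfl fun x _ => by rw [hp]
  have hcomp : ∑ x, (b x + a x * B) * (f (p x) + a (p x) * B) =
      ∑ x, b x * f (p x) + B * ∑ x, a x * f x + ∑ x, (b x + a x * B) * (a x * B) := by
    simp only [hp]
    rw [hexp fun x => f (p x), hperm]
  constructor
  · have := hmv.sum_mul_comp_perm_le_sum_mul (σ := p)
    rw [hcomp, hexp] at this
    omega
  · intro heq
    have h2 := (hmv.sum_mul_comp_perm_eq_sum_mul_iff (σ := p)).1 (by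
      rw [hcomp, hexp, heq])
    refine comp_perm_eq_self_of_sorted hab hp hf fun x y hxy hb => ?_
    by_contra! hlt
    have := @h2 y x (by
      dsimp only [Function.comp_apply]
      rw [hp, hp, hxy]
      omega)
    dsimp only at this
    rw [hxy] at this
    omega

theorem exists_perm_comp_eq {κ : Type} [DecidableEq κ] {f g : ι → κ}
    (h : ∀ j, (Finset.univ.filter fun x => f x = j).card =
      (Finset.univ.filter fun x => g x = j).card) : ∃ p : Equiv.Perm ι, ∀ x, g (p x) = f x := by
  have e : ∀ j, {x // f x = j} ≃ {x // g x = j} := fun j =>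
    Fintype.equivOfCardEq (by rw [Fintype.card_subtype, Fintype.card_subtype, h])
  exact ⟨Equiv.ofFiberEquiv e, fun x => Equiv.ofFiberEquiv_map e x⟩

theorem sum_mul_comp_swap (g w : ι → ℕ) (x y : ι) (hxy : x ≠ y) :
    ∑ z, ((g (Equiv.swap x y z) : ℤ) * w z) =
      ∑ z, (g z : ℤ) * w z + ((g y : ℤ) - g x) * ((w x : ℤ) - w y) := by
  rw [← sub_eq_iff_eq_add', ← Finset.sum_sub_distrib, ← Finset.sum_subset (Finset.subset_univ {x, y}),
    Finset.sum_pair hxy]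
  · simp only [Equiv.swap_apply_left, Equiv.swap_apply_right]
    ring
  · intro z _ hz
    rw [Finset.mem_insert, Finset.mem_singleton, not_or] at hz
    rw [Equiv.swap_apply_of_ne_of_ne hz.1 hz.2, sub_self]

end Sorting

/-- The words `ι → κ` in which each letter `j` occurs `c j` times. -/
abbrev Words (ι : Type) [Fintype ι] {κ : Type} [DecidableEq κ] (c : κ → ℕ) : Type :=
  {f : ι → κ // ∀ j, (Finset.univ.filter fun x => f x = j).card = c j}

section Words

variable {ι : Type} [Fintype ι] [DecidableEq ι] {κ : Type} [DecidableEq κ]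

/-- The alphabet may be infinite. Finiteness comes from the fact that all words of one content are
rearrangements of a single one. -/
instance words_finite (c : κ → ℕ) : Finite (Words ι c) := by
  rcases isEmpty_or_nonempty (Words ι c) with h | ⟨⟨f0⟩⟩
  · infer_instance
  · refine Finite.of_surjective
      (fun p : Equiv.Perm ι => (⟨fun x => f0.1 (p x), fun j => ?_⟩ : Words ι c)) ?_
    · rw [← f0.2 j]
      exact Finset.card_bij (fun z _ => p z) (by simp) (fun _ _ _ _ h => p.injective h)
        fun z hz => ⟨p.symm z, by simpa using hz, by simp⟩
    · intro f
      obtain ⟨p, hp⟩ := exists_perm_comp_eq (f := f.1) (g := f0.1) fun j => by rw [f.2, f0.2]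
      exact ⟨p, Subtype.ext (funext hp)⟩

instance words_fintype (c : κ → ℕ) : Fintype (Words ι c) := Fintype.ofFinite _

/-- The action of permutations on words. -/
def wordAct (ι : Type) [Fintype ι] [DecidableEq ι] (c : κ → ℕ) :
    Equiv.Perm ι →* Equiv.Perm (Words ι c) :=
  MonoidHom.toHomPerm
    { toFun := fun σ f => ⟨fun x => f.1 (σ⁻¹ x), fun j => by
        rw [← f.2 j]
        exact Finset.card_bij (fun z _ => σ⁻¹ z) (by simp) (fun _ _ _ _ h => (σ⁻¹).injective h)
          fun z hz => ⟨σ z, by simpa using hz, by simp⟩⟩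
      map_one' := by
        funext f
        rfl
      map_mul' := fun σ τ => by
        funext f
        apply Subtype.ext
        funext x
        change f.1 ((σ * τ)⁻¹ x) = f.1 (τ⁻¹ (σ⁻¹ x))
        rw [mul_inv_rev]
        rfl }

theorem wordAct_apply (c : κ → ℕ) (σ : Equiv.Perm ι) (f : Words ι c) (x : ι) :
    (wordAct ι c σ f).1 x = f.1 (σ⁻¹ x) := rfl

theorem wordAct_transitive (c : κ → ℕ) (f g : Words ι c) : ∃ σ, wordAct ι c σ f = g := by
  obtain ⟨p, hp⟩ := exists_perm_comp_eq (f := g.1) (g := f.1) fun j => by rw [f.2, g.2]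
  exact ⟨p⁻¹, Subtype.ext (funext fun x => by rw [wordAct_apply, inv_inv, hp])⟩

theorem sum_content_eq_card {c : κ →₀ ℕ} (f : Words ι c) : c.sum (fun _ a => a) = Fintype.card ι := by
  rw [Finsupp.sum, ← Finset.card_univ,
    Finset.card_eq_sum_card_fiberwise (f := f.1) (t := c.support)]
  · exact Finset.sum_congr rfl fun j _ => (f.2 j).symm
  · intro x _
    rw [Finset.mem_coe, Finsupp.mem_support_iff, ← f.2, ← Nat.pos_iff_ne_zero, Finset.card_pos]
    exact ⟨x, by simp⟩

theorem words_nonempty {c : κ →₀ ℕ} (h : c.sum (fun _ a => a) = Fintype.card ι) :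
    Nonempty (Words ι c) := by
  have e : ι ≃ Σ j : c.support, Fin (c j) := Fintype.equivOfCardEq (by
    rw [← h, Fintype.card_sigma, Finsupp.sum]
    simp only [Fintype.card_fin]
    exact (Finset.sum_coe_sort c.support fun j => c j).symm)
  refine ⟨fun x => (e x).1, fun j => ?_⟩
  by_cases hj : j ∈ c.support
  · rw [← Fintype.card_fin (c j), ← Fintype.card_subtype]
    refine Fintype.card_congr ?_
    refine (e.subtypeEquiv (q := fun y => y.1 = (⟨j, hj⟩ : c.support)) fun x => ?_).trans
      (Equiv.sigmaSubtype (⟨j, hj⟩ : c.support))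
    rw [Subtype.ext_iff]
  · rw [Finsupp.notMem_support_iff.1 hj, Finset.card_eq_zero, Finset.filter_eq_empty_iff]
    rintro x - rfl
    exact hj (e x).1.2

end Words

/-! ### Characters and multiplicities -/

section Characters

variable {G : Type} [Group G]

/-- The number of equivariant maps as a scalar product of characters. -/
theorem finrank_intertwiningMap_eq [Fintype G] {V W : Type} [AddCommMonoid V] [Module ℂ V]
    [Module.Finite ℂ V] [AddCommMonoid W] [Module ℂ W] [Module.Finite ℂ W]
    (ρ : Representation ℂ G V) (σ : Representation ℂ G W) :
    (Module.finrank ℂ (ρ.IntertwiningMap σ) : ℂ) = (Fintype.card G : ℂ)⁻¹ *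
      ∑ g : G, LinearMap.trace ℂ V (ρ g⁻¹) * LinearMap.trace ℂ W (σ g) := by
  let _ : AddCommGroup V := Module.addCommMonoidToAddCommGroup ℂ
  let _ : AddCommGroup W := Module.addCommMonoidToAddCommGroup ℂ
  have : Invertible (Nat.card G : ℂ) := invertibleOfNonzero (by
    rw [Nat.card_eq_fintype_card]
    exact_mod_cast Fintype.card_ne_zero)
  have h := Representation.card_inv_mul_sum_char_mul_char_eq_finrank ρ σ
  rw [Nat.card_eq_fintype_card] at h
  refine h.symm.trans ?_
  congr 1
  exact Finset.sum_congr rfl fun g _ => mul_comm _ _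

/-- The scalar product of two characters is symmetric under `g ↦ g⁻¹`. Complete reducibility is not
needed explicitly. -/
theorem finrank_intertwiningMap_comm [Fintype G] {V W : Type} [AddCommMonoid V] [Module ℂ V]
    [Module.Finite ℂ V] [AddCommMonoid W] [Module ℂ W] [Module.Finite ℂ W]
    (ρ : Representation ℂ G V) (σ : Representation ℂ G W) :
    Module.finrank ℂ (ρ.IntertwiningMap σ) = Module.finrank ℂ (σ.IntertwiningMap ρ) := by
  have h : (Module.finrank ℂ (ρ.IntertwiningMap σ) : ℂ) =
      Module.finrank ℂ (σ.IntertwiningMap ρ) := by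
    rw [finrank_intertwiningMap_eq, finrank_intertwiningMap_eq]
    congr 1
    rw [← Equiv.sum_comp (Equiv.inv G)]
    refine Finset.sum_congr rfl fun g _ => ?_
    rw [Equiv.inv_apply, inv_inv, mul_comm]
  exact_mod_cast h

theorem trace_conj_eq {V : Type} [AddCommMonoid V] [Module ℂ V] (ρ : Representation ℂ G V)
    (g h : G) : LinearMap.trace ℂ V (ρ (h * g * h⁻¹)) = LinearMap.trace ℂ V (ρ g) := by
  rw [map_mul, LinearMap.trace_mul_comm, ← map_mul, inv_mul_cancel_left]

theorem intertwiningMap_finite {V W : Type} [AddCommMonoid V] [Module ℂ V]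
    [Module.Finite ℂ V] [AddCommMonoid W] [Module ℂ W] [Module.Finite ℂ W]
    (ρ : Representation ℂ G V) (σ : Representation ℂ G W) :
    Module.Finite ℂ (ρ.IntertwiningMap σ) := by
  let _ : AddCommGroup V := Module.addCommMonoidToAddCommGroup ℂ
  let _ : AddCommGroup W := Module.addCommMonoidToAddCommGroup ℂ
  exact inferInstanceAs (Module.Finite ℂ (ρ.IntertwiningMap σ))

/-- The representation on functions on `X` given by an action on `X` and a cocycle. -/
def cocycleRep {X : Type} (π : G →* Equiv.Perm X) (a : G → X → ℂ) (ha1 : ∀ x, a 1 x = 1)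
    (ha : ∀ g h x, a (g * h) x = a g x * a h ((π g)⁻¹ x)) : Representation ℂ G (X → ℂ) where
  toFun g :=
    { toFun := fun v x => a g x * v ((π g)⁻¹ x)
      map_add' := fun v w => by
        funext x
        simp only [Pi.add_apply]
        ring
      map_smul' := fun c v => by
        funext x
        simp only [Pi.smul_apply, smul_eq_mul, RingHom.id_apply]
        ring }
  map_one' := by
    refine LinearMap.ext fun v => funext fun x => ?_
    change a 1 x * v ((π 1)⁻¹ x) = v x
    rw [ha1, map_one, inv_one, Equiv.Perm.one_apply, one_mul]
  map_mul' g h := by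
    refine LinearMap.ext fun v => funext fun x => ?_
    change a (g * h) x * v ((π (g * h))⁻¹ x) = a g x * (a h _ * v ((π h)⁻¹ ((π g)⁻¹ x)))
    rw [ha, map_mul, mul_inv_rev, Equiv.Perm.mul_apply, mul_assoc]

theorem cocycleRep_apply {X : Type} (π : G →* Equiv.Perm X) (a : G → X → ℂ)
    (ha1 : ∀ x, a 1 x = 1) (ha : ∀ g h x, a (g * h) x = a g x * a h ((π g)⁻¹ x)) (g : G)
    (v : X → ℂ) (x : X) : cocycleRep π a ha1 ha g v x = a g x * v ((π g)⁻¹ x) := rfl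

theorem trace_cocycleRep {X : Type} [Fintype X] [DecidableEq X] (π : G →* Equiv.Perm X)
    (a : G → X → ℂ) (ha1 : ∀ x, a 1 x = 1)
    (ha : ∀ g h x, a (g * h) x = a g x * a h ((π g)⁻¹ x)) (g : G) :
    LinearMap.trace ℂ (X → ℂ) (cocycleRep π a ha1 ha g) = ∑ x, if π g x = x then a g x else 0 := by
  rw [LinearMap.trace_eq_matrix_trace ℂ (Pi.basisFun ℂ X), Matrix.trace]
  refine Finset.sum_congr rfl fun x _ => ?_
  rw [Matrix.diag_apply, LinearMap.toMatrix_apply, Pi.basisFun_repr, Pi.basisFun_apply,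
    cocycleRep_apply, Pi.single_apply, mul_ite, mul_one, mul_zero]
  congr 1
  rw [Equiv.Perm.inv_eq_iff_eq, eq_comm (a := x)]

/-- The average over a group of a sum over fixed points of a transitive action is the average over a
stabilizer. -/
theorem average_sum_fixed {X : Type} [Fintype G] [Fintype X] [DecidableEq X]
    (π : G →* Equiv.Perm X) (F : G → X → ℂ) (x0 : X) (htrans : ∀ x, ∃ g, π g x0 = x)
    (hF : ∀ g h, π g x0 = x0 → F (h * g * h⁻¹) (π h x0) = F g x0) :
    (Fintype.card G : ℂ)⁻¹ * ∑ g, ∑ x, (if π g x = x then F g x else 0) =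
      ((Finset.univ.filter fun g => π g x0 = x0).card : ℂ)⁻¹ *
        ∑ g, if π g x0 = x0 then F g x0 else 0 := by
  have hS0 : ((Finset.univ.filter fun g => π g x0 = x0).card : ℂ) ≠ 0 := by
    rw [Nat.cast_ne_zero, ← Nat.pos_iff_ne_zero, Finset.card_pos]
    exact ⟨1, by simp⟩
  have hG0 : (Fintype.card G : ℂ) ≠ 0 := by exact_mod_cast Fintype.card_ne_zero
  have h1 : ∀ h : G, (∑ g, if π g (π h x0) = π h x0 then F g (π h x0) else 0) =
      ∑ g, if π g x0 = x0 then F g x0 else 0 := by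
    intro h
    rw [← Equiv.sum_comp (MulAut.conj h).toEquiv]
    refine Finset.sum_congr rfl fun g _ => ?_
    change (if π (h * g * h⁻¹) (π h x0) = π h x0 then F (h * g * h⁻¹) (π h x0) else 0) = _
    have hiff : π (h * g * h⁻¹) (π h x0) = π h x0 ↔ π g x0 = x0 := by
      rw [← Equiv.Perm.mul_apply, ← map_mul, inv_mul_cancel_right, map_mul, Equiv.Perm.mul_apply,
        EmbeddingLike.apply_eq_iff_eq]
    by_cases hg : π g x0 = x0
    · rw [if_pos (hiff.2 hg), if_pos hg, hF g h hg]
    · rw [if_neg (fun h' => hg (hiff.1 h')), if_neg hg]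
  have h2 : ∀ x, (Finset.univ.filter fun h => π h x0 = x).card =
      (Finset.univ.filter fun g => π g x0 = x0).card := by
    intro x
    obtain ⟨h, rfl⟩ := htrans x
    refine Finset.card_bij (fun g _ => h⁻¹ * g) ?_ ?_ ?_
    · intro g hg
      rw [Finset.mem_filter] at hg ⊢
      refine ⟨Finset.mem_univ _, ?_⟩
      rw [map_mul, Equiv.Perm.mul_apply, hg.2, ← Equiv.Perm.mul_apply, ← map_mul, inv_mul_cancel,
        map_one, Equiv.Perm.one_apply]
    · intro _ _ _ _ h
      exact mul_left_cancel h
    · intro g hg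
      rw [Finset.mem_filter] at hg
      refine ⟨h * g, ?_, by rw [inv_mul_cancel_left]⟩
      rw [Finset.mem_filter]
      refine ⟨Finset.mem_univ _, ?_⟩
      rw [map_mul, Equiv.Perm.mul_apply, hg.2]
  -- The same double sum is counted in two ways: by `h1` each `h` contributes the sum over the
  -- stabilizer, and by `h2` each point is `π h x0` for as many `h` as the stabilizer has elements.
  have h3 : ∑ h : G, ∑ g, (if π g (π h x0) = π h x0 then F g (π h x0) else 0) =
      (Finset.univ.filter fun g => π g x0 = x0).card *
        ∑ g, ∑ x, (if π g x = x then F g x else 0) := by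
    rw [← Finset.sum_fiberwise_of_maps_to (s := Finset.univ) (t := Finset.univ)
      (g := fun h : G => π h x0) (fun _ _ => Finset.mem_univ _), Finset.sum_comm (s := Finset.univ),
      Finset.mul_sum]
    refine Finset.sum_congr rfl fun x _ => ?_
    rw [← h2 x, ← nsmul_eq_mul, ← Finset.sum_const]
    refine Finset.sum_congr rfl fun h hh => ?_
    rw [(Finset.mem_filter.1 hh).2]
  simp only [h1, Finset.sum_const, Finset.card_univ, nsmul_eq_mul] at h3
  field_simp
  linear_combination -h3

/-- Frobenius reciprocity. -/
theorem finrank_intertwiningMap_ind {H : Type} [Group H] (φ : G →* H) {V W : Type} [AddCommGroup V]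
    [Module ℂ V] [AddCommGroup W] [Module ℂ W] (ρ : Representation ℂ G V)
    (σ : Representation ℂ H W) :
    Module.finrank ℂ ((Representation.ind φ ρ).IntertwiningMap σ) =
      Module.finrank ℂ (ρ.IntertwiningMap (σ.comp φ)) :=
  LinearEquiv.finrank_eq
    { toFun := fun f => ⟨f.toLinearMap ∘ₗ Representation.IndV.mk φ ρ 1, fun g => by
        refine LinearMap.ext fun x => ?_
        have h := Representation.IntertwiningMap.isIntertwining _ _ f (φ g) (Representation.IndV.mk φ ρ 1 x)
        rw [Representation.ind_mk, one_mul] at h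
        -- In the coinvariants the class of `h ⊗ x` equals that of `φ g * h ⊗ ρ g x`. Here this is
        -- used with `h = (φ g)⁻¹`.
        have h2 : Representation.IndV.mk φ ρ (φ g)⁻¹ x = Representation.IndV.mk φ ρ 1 (ρ g x) := by
          have := Representation.Coinvariants.mk_self_apply
            (ρ := Representation.tprod ((Representation.leftRegular ℂ H).comp φ) ρ) g
            (MonoidAlgebra.single (φ g)⁻¹ 1 ⊗ₜ x)
          simpa using this.symm
        rw [h2] at h
        exact h⟩
      map_add' := fun _ _ => rfl
      map_smul' := fun _ _ => rfl
      -- `H` acts on the induced module by right multiplication with the inverse, so the class of `h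
      -- ⊗ x` is the translate by `h⁻¹` of the class of `1 ⊗ x` and must go to `σ h⁻¹ (f x)`.
      invFun := fun f => ⟨Representation.Coinvariants.lift _
        (TensorProduct.lift <| (Finsupp.lift _ _ _ fun h => σ h⁻¹ ∘ₗ f.toLinearMap) ∘ₗ
          (MonoidAlgebra.coeffLinearEquiv ℂ).toLinearMap)
        fun g => by
          ext h x
          have := Representation.IntertwiningMap.isIntertwining _ _ f g x
          simp [mul_inv_rev, this, Representation.ofMulAction_single], fun g => by ext; simp⟩
      left_inv := fun f => by
        ext h a
        simpa using (Representation.IntertwiningMap.isIntertwining _ _ f h⁻¹ (Representation.IndV.mk φ ρ 1 a)).symm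
      right_inv := fun _ => by
        ext
        simp }

instance indV_finiteDimensional {H : Type} [Group H] [Finite H] (φ : G →* H) {V : Type}
    [AddCommGroup V] [Module ℂ V] [FiniteDimensional ℂ V] (ρ : Representation ℂ G V) :
    FiniteDimensional ℂ (Representation.IndV φ ρ) := by
  have : FiniteDimensional ℂ (MonoidAlgebra ℂ H) :=
    Module.Finite.equiv (MonoidAlgebra.coeffLinearEquiv ℂ).symm
  exact Module.Finite.of_surjective (Representation.Coinvariants.mk _)
    (Representation.Coinvariants.mk_surjective _)

/-- In the basis of pure tensors of basis vectors the diagonal entries are products of diagonal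
entries, and the product of the traces expands to their sum. -/
theorem trace_piTensorProduct_map {I : Type} [Fintype I] [DecidableEq I] {V : I → Type}
    [∀ i, AddCommMonoid (V i)] [∀ i, Module ℂ (V i)] [∀ i, Module.Finite ℂ (V i)]
    (f : ∀ i, V i →ₗ[ℂ] V i) :
    LinearMap.trace ℂ (⨂[ℂ] i, V i) (PiTensorProduct.map f) = ∏ i, LinearMap.trace ℂ (V i) (f i) := by
  have b : ∀ i, Module.Basis (Fin (Module.finrank ℂ (V i))) ℂ (V i) := fun i =>
    let _ : AddCommGroup (V i) := Module.addCommMonoidToAddCommGroup ℂ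
    Module.finBasis ℂ (V i)
  rw [LinearMap.trace_eq_matrix_trace ℂ (Basis.piTensorProduct b), Matrix.trace]
  simp only [LinearMap.trace_eq_matrix_trace ℂ (b _), Matrix.trace]
  rw [Finset.prod_univ_sum, Fintype.piFinset_univ]
  refine Finset.sum_congr rfl fun p _ => ?_
  rw [Matrix.diag_apply, LinearMap.toMatrix_apply, Basis.piTensorProduct_apply,
    PiTensorProduct.map_tprod, Basis.piTensorProduct_repr_tprod_apply]
  refine Finset.prod_congr rfl fun i _ => ?_
  rw [Matrix.diag_apply, LinearMap.toMatrix_apply]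

end Characters

/-! ### Equivariant maps from Specht modules to spaces of words -/

section SpechtHom

variable {ι : Type} [Fintype ι] [DecidableEq ι]

/-- The permutation representation on functions on words. -/
def wordRep (ι : Type) [Fintype ι] [DecidableEq ι] {κ : Type} [DecidableEq κ] (c : κ → ℕ) :
    Representation ℂ (Equiv.Perm ι) (Words ι c → ℂ) :=
  cocycleRep (wordAct ι c) (fun _ _ => 1) (fun _ => rfl) fun _ _ _ => (one_mul 1).symm

open Classical in
/-- Extension by zero of a function on words. -/
def wordExtend {c : ℕ → ℕ} (v : Words ι c → ℂ) (f : ι → ℕ) : ℂ :=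
  if h : ∀ j, (Finset.univ.filter fun x => f x = j).card = c j then v ⟨f, h⟩ else 0

theorem wordExtend_coe {c : ℕ → ℕ} (v : Words ι c → ℂ) (f : Words ι c) :
    wordExtend v f.1 = v f := dif_pos f.2

theorem wordRep_apply_coe {c : ℕ → ℕ} (σ : Equiv.Perm ι) (v : Words ι c → ℂ) (f : Words ι c) :
    wordRep ι c σ v f = wordExtend v (fun x => f.1 (σ x)) := by
  change 1 * v ((wordAct ι c σ)⁻¹ f) = _
  rw [one_mul, ← map_inv, ← wordExtend_coe v]
  congr 1

theorem content_comp_perm {c : ℕ → ℕ} (σ : Equiv.Perm ι) (f : ι → ℕ) :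
    (∀ j, (Finset.univ.filter fun x => f (σ x) = j).card = c j) ↔
      ∀ j, (Finset.univ.filter fun x => f x = j).card = c j := by
  refine forall_congr' fun j => ?_
  rw [show (Finset.univ.filter fun x => f (σ x) = j).card =
    (Finset.univ.filter fun x => f x = j).card from
      Finset.card_bij (fun z _ => σ z) (by simp) (fun _ _ _ _ h => σ.injective h)
        fun z hz => ⟨σ.symm z, by simpa using hz, by simp⟩]

variable {μ : YoungDiagram} (t : ι ≃ μ.cells)

theorem tabloidRep_polytabloid_eq (σ : Equiv.Perm ι) :
    tabloidRep ι σ (polytabloid μ t) = ∑ q : Equiv.Perm ι,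
      if ∀ x, (t (q x)).1.2 = (t x).1.2 then
        Finsupp.single (fun x => (t (q⁻¹ (σ⁻¹ x))).1.1) ((Equiv.Perm.sign q : ℤ) : ℂ) else 0 := by
  unfold polytabloid
  rw [map_sum]
  refine Finset.sum_congr rfl fun q _ => ?_
  split_ifs
  · change Finsupp.lmapDomain ℂ ℂ _ (Finsupp.single _ _) = _
    rw [Finsupp.lmapDomain_apply, Finsupp.mapDomain_single]
  · exact map_zero _

/-- Left multiplication by `q` permutes the column group and changes every sign by the sign of `q`.
-/
theorem tabloidRep_polytabloid_of_col {q : Equiv.Perm ι} (hq : ∀ x, (t (q x)).1.2 = (t x).1.2) :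
    tabloidRep ι q (polytabloid μ t) = ((Equiv.Perm.sign q : ℤ) : ℂ) • polytabloid μ t := by
  rw [tabloidRep_polytabloid_eq]
  unfold polytabloid
  rw [Finset.smul_sum, ← Equiv.sum_comp (Equiv.mulLeft q)
    (fun p : Equiv.Perm ι => ((Equiv.Perm.sign q : ℤ) : ℂ) • (if ∀ x, (t (p x)).1.2 = (t x).1.2 then
      Finsupp.single (fun x => (t (p⁻¹ x)).1.1) ((Equiv.Perm.sign p : ℤ) : ℂ) else 0))]
  refine Finset.sum_congr rfl fun p _ => ?_
  have hc : (∀ x, (t ((q * p) x)).1.2 = (t x).1.2) ↔ ∀ x, (t (p x)).1.2 = (t x).1.2 := by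
    refine forall_congr' fun x => ?_
    rw [Equiv.Perm.mul_apply, hq]
  simp only [Equiv.coe_mulLeft, hc]
  split_ifs
  · rw [Finsupp.smul_single, smul_eq_mul, map_mul, Units.val_mul, Int.cast_mul, ← mul_assoc,
      ← Int.cast_mul, ← Units.val_mul, Int.units_mul_self, Units.val_one, Int.cast_one, one_mul,
      mul_inv_rev]
    rfl
  · rw [smul_zero]

/-- The Garnir relations. -/
theorem sum_sign_tabloidRep_polytabloid (A : Finset ι)
    (hA : ∀ q : Equiv.Perm ι, (∀ x, (t (q x)).1.2 = (t x).1.2) →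
      ∃ x ∈ A, ∃ y ∈ A, x ≠ y ∧ (t (q x)).1.1 = (t (q y)).1.1) :
    ∑ σ : Equiv.Perm ι, (if ∀ x, x ∉ A → σ x = x then ((Equiv.Perm.sign σ : ℤ) : ℂ) else 0) •
      tabloidRep ι σ (polytabloid μ t) = 0 := by
  simp only [tabloidRep_polytabloid_eq, Finset.smul_sum]
  rw [Finset.sum_comm]
  refine Finset.sum_eq_zero fun q _ => ?_
  by_cases hq : ∀ x, (t (q x)).1.2 = (t x).1.2
  · simp only [if_pos hq]
    obtain ⟨x, hx, y, hy, hxy, hrow⟩ := hA q⁻¹ fun x => by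
      have := hq (q⁻¹ x)
      rw [← this]
      simp
    set F : Equiv.Perm ι → ((ι → ℕ) →₀ ℂ) := fun σ =>
      (if ∀ x, x ∉ A → σ x = x then ((Equiv.Perm.sign σ : ℤ) : ℂ) else 0) •
        Finsupp.single (fun x => (t (q⁻¹ (σ⁻¹ x))).1.1) ((Equiv.Perm.sign q : ℤ) : ℂ) with hF
    -- For a fixed term `q` of the polytabloid, `x` and `y` lie in the same row of its tabloid.
    -- Multiplying `σ` by their transposition therefore fixes the tabloid and flips the sign, so the
    -- sum over `σ` cancels.
    have hneg : ∀ σ, F (σ * Equiv.swap x y) = - F σ := by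
      intro σ
      have hc : (∀ z, z ∉ A → (σ * Equiv.swap x y) z = z) ↔ ∀ z, z ∉ A → σ z = z := by
        refine forall_congr' fun z => imp_congr_right fun hz => ?_
        rw [Equiv.Perm.mul_apply, Equiv.swap_apply_of_ne_of_ne (ne_of_mem_of_not_mem hx hz).symm
          (ne_of_mem_of_not_mem hy hz).symm]
      have hs : (fun z => (t (q⁻¹ ((σ * Equiv.swap x y)⁻¹ z))).1.1) =
          fun z => (t (q⁻¹ (σ⁻¹ z))).1.1 := by
        funext z
        rw [mul_inv_rev, Equiv.swap_inv, Equiv.Perm.mul_apply]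
        rcases eq_or_ne (σ⁻¹ z) x with h | h
        · rw [h, Equiv.swap_apply_left, hrow]
        · rcases eq_or_ne (σ⁻¹ z) y with h' | h'
          · rw [h', Equiv.swap_apply_right, hrow]
          · rw [Equiv.swap_apply_of_ne_of_ne h h']
      simp only [hF, hc, hs, Equiv.Perm.sign_mul, Equiv.Perm.sign_swap hxy]
      split_ifs <;> simp
    have h2 : ∑ σ, F σ = - ∑ σ, F σ := by
      rw [← Finset.sum_neg_distrib, ← Equiv.sum_comp (Equiv.mulRight (Equiv.swap x y))]
      exact Finset.sum_congr rfl fun σ _ => hneg σ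
    exact self_eq_neg.1 h2
  · simp only [if_neg hq, smul_zero, Finset.sum_const_zero]

/-- The polytabloid as an element of the Specht module. -/
def spechtGenerator : spechtSubmodule μ ι :=
  ⟨polytabloid μ t, Submodule.subset_span ⟨t, rfl⟩⟩

theorem coe_spechtRep (σ : Equiv.Perm ι) (x : spechtSubmodule μ ι) :
    (spechtRep μ ι σ x : (ι → ℕ) →₀ ℂ) = tabloidRep ι σ x := rfl

instance spechtSubmodule_finite : FiniteDimensional ℂ (spechtSubmodule μ ι) :=
  FiniteDimensional.span_of_finite ℂ (Set.finite_range _)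

/-- Any two tableaux of shape `μ` differ by a permutation of the entries, so the Specht module is
cyclic, generated by any one polytabloid. -/
theorem spechtSubmodule_induction {p : spechtSubmodule μ ι → Prop}
    (hgen : ∀ σ, p (spechtRep μ ι σ (spechtGenerator t))) (hzero : p 0)
    (hadd : ∀ x y, p x → p y → p (x + y)) (hsmul : ∀ (a : ℂ) x, p x → p (a • x)) : ∀ x, p x := by
  rintro ⟨x, hx⟩
  unfold spechtSubmodule at hx
  induction hx using Submodule.span_induction with
  | mem x h =>
    obtain ⟨T, rfl⟩ := h
    convert hgen (t.trans T.symm) using 1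
    apply Subtype.ext
    rw [coe_spechtRep]
    change _ = tabloidRep ι _ (polytabloid μ t)
    rw [tabloidRep_polytabloid]
    change polytabloid μ T = _
    congr 1
    refine Equiv.ext fun x => ?_
    simp [Equiv.Perm.inv_def]
  | zero => exact hzero
  | add x y hx hy h1 h2 => exact hadd ⟨x, hx⟩ ⟨y, hy⟩ h1 h2
  | smul a x hx h => exact hsmul a ⟨x, hx⟩ h

theorem intertwiningMap_eq_zero {V : Type} [AddCommGroup V] [Module ℂ V]
    {ρ : Representation ℂ (Equiv.Perm ι) V} (θ : (spechtRep μ ι).IntertwiningMap ρ)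
    (h : θ (spechtGenerator t) = 0) : θ = 0 := by
  apply Representation.IntertwiningMap.ext
  refine LinearMap.ext fun x => ?_
  change θ x = 0
  induction x using spechtSubmodule_induction t with
  | hgen σ => rw [Representation.IntertwiningMap.isIntertwining, h, map_zero]
  | hzero => exact map_zero θ
  | hadd x y hx hy => rw [map_add, hx, hy, add_zero]
  | hsmul a x hx => rw [map_smul, hx, smul_zero]

variable {c : ℕ → ℕ}

/-- The image of the generator is a function `v` on words, and a permutation acts on it by
precomposition. Each linear relation between translates of the polytabloid thus becomes a linear
relation between the values of `v` at the rearrangements of any word. This is applied to column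
permutations and to Garnir relations. -/
theorem sum_mul_wordExtend_eq_zero (θ : (spechtRep μ ι).IntertwiningMap (wordRep ι c))
    (a : Equiv.Perm ι → ℂ) (ha : ∑ σ, a σ • tabloidRep ι σ (polytabloid μ t) = 0) (f : ι → ℕ) :
    ∑ σ, a σ * wordExtend (θ (spechtGenerator t)) (fun x => f (σ x)) = 0 := by
  by_cases hf : ∀ j, (Finset.univ.filter fun x => f x = j).card = c j
  · have h1 : ∑ σ, a σ • spechtRep μ ι σ (spechtGenerator t) = 0 := by
      apply Subtype.ext
      rw [AddSubmonoidClass.coe_finsetSum]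
      exact ha
    have h2 := congrArg θ h1
    rw [map_sum, map_zero] at h2
    have h3 := congrFun h2 ⟨f, hf⟩
    rw [Finset.sum_apply] at h3
    refine Eq.trans ?_ h3
    refine Finset.sum_congr rfl fun σ _ => ?_
    rw [map_smul, Representation.IntertwiningMap.isIntertwining, Pi.smul_apply, smul_eq_mul,
      wordRep_apply_coe]
  · refine Finset.sum_eq_zero fun σ _ => ?_
    rw [wordExtend, dif_neg, mul_zero]
    rwa [content_comp_perm]

theorem wordExtend_comp_of_col (θ : (spechtRep μ ι).IntertwiningMap (wordRep ι c))
    {q : Equiv.Perm ι} (hq : ∀ x, (t (q x)).1.2 = (t x).1.2) (f : ι → ℕ) :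
    wordExtend (θ (spechtGenerator t)) (fun x => f (q x)) =
      ((Equiv.Perm.sign q : ℤ) : ℂ) * wordExtend (θ (spechtGenerator t)) f := by
  have := sum_mul_wordExtend_eq_zero t θ
    (fun σ => (if σ = q then 1 else 0) - if σ = 1 then ((Equiv.Perm.sign q : ℤ) : ℂ) else 0)
    (by simp [sub_smul, Finset.sum_sub_distrib, tabloidRep_polytabloid_of_col t hq]) f
  simpa [sub_mul, Finset.sum_sub_distrib, sub_eq_zero] using this

/-- A word is semistandard if it is weakly increasing along the rows and strictly increasing down
the columns of the tableau `t`. -/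
def IsSemistandard (f : ι → ℕ) : Prop :=
  (∀ x y, (t x).1.1 = (t y).1.1 → (t x).1.2 < (t y).1.2 → f x ≤ f y) ∧
    ∀ x y, (t x).1.2 = (t y).1.2 → (t x).1.1 < (t y).1.1 → f x < f y

theorem cell_ext {x y : ι} (h1 : (t x).1.1 = (t y).1.1) (h2 : (t x).1.2 = (t y).1.2) : x = y :=
  t.injective (Subtype.ext (Prod.ext h1 h2))

/-- The Garnir set consists of the cells of the column of `x` from `x` downwards and the cells of
the column of `y` from the top down to `y`. As `x` and `y` share a row, it has one cell more than
the column of `x`. The column of `y` is further to the right, hence not longer, so after a column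
permutation two cells of the set share a row. -/
theorem garnir_pigeonhole {x y : ι} (hrow : (t x).1.1 = (t y).1.1)
    (hcol : (t x).1.2 < (t y).1.2) (q : Equiv.Perm ι) (hq : ∀ z, (t (q z)).1.2 = (t z).1.2) :
    ∃ z ∈ Finset.univ.filter (fun z => ((t z).1.2 = (t x).1.2 ∧ (t x).1.1 ≤ (t z).1.1) ∨
        ((t z).1.2 = (t y).1.2 ∧ (t z).1.1 ≤ (t y).1.1)),
      ∃ w ∈ Finset.univ.filter (fun z => ((t z).1.2 = (t x).1.2 ∧ (t x).1.1 ≤ (t z).1.1) ∨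
        ((t z).1.2 = (t y).1.2 ∧ (t z).1.1 ≤ (t y).1.1)), z ≠ w ∧
      (t (q z)).1.1 = (t (q w)).1.1 := by
  have hlen : ∀ z, (t z).1.1 < μ.colLen (t z).1.2 := fun z =>
    YoungDiagram.mem_iff_lt_colLen.1 ((YoungDiagram.mem_cells _).1 (t z).2)
  have hlen' : ∀ z, (t z).1.2 = (t x).1.2 ∨ (t z).1.2 = (t y).1.2 →
      (t z).1.1 < μ.colLen (t x).1.2 := by
    rintro z (h | h)
    · rw [← h]
      exact hlen z
    · refine (hlen z).trans_le ?_
      rw [h]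
      exact μ.colLen_anti _ _ hcol.le
  refine Finset.exists_ne_map_eq_of_card_lt_of_maps_to (t := Finset.range (μ.colLen (t x).1.2))
    ?_ ?_
  · have hx := hlen x
    have e1 : (Finset.range (μ.colLen (t x).1.2 + 1)).card ≤ (Finset.univ.filter (fun z =>
        ((t z).1.2 = (t x).1.2 ∧ (t x).1.1 ≤ (t z).1.1) ∨
        ((t z).1.2 = (t y).1.2 ∧ (t z).1.1 ≤ (t y).1.1))).card := by
      have hmem1 : ∀ i, i < μ.colLen (t x).1.2 → (i, (t x).1.2) ∈ μ.cells := fun i hi =>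
        (YoungDiagram.mem_cells _).2 (YoungDiagram.mem_iff_lt_colLen.2 hi)
      have hmem2 : ∀ i, i ≤ (t y).1.1 → (i, (t y).1.2) ∈ μ.cells := fun i hi =>
        μ.up_left_mem hi le_rfl (t y).2
      -- The cells are listed down the column of `y` as far as the common row, then down the column
      -- of `x` starting from that same row. This repeated row accounts for the shift `i - 1`.
      refine Finset.card_le_card_of_injOn (fun i => if h : i ≤ (t y).1.1 then
        t.symm ⟨(i, (t y).1.2), hmem2 i h⟩ else if h' : i - 1 < μ.colLen (t x).1.2 then
          t.symm ⟨(i - 1, (t x).1.2), hmem1 _ h'⟩ else x) ?_ ?_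
      · intro i hi
        rw [Finset.mem_coe, Finset.mem_range] at hi
        rw [Finset.mem_coe, Finset.mem_filter]
        refine ⟨Finset.mem_univ _, ?_⟩
        by_cases h : i ≤ (t y).1.1
        · simp [h]
        · have h' : i - 1 < μ.colLen (t x).1.2 := by omega
          simp only [dif_neg h, dif_pos h', Equiv.apply_symm_apply]
          left
          simp only [true_and]
          omega
      · intro i hi j hj hij
        rw [Finset.mem_coe, Finset.mem_range] at hi hj
        dsimp only at hij
        split_ifs at hij with h1 h2 h3 h4 h5 h6 h7 h8
        all_goals first
          | (rw [t.symm.injective.eq_iff, Subtype.mk.injEq, Prod.mk.injEq] at hij; omega)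
          | omega
    rw [Finset.card_range] at e1 ⊢
    omega
  · intro z hz
    rw [Finset.mem_coe, Finset.mem_filter] at hz
    rw [Finset.mem_coe, Finset.mem_range]
    apply hlen'
    rw [hq]
    rcases hz.2 with h | h
    · exact Or.inl h.1
    · exact Or.inr h.1

end SpechtHom

/-! ### Semistandard words: the upper bound for equivariant maps -/

section SpechtHom

variable {ι : Type} [Fintype ι] [DecidableEq ι] {μ : YoungDiagram} (t : ι ≃ μ.cells) {c : ℕ → ℕ}

/-- The sets `Y \ σ(Y)` and `σ(Y) \ Y` have equal, nonzero size. The values lost on the former are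
at most `b`, those gained on the latter at least `a`. -/
theorem sum_lt_sum_comp_perm {f : ι → ℕ} {Y : Finset ι} {σ : Equiv.Perm ι} {a b : ℕ} (hab : b < a)
    (hY : ∀ z ∈ Y, f z ≤ b) (hX : ∀ z ∈ Y, σ z ∉ Y → a ≤ f (σ z)) (hσ : ¬ ∀ z ∈ Y, σ z ∈ Y) :
    ∑ z ∈ Y, f z < ∑ z ∈ Y, f (σ z) := by
  have hcard : (Y.image σ).card = Y.card := Finset.card_image_of_injective _ σ.injective
  have h1 : ∑ z ∈ Y, f (σ z) = ∑ z ∈ Y.image σ, f z :=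
    (Finset.sum_image fun _ _ _ _ h => σ.injective h).symm
  rw [h1]
  refine Finset.sum_sdiff_lt_sum_sdiff.1 ?_
  have h2 : (Y \ Y.image σ).card = (Y.image σ \ Y).card := Finset.card_sdiff_comm hcard.symm
  have h3 : (Y.image σ \ Y).Nonempty := by
    push Not at hσ
    obtain ⟨z, hz, hz'⟩ := hσ
    exact ⟨σ z, Finset.mem_sdiff.2 ⟨Finset.mem_image_of_mem _ hz, hz'⟩⟩
  calc ∑ z ∈ Y \ Y.image σ, f z ≤ (Y \ Y.image σ).card • b :=
        Finset.sum_le_card_nsmul _ _ _ fun z hz => hY z (Finset.mem_sdiff.1 hz).1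
    _ < (Y.image σ \ Y).card • a := by
        rw [h2, smul_eq_mul, smul_eq_mul]
        exact Nat.mul_lt_mul_of_pos_left hab (Finset.card_pos.2 h3)
    _ ≤ ∑ z ∈ Y.image σ \ Y, f z := by
        refine Finset.card_nsmul_le_sum _ _ _ fun z hz => ?_
        obtain ⟨h4, h5⟩ := Finset.mem_sdiff.1 hz
        obtain ⟨w, hw, rfl⟩ := Finset.mem_image.1 h4
        exact hX w hw h5

/-- A nonzero equivariant map from the Specht module to words does not vanish on all semistandard
words. -/
theorem exists_isSemistandard_ne_zero (θ : (spechtRep μ ι).IntertwiningMap (wordRep ι c))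
    (hθ : θ ≠ 0) : ∃ f : Words ι c, IsSemistandard t f.1 ∧ θ (spechtGenerator t) f ≠ 0 := by
  set v := θ (spechtGenerator t) with hv
  have hv0 : ∃ f, v f ≠ 0 := by
    by_contra! h
    exact hθ (intertwiningMap_eq_zero t θ (funext h))
  -- In the support of `v`, take a word whose sum of entries weighted by columns is largest and,
  -- among those, whose sum weighted by rows is largest. It turns out to be semistandard.
  set key : (ι → ℕ) → ℕ ×ₗ ℕ := fun f =>
    toLex (∑ x, f x * (t x).1.2, ∑ x, f x * (t x).1.1) with hkey
  obtain ⟨f, hf, hmax⟩ := Finset.exists_max_image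
    (Finset.univ.filter fun f : Words ι c => v f ≠ 0) (fun f => key f.1)
    (by obtain ⟨f, hf⟩ := hv0; exact ⟨f, by simpa using hf⟩)
  have hfv : wordExtend v f.1 ≠ 0 := by
    rw [wordExtend_coe]
    exact (Finset.mem_filter.1 hf).2
  have hmax' : ∀ g : ι → ℕ, key f.1 < key g → wordExtend v g = 0 := by
    intro g hg
    by_contra h
    by_cases hc : ∀ j, (Finset.univ.filter fun x => g x = j).card = c j
    · have := hmax ⟨g, hc⟩ (by
        rw [Finset.mem_filter, ← wordExtend_coe v]
        exact ⟨Finset.mem_univ _, h⟩)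
      exact absurd hg this.not_gt
    · exact h (dif_neg hc)
  have hcol : ∀ x y, (t x).1.2 = (t y).1.2 → (t x).1.1 < (t y).1.1 → f.1 x < f.1 y := by
    intro x y h1 h2
    by_contra! h3
    have hxy : x ≠ y := by
      rintro rfl
      exact lt_irrefl _ h2
    have hs := wordExtend_comp_of_col t θ (q := Equiv.swap x y) (fun z => by
      rcases eq_or_ne z x with rfl | hz
      · rw [Equiv.swap_apply_left, h1]
      · rcases eq_or_ne z y with rfl | hz'
        · rw [Equiv.swap_apply_right, h1]
        · rw [Equiv.swap_apply_of_ne_of_ne hz hz']) f.1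
    rw [Equiv.Perm.sign_swap hxy, Units.val_neg, Units.val_one, Int.cast_neg, Int.cast_one,
      neg_one_mul] at hs
    -- Exchanging two entries of a column negates `v`. Equal entries force `v f = - v f`. Entries in
    -- the wrong order give, after the exchange, a word with the same column sum and a larger row
    -- sum, where `v` vanishes by maximality.
    rcases h3.eq_or_lt with h | h
    · have h4 : (fun z => f.1 (Equiv.swap x y z)) = f.1 := by
        funext z
        rcases eq_or_ne z x with rfl | hz
        · rw [Equiv.swap_apply_left, h]
        · rcases eq_or_ne z y with rfl | hz'
          · rw [Equiv.swap_apply_right, h]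
          · rw [Equiv.swap_apply_of_ne_of_ne hz hz']
      rw [h4] at hs
      exact hfv (self_eq_neg.1 hs)
    · refine hfv (neg_eq_zero.1 (hs.symm.trans (hmax' _ ?_)))
      rw [hkey, Prod.Lex.toLex_lt_toLex]
      right
      have e1 := sum_mul_comp_swap f.1 (fun z => (t z).1.2) x y hxy
      have e2 := sum_mul_comp_swap f.1 (fun z => (t z).1.1) x y hxy
      dsimp only at e1 e2 ⊢
      rw [h1, sub_self, mul_zero, add_zero] at e1
      constructor
      · exact_mod_cast e1.symm
      · zify
        rw [e2]
        have : 0 < ((f.1 y : ℤ) - f.1 x) * (((t x).1.1 : ℤ) - (t y).1.1) :=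
          mul_pos_of_neg_of_neg (by omega) (by omega)
        omega
  refine ⟨f, ⟨?_, hcol⟩, (Finset.mem_filter.1 hf).2⟩
  intro x y hrow hlt
  by_contra! hgt
  -- A descent `f x > f y` in a row would make every value on the upper part `Y` of the Garnir set
  -- smaller than every value on the remaining, lower part.
  have hG := sum_mul_wordExtend_eq_zero t θ _ (sum_sign_tabloidRep_polytabloid t _
    fun q hq => garnir_pigeonhole t hrow hlt q hq) f.1
  set A := Finset.univ.filter (fun z => ((t z).1.2 = (t x).1.2 ∧ (t x).1.1 ≤ (t z).1.1) ∨
        ((t z).1.2 = (t y).1.2 ∧ (t z).1.1 ≤ (t y).1.1)) with hA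
  set Y := Finset.univ.filter (fun z => (t z).1.2 = (t y).1.2 ∧ (t z).1.1 ≤ (t y).1.1) with hYdef
  have hle : ∀ z, (t z).1.2 = (t x).1.2 → (t x).1.1 ≤ (t z).1.1 → f.1 x ≤ f.1 z := by
    intro z h1 h2
    rcases h2.eq_or_lt with h | h
    · rw [cell_ext t h h1.symm]
    · exact (hcol _ _ h1.symm h).le
  have hge : ∀ z ∈ Y, f.1 z ≤ f.1 y := by
    intro z hz
    obtain ⟨-, h1, h2⟩ := Finset.mem_filter.1 hz
    rcases h2.eq_or_lt with h | h
    · rw [cell_ext t h h1]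
    · exact (hcol _ _ h1 h).le
  have hYA : ∀ z ∈ A, z ∉ Y → (t z).1.2 = (t x).1.2 ∧ (t x).1.1 ≤ (t z).1.1 := by
    intro z hz hz'
    rcases (Finset.mem_filter.1 hz).2 with h | h
    · exact h
    · exact absurd (show z ∈ Y from Finset.mem_filter.2 ⟨Finset.mem_univ _, h⟩) hz'
  -- A permutation of the Garnir set that preserves `Y` is a column permutation, and its two signs
  -- cancel. Any other moves larger values into the right column and leads to a word where `v`
  -- vanishes by maximality. The relation thus says that a positive multiple of `v f` is zero.
  have hterm : ∀ σ : Equiv.Perm ι,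
      (if ∀ x, x ∉ A → σ x = x then ((Equiv.Perm.sign σ : ℤ) : ℂ) else 0) *
        wordExtend v (fun x => f.1 (σ x)) =
      if (∀ x, x ∉ A → σ x = x) ∧ ∀ z ∈ Y, σ z ∈ Y then wordExtend v f.1 else 0 := by
    intro σ
    by_cases h1 : ∀ x, x ∉ A → σ x = x
    swap
    · rw [if_neg h1, if_neg (fun h => h1 h.1), zero_mul]
    have hmem : ∀ z, σ z ∈ A ↔ z ∈ A := by
      intro z
      constructor
      · intro h
        by_contra h'
        rw [h1 z h'] at h
        exact h' h
      · intro h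
        by_contra h'
        exact h' ((σ.injective (h1 _ h')).symm ▸ h)
    rw [if_pos h1]
    by_cases h2 : ∀ z ∈ Y, σ z ∈ Y
    · rw [if_pos ⟨h1, h2⟩]
      have hmem2 : ∀ z, σ z ∈ Y ↔ z ∈ Y := by
        have h3 : Y.image σ = Y := Finset.eq_of_subset_of_card_le
          (fun w hw => by
            obtain ⟨z, hz, rfl⟩ := Finset.mem_image.1 hw
            exact h2 z hz)
          (Finset.card_image_of_injective _ σ.injective).ge
        intro z
        refine ⟨fun h => ?_, h2 z⟩
        rw [← h3] at h
        obtain ⟨w, hw, hw'⟩ := Finset.mem_image.1 h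
        exact σ.injective hw' ▸ hw
      have hq : ∀ z, (t (σ z)).1.2 = (t z).1.2 := by
        intro z
        by_cases hz : z ∈ A
        · by_cases hz' : z ∈ Y
          · rw [(Finset.mem_filter.1 ((hmem2 z).2 hz')).2.1, (Finset.mem_filter.1 hz').2.1]
          · rw [(hYA _ ((hmem z).2 hz) (fun h => hz' ((hmem2 z).1 h))).1, (hYA _ hz hz').1]
        · rw [h1 z hz]
      rw [wordExtend_comp_of_col t θ hq, ← mul_assoc, ← Int.cast_mul, ← Units.val_mul,
        Int.units_mul_self, Units.val_one, Int.cast_one, one_mul]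
    · rw [if_neg (fun h => h2 h.2), hmax', mul_zero]
      rw [hkey, Prod.Lex.toLex_lt_toLex]
      left
      dsimp only
      have hS := sum_lt_sum_comp_perm (σ := σ) hgt hge (fun z hz hz' => by
        have hzA : z ∈ A := Finset.mem_filter.2
          ⟨Finset.mem_univ _, Or.inr (Finset.mem_filter.1 hz).2⟩
        obtain ⟨h3, h4⟩ := hYA _ ((hmem z).2 hzA) hz'
        exact hle _ h3 h4) h2
      -- Only the sum over `Y` changes under `σ`, and it enters with the positive factor `(t y).1.2
      -- - (t x).1.2`.
      have hdec : ∀ g : ι → ℕ, ∑ z, g z * (t z).1.2 = ∑ z ∈ Finset.univ \ A, g z * (t z).1.2 +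
          ((t x).1.2 * ∑ z ∈ A, g z + ((t y).1.2 - (t x).1.2) * ∑ z ∈ Y, g z) := by
        intro g
        rw [← Finset.sum_sdiff (Finset.subset_univ A)]
        congr 1
        have hYsub : Y ⊆ A := fun z hz => Finset.mem_filter.2
          ⟨Finset.mem_univ _, Or.inr (Finset.mem_filter.1 hz).2⟩
        rw [← Finset.sum_sdiff hYsub, ← Finset.sum_sdiff hYsub, mul_add, add_assoc, ← add_mul,
          Nat.add_sub_cancel' hlt.le, Finset.mul_sum, Finset.mul_sum]
        congr 1
        · refine Finset.sum_congr rfl fun z hz => ?_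
          rw [Finset.mem_sdiff] at hz
          rw [(hYA z hz.1 hz.2).1, mul_comm]
        · refine Finset.sum_congr rfl fun z hz => ?_
          rw [(Finset.mem_filter.1 hz).2.1, mul_comm]
      have e1 : ∑ z ∈ A, f.1 (σ z) = ∑ z ∈ A, f.1 z := by
        rw [← Finset.sum_image (f := f.1) (fun _ _ _ _ h => σ.injective h)]
        congr 1
        refine Finset.eq_of_subset_of_card_le (fun w hw => ?_)
          (Finset.card_image_of_injective _ σ.injective).ge
        obtain ⟨z, hz, rfl⟩ := Finset.mem_image.1 hw
        exact (hmem z).2 hz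
      have e2 : ∑ z ∈ Finset.univ \ A, f.1 (σ z) * (t z).1.2 =
          ∑ z ∈ Finset.univ \ A, f.1 z * (t z).1.2 :=
        Finset.sum_congr rfl fun z hz => by rw [h1 z (Finset.mem_sdiff.1 hz).2]
      rw [hdec f.1, hdec fun z => f.1 (σ z), e1, e2]
      have := Nat.mul_lt_mul_of_pos_left hS (Nat.sub_pos_of_lt hlt)
      omega
  rw [Finset.sum_congr rfl fun σ _ => hterm σ, ← Finset.sum_filter, Finset.sum_const,
    nsmul_eq_mul, mul_eq_zero, Nat.cast_eq_zero, Finset.card_eq_zero] at hG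
  rcases hG with h | h
  · have : (1 : Equiv.Perm ι) ∈ Finset.univ.filter
        (fun σ : Equiv.Perm ι => (∀ x, x ∉ A → σ x = x) ∧ ∀ z ∈ Y, σ z ∈ Y) := by simp
    rw [h] at this
    exact absurd this (Finset.notMem_empty _)
  · exact hfv h

theorem finrank_intertwiningMap_specht_le :
    Module.finrank ℂ ((spechtRep μ ι).IntertwiningMap (wordRep ι c)) ≤
      Nat.card {f : Words ι c // IsSemistandard t f.1} := by
  have : Fintype {f : Words ι c // IsSemistandard t f.1} := Fintype.ofFinite _
  rw [Nat.card_eq_fintype_card, ← Module.finrank_fintype_fun_eq_card ℂ]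
  refine LinearMap.finrank_le_finrank_of_injective
    (f := ({ toFun := fun θ f => θ (spechtGenerator t) f.1
             map_add' := fun _ _ => rfl
             map_smul' := fun _ _ => rfl } :
      (spechtRep μ ι).IntertwiningMap (wordRep ι c) →ₗ[ℂ]
        ({f : Words ι c // IsSemistandard t f.1} → ℂ))) ?_
  rw [injective_iff_map_eq_zero]
  intro θ hθ
  by_contra h
  obtain ⟨f, hf, hne⟩ := exists_isSemistandard_ne_zero t θ h
  exact hne (congrFun hθ ⟨f, hf⟩)

end SpechtHom

/-! ### Semistandard words: the lower bound for equivariant maps -/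

section SpechtHom

variable {ι : Type} [Fintype ι] [DecidableEq ι] {μ : YoungDiagram} (t : ι ≃ μ.cells) {c : ℕ → ℕ}

/-- The word `f` has the same letters in the rows of the tabloid `r` as `g` in the rows of `t`. -/
def SameRows (g r f : ι → ℕ) : Prop :=
  ∀ i v, (Finset.univ.filter fun x => r x = i ∧ f x = v).card =
    (Finset.univ.filter fun x => (t x).1.1 = i ∧ g x = v).card

theorem sameRows_comp (g r f : ι → ℕ) (σ : Equiv.Perm ι) :
    SameRows t g (fun x => r (σ⁻¹ x)) f ↔ SameRows t g r fun x => f (σ x) := by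
  refine forall_congr' fun i => forall_congr' fun v => ?_
  rw [show (Finset.univ.filter fun x => r (σ⁻¹ x) = i ∧ f x = v).card =
    (Finset.univ.filter fun x => r x = i ∧ f (σ x) = v).card from
      Finset.card_bij (fun z _ => σ⁻¹ z) (by simp) (fun _ _ _ _ h => (σ⁻¹).injective h)
        fun z hz => ⟨σ z, by simpa using hz, by simp⟩]

open Classical in
/-- The map from tabloids to words which sends a tabloid to the sum of all words with the prescribed
letters in its rows. -/
def tabloidToWords (c : ℕ → ℕ) (g : ι → ℕ) : ((ι → ℕ) →₀ ℂ) →ₗ[ℂ] (Words ι c → ℂ) :=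
  Finsupp.linearCombination ℂ fun r f => if SameRows t g r f.1 then 1 else 0

/-- The equivariant map from the Specht module to words given by the word `g`. -/
def semistandardHom (c : ℕ → ℕ) (g : ι → ℕ) : (spechtRep μ ι).IntertwiningMap (wordRep ι c) where
  toLinearMap := tabloidToWords t c g ∘ₗ (spechtSubmodule μ ι).subtype
  isIntertwining' σ := by
    have h : tabloidToWords t c g ∘ₗ tabloidRep ι σ = wordRep ι c σ ∘ₗ tabloidToWords t c g := by
      refine Finsupp.lhom_ext fun r b => ?_
      funext f
      change tabloidToWords t c g (Finsupp.lmapDomain ℂ ℂ _ (Finsupp.single r b)) f =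
        wordRep ι c σ (tabloidToWords t c g (Finsupp.single r b)) f
      rw [Finsupp.lmapDomain_apply, Finsupp.mapDomain_single, wordRep_apply_coe]
      have hf : ∀ j, (Finset.univ.filter fun x => f.1 (σ x) = j).card = c j :=
        (content_comp_perm σ f.1).2 f.2
      rw [show wordExtend (tabloidToWords t c g (Finsupp.single r b)) (fun x => f.1 (σ x)) =
          tabloidToWords t c g (Finsupp.single r b) ⟨_, hf⟩ from dif_pos hf]
      simp only [tabloidToWords, Finsupp.linearCombination_single, Pi.smul_apply]
      classical exact congrArg (b • ·) (if_congr (sameRows_comp t g r f.1 σ) rfl rfl)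
    refine LinearMap.ext fun x => ?_
    exact LinearMap.congr_fun h x.1

open Classical in
theorem semistandardHom_generator (g : ι → ℕ) (f : Words ι c) :
    semistandardHom t c g (spechtGenerator t) f = ∑ q : Equiv.Perm ι,
      if (∀ x, (t (q x)).1.2 = (t x).1.2) ∧ SameRows t g (fun x => (t x).1.1) (fun x => f.1 (q x))
        then ((Equiv.Perm.sign q : ℤ) : ℂ) else 0 := by
  change tabloidToWords t c g (polytabloid μ t) f = _
  unfold polytabloid
  rw [map_sum, Finset.sum_apply]
  refine Finset.sum_congr rfl fun q _ => ?_
  by_cases hq : ∀ x, (t (q x)).1.2 = (t x).1.2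
  · rw [if_pos hq, tabloidToWords, Finsupp.linearCombination_single, Pi.smul_apply, smul_eq_mul,
      mul_ite, mul_one, mul_zero]
    refine if_congr ?_ rfl rfl
    rw [sameRows_comp t g (fun x => (t x).1.1), and_iff_right hq]
  · rw [if_neg hq, if_neg fun h => hq h.1, map_zero, Pi.zero_apply]

/-- The word `f ∘ q` is a rearrangement of `g` within rows, while `q` preserves columns. So the
column sum of `f` is that of a row rearrangement of `g`, and `g`, being sorted along rows, maximizes
it. In the case of equality `f ∘ q = g` is also sorted down the columns, which forces `f ∘ q = f`.
-/
theorem sum_col_le_of_sameRows {f g : ι → ℕ} (hf : IsSemistandard t f) (hg : IsSemistandard t g)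
    {q : Equiv.Perm ι} (hq : ∀ x, (t (q x)).1.2 = (t x).1.2)
    (hrel : SameRows t g (fun x => (t x).1.1) (fun x => f (q x))) :
    ∑ x, (t x).1.2 * f x ≤ ∑ x, (t x).1.2 * g x ∧
      (∑ x, (t x).1.2 * f x = ∑ x, (t x).1.2 * g x → f = g ∧ ∀ x, f (q x) = f x) := by
  obtain ⟨p, hp⟩ := exists_perm_comp_eq (f := fun x => ((t x).1.1, f (q x)))
    (g := fun x => ((t x).1.1, g x)) fun j => by simpa [Prod.ext_iff] using hrel j.1 j.2
  simp only [Prod.mk.injEq] at hp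
  have h1 : ∑ x, (t x).1.2 * f x = ∑ x, (t x).1.2 * g (p x) := by
    rw [← Equiv.sum_comp q]
    refine Finset.sum_congr rfl fun x _ => ?_
    rw [hq, (hp x).2]
  obtain ⟨h2, h3⟩ := sum_mul_comp_perm_le_of_sorted (a := fun x => (t x).1.1)
    (b := fun x => (t x).1.2) (f := g) (fun x y h h' => cell_ext t h h') (p := p)
    (fun x => (hp x).1) hg.1
  rw [h1]
  refine ⟨h2, fun h => ?_⟩
  have h4 : ∀ x, f (q x) = g x := fun x => by rw [← (hp x).2, h3 h]
  have h5 := comp_perm_eq_self_of_sorted (a := fun x => (t x).1.2)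
    (b := fun x => (t x).1.1) (f := f) (fun x y h h' => cell_ext t h' h) (p := q) hq
    (fun x y h h' => (hf.2 x y h h').le) (fun x y h h' => by
      rw [h4, h4]
      exact (hg.2 x y h h').le)
  exact ⟨funext fun x => by rw [← h5, h4], h5⟩

theorem eq_one_of_isSemistandard {f : ι → ℕ} (hf : IsSemistandard t f) {q : Equiv.Perm ι}
    (hq : ∀ x, (t (q x)).1.2 = (t x).1.2) (h : ∀ x, f (q x) = f x) : q = 1 := by
  refine Equiv.ext fun x => cell_ext t ?_ (hq x)
  rw [Equiv.Perm.one_apply]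
  rcases lt_trichotomy (t (q x)).1.1 (t x).1.1 with h1 | h1 | h1
  · exact absurd (h x) (hf.2 _ _ (hq x) h1).ne
  · exact h1
  · exact absurd (h x) (hf.2 _ _ (hq x).symm h1).ne'

/-- The maps attached to semistandard words are triangular with respect to the column sum. In a
vanishing linear combination choose the word `g` of largest column sum among those with nonzero
coefficient, and evaluate at `g`. Only its own map contributes there, and only through the identity
column permutation. -/
theorem card_le_finrank_intertwiningMap_specht :
    Nat.card {f : Words ι c // IsSemistandard t f.1} ≤
      Module.finrank ℂ ((spechtRep μ ι).IntertwiningMap (wordRep ι c)) := by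
  classical
  have : Fintype {f : Words ι c // IsSemistandard t f.1} := Fintype.ofFinite _
  have := intertwiningMap_finite (spechtRep μ ι) (wordRep ι c)
  rw [Nat.card_eq_fintype_card, ← Module.finrank_fintype_fun_eq_card ℂ]
  refine LinearMap.finrank_le_finrank_of_injective
    (f := Fintype.linearCombination ℂ
      fun g : {f : Words ι c // IsSemistandard t f.1} => semistandardHom t c g.1.1) ?_
  rw [injective_iff_map_eq_zero]
  intro a ha
  by_contra hne
  obtain ⟨g0, hg0⟩ := Function.ne_iff.1 hne
  obtain ⟨g, hg, hmax⟩ := Finset.exists_max_image (Finset.univ.filter fun g => a g ≠ 0)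
    (fun g => ∑ x, (t x).1.2 * g.1.1 x) ⟨g0, by simpa using hg0⟩
  rw [Finset.mem_filter] at hg
  apply hg.2
  have h1 : (∑ h, a h • semistandardHom t c h.1.1) (spechtGenerator t) g.1 = 0 := by
    rw [← Fintype.linearCombination_apply, ha]
    rfl
  rw [Representation.IntertwiningMap.sum_apply, Finset.sum_apply,
    Finset.sum_eq_single_of_mem g (Finset.mem_univ _)] at h1
  · rw [Representation.IntertwiningMap.smul_apply, Pi.smul_apply, smul_eq_mul,
      semistandardHom_generator, Finset.sum_eq_single_of_mem 1 (Finset.mem_univ _)] at h1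
    · rw [if_pos ⟨fun _ => rfl, fun _ _ => rfl⟩] at h1
      simpa using h1
    · intro q _ hq
      rw [if_neg]
      rintro ⟨h2, h3⟩
      exact hq (eq_one_of_isSemistandard t g.2 h2
        ((sum_col_le_of_sameRows t g.2 g.2 h2 h3).2 rfl).2)
  · intro h _ hh
    rw [Representation.IntertwiningMap.smul_apply, Pi.smul_apply, smul_eq_mul,
      semistandardHom_generator]
    by_cases hah : a h = 0
    · rw [hah, zero_mul]
    · rw [Finset.sum_eq_zero, mul_zero]
      intro q _
      rw [if_neg]
      rintro ⟨h2, h3⟩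
      obtain ⟨h4, h5⟩ := sum_col_le_of_sameRows t g.2 h.2 h2 h3
      have h6 := hmax h (Finset.mem_filter.2 ⟨Finset.mem_univ _, hah⟩)
      exact hh (Subtype.ext (Subtype.ext (h5 (le_antisymm h4 h6)).1.symm))

/-- The number of semistandard tableaux of a given shape and content. -/
def kostka (μ : YoungDiagram) (c : ℕ → ℕ) : ℕ :=
  Nat.card {T : SemistandardYoungTableau μ //
    ∀ j, (μ.cells.filter fun p => T p.1 p.2 = j).card = c j}

theorem card_isSemistandard : Nat.card {f : Words ι c // IsSemistandard t f.1} = kostka μ c := by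
  have hcell : ∀ x, ((t x).1.1, (t x).1.2) ∈ μ := fun x => (YoungDiagram.mem_cells _).1 (t x).2
  have hcard : ∀ (T : ℕ → ℕ → ℕ) (j : ℕ),
      (Finset.univ.filter fun x => T (t x).1.1 (t x).1.2 = j).card =
        (μ.cells.filter fun p => T p.1 p.2 = j).card := fun T j =>
    Finset.card_bij (fun z _ => (t z).1)
      (fun z hz => Finset.mem_filter.2 ⟨(t z).2, (Finset.mem_filter.1 hz).2⟩)
      (fun _ _ _ _ h => t.injective (Subtype.ext h))
      fun p hp => ⟨t.symm ⟨p, (Finset.mem_filter.1 hp).1⟩, by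
        rw [Finset.mem_filter, Equiv.apply_symm_apply]
        exact ⟨Finset.mem_univ _, (Finset.mem_filter.1 hp).2⟩, by rw [Equiv.apply_symm_apply]⟩
  symm
  refine Nat.card_eq_of_bijective (fun T => ⟨⟨fun x => T.1 (t x).1.1 (t x).1.2, fun j => ?_⟩,
    fun x y h1 h2 => ?_, fun x y h1 h2 => ?_⟩) ⟨?_, ?_⟩
  · rw [hcard, T.2]
  · dsimp only
    rw [h1]
    exact T.1.row_weak h2 (hcell y)
  · dsimp only
    rw [h1]
    exact T.1.col_strict h2 (hcell y)
  · intro T T' h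
    apply Subtype.ext
    ext i j
    by_cases hc : (i, j) ∈ μ.cells
    · have := congrFun (congrArg (fun f => f.1.1) h) (t.symm ⟨(i, j), hc⟩)
      simpa using this
    · rw [YoungDiagram.mem_cells] at hc
      rw [T.1.zeros hc, T'.1.zeros hc]
  · rintro ⟨f, hf1, hf2⟩
    have hT : ∀ {i j} (h : (i, j) ∈ μ), (fun i j => if h : (i, j) ∈ μ.cells then
      f.1 (t.symm ⟨(i, j), h⟩) else 0) i j = f.1 (t.symm ⟨(i, j), (YoungDiagram.mem_cells _).2 h⟩) :=
      fun h => dif_pos ((YoungDiagram.mem_cells _).2 h)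
    have hTx : ∀ x, (fun i j => if h : (i, j) ∈ μ.cells then
      f.1 (t.symm ⟨(i, j), h⟩) else 0) (t x).1.1 (t x).1.2 = f.1 x := fun x => by
      rw [hT (hcell x)]
      exact congrArg f.1 (t.symm_apply_apply x)
    refine ⟨⟨⟨fun i j => if h : (i, j) ∈ μ.cells then f.1 (t.symm ⟨(i, j), h⟩) else 0,
      fun {i j1 j2} h1 h2 => ?_, fun {i1 i2 j} h1 h2 => ?_, fun {i j} h => dif_neg h⟩, ?_⟩, ?_⟩
    · refine (hT (μ.up_left_mem le_rfl h1.le h2)).trans_le ((hf1 _ _ ?_ ?_).trans_eq (hT h2).symm)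
      · simp
      · simpa using h1
    · refine (hT (μ.up_left_mem h1.le le_rfl h2)).trans_lt ((hf2 _ _ ?_ ?_).trans_eq (hT h2).symm)
      · simp
      · simpa using h1
    · intro j
      refine (hcard (fun i j => if h : (i, j) ∈ μ.cells then f.1 (t.symm ⟨(i, j), h⟩) else 0)
        j).symm.trans ?_
      rw [← f.2 j]
      exact congrArg Finset.card (Finset.filter_congr fun x _ => (hTx x).symm ▸ Iff.rfl)
    · exact Subtype.ext (Subtype.ext (funext hTx))

theorem finrank_intertwiningMap_specht (t : ι ≃ μ.cells) :
    Module.finrank ℂ ((spechtRep μ ι).IntertwiningMap (wordRep ι c)) = kostka μ c := by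
  rw [← card_isSemistandard t]
  exact le_antisymm (finrank_intertwiningMap_specht_le t) (card_le_finrank_intertwiningMap_specht t)

end SpechtHom

/-! ### Young's rule -/

section Orthogonality

variable {ι : Type} [Fintype ι] [DecidableEq ι] {μ ν : YoungDiagram}

theorem card_row (t : ι ≃ μ.cells) (j : ℕ) :
    (Finset.univ.filter fun x => (t x).1.1 = j).card = μ.rowLen j := by
  rw [YoungDiagram.rowLen_eq_card, YoungDiagram.row]
  exact Finset.card_bij (fun z _ => (t z).1)
    (fun z hz => Finset.mem_filter.2 ⟨(t z).2, (Finset.mem_filter.1 hz).2⟩)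
    (fun _ _ _ _ h => t.injective (Subtype.ext h)) fun p hp => by
      rw [Finset.mem_filter] at hp
      exact ⟨t.symm ⟨p, hp.1⟩, by simpa using hp.2, by simp⟩

theorem youngDiagram_ext_rowLen (h : ∀ i, μ.rowLen i = ν.rowLen i) : μ = ν := by
  refine YoungDiagram.ext (Finset.ext fun p => ?_)
  rw [YoungDiagram.mem_cells, YoungDiagram.mem_cells, ← Prod.mk.eta (p := p),
    YoungDiagram.mem_iff_lt_rowLen, YoungDiagram.mem_iff_lt_rowLen, h]

theorem spechtSubmodule_apply_eq_zero (x : spechtSubmodule ν ι) {f : ι → ℕ}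
    (hf : ¬ ∀ j, (Finset.univ.filter fun x => f x = j).card = ν.rowLen j) :
    (x : (ι → ℕ) →₀ ℂ) f = 0 := by
  have h : spechtSubmodule ν ι ≤ Finsupp.supported ℂ ℂ
      {f : ι → ℕ | ∀ j, (Finset.univ.filter fun x => f x = j).card = ν.rowLen j} := by
    unfold spechtSubmodule
    rw [Submodule.span_le]
    rintro _ ⟨T, rfl⟩
    refine Submodule.sum_mem _ fun q _ => ?_
    split_ifs
    · refine Finsupp.single_mem_supported ℂ _ fun j => ?_
      exact card_row ((q⁻¹ : Equiv.Perm ι).trans T) j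
    · exact Submodule.zero_mem _
  by_contra h0
  exact hf (h x.2 (Finset.mem_coe.2 (Finsupp.mem_support_iff.2 h0)))

/-- The embedding of the Specht module in the permutation module of its shape. -/
def spechtToWords (ν : YoungDiagram) (ι : Type) [Fintype ι] [DecidableEq ι] :
    (spechtRep ν ι).IntertwiningMap (wordRep ι ν.rowLen) where
  toLinearMap :=
    { toFun := fun x f => (x : (ι → ℕ) →₀ ℂ) f.1
      map_add' := fun _ _ => rfl
      map_smul' := fun _ _ => rfl }
  isIntertwining' σ := by
    refine LinearMap.ext fun x => funext fun f => ?_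
    change tabloidRep ι σ x.1 f.1 = 1 * x.1 ((wordAct ι ν.rowLen σ)⁻¹ f).1
    rw [one_mul, ← map_inv]
    have h : f.1 = fun y => (wordAct ι ν.rowLen σ⁻¹ f).1 (σ⁻¹ y) := by
      funext y
      rw [wordAct_apply, inv_inv]
      simp
    conv_lhs => rw [h]
    change Finsupp.lmapDomain ℂ ℂ _ x.1 _ = _
    rw [Finsupp.lmapDomain_apply]
    refine Finsupp.mapDomain_apply (f := fun (f : ι → ℕ) y => f (σ⁻¹ y)) ?_ _ _
    intro f g hfg
    funext y
    simpa using congrFun hfg (σ y)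

theorem spechtToWords_injective : Function.Injective (spechtToWords ν ι) := by
  intro x y hxy
  apply Subtype.ext
  refine Finsupp.ext fun f => ?_
  by_cases hf : ∀ j, (Finset.univ.filter fun x => f x = j).card = ν.rowLen j
  · exact congrFun hxy ⟨f, hf⟩
  · rw [spechtSubmodule_apply_eq_zero x hf, spechtSubmodule_apply_eq_zero y hf]

theorem finrank_specht_le_finrank_words (μ ν : YoungDiagram) :
    Module.finrank ℂ ((spechtRep μ ι).IntertwiningMap (spechtRep ν ι)) ≤
      Module.finrank ℂ ((spechtRep μ ι).IntertwiningMap (wordRep ι ν.rowLen)) := by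
  have := intertwiningMap_finite (spechtRep μ ι) (wordRep ι ν.rowLen)
  refine LinearMap.finrank_le_finrank_of_injective
    (f := ({ toFun := fun θ => (spechtToWords ν ι).comp θ
             map_add' := fun a b => by
               apply Representation.IntertwiningMap.ext
               refine LinearMap.ext fun x => ?_
               exact map_add (spechtToWords ν ι) (a x) (b x)
             map_smul' := fun c a => by
               apply Representation.IntertwiningMap.ext
               refine LinearMap.ext fun x => ?_
               exact map_smul (spechtToWords ν ι) c (a x) } :
           (spechtRep μ ι).IntertwiningMap (spechtRep ν ι) →ₗ[ℂ]
           (spechtRep μ ι).IntertwiningMap (wordRep ι ν.rowLen))) ?_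
  intro a b hab
  apply Representation.IntertwiningMap.ext
  refine LinearMap.ext fun x => ?_
  exact spechtToWords_injective (congrArg (fun θ : (spechtRep μ ι).IntertwiningMap
    (wordRep ι ν.rowLen) => θ x) hab)

theorem row_le_of_isSemistandard (s : ι ≃ μ.cells) {f : ι → ℕ} (hf : IsSemistandard s f) :
    ∀ i x, (s x).1.1 = i → i ≤ f x := by
  intro i
  induction i with
  | zero => exact fun _ _ => Nat.zero_le _
  | succ i ih =>
    intro x hx
    have hmem : (i, (s x).1.2) ∈ μ.cells := μ.up_left_mem (hx ▸ Nat.le_succ i) le_rfl (s x).2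
    have h1 := ih (s.symm ⟨_, hmem⟩) (by simp)
    have h2 := hf.2 (s.symm ⟨_, hmem⟩) x (by simp) (by simp [hx])
    omega

theorem isSemistandard_row (s : ι ≃ μ.cells) : IsSemistandard s fun x => (s x).1.1 :=
  ⟨fun _ _ h _ => h.le, fun _ _ _ h => h⟩

/-- This comparison of one number takes the place of the dominance order. Rows are numbered from `0`
and columns increase strictly, so every entry is at least its row number, and the entries sum to the
row sum of `ν`. -/
theorem sum_row_le (s : ι ≃ μ.cells) (t : ι ≃ ν.cells) (f : Words ι ν.rowLen)
    (hf : IsSemistandard s f.1) :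
    ∑ x, (s x).1.1 ≤ ∑ x, (t x).1.1 ∧
      (∑ x, (s x).1.1 = ∑ x, (t x).1.1 → ∀ x, (s x).1.1 = f.1 x) := by
  obtain ⟨p, hp⟩ := exists_perm_comp_eq (f := f.1) (g := fun x => (t x).1.1) fun j => by
    rw [f.2, card_row]
  have h1 : ∑ x, (t x).1.1 = ∑ x, f.1 x := by
    rw [← Equiv.sum_comp p]
    exact Finset.sum_congr rfl fun x _ => hp x
  have h2 : ∀ x, (s x).1.1 ≤ f.1 x := fun x => row_le_of_isSemistandard s hf _ x rfl
  rw [h1]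
  refine ⟨Finset.sum_le_sum fun x _ => h2 x, fun h => ?_⟩
  intro x
  exact (Finset.sum_eq_sum_iff_of_le fun x _ => h2 x).1 h x (Finset.mem_univ _)

theorem exists_isSemistandard_of_finrank_ne_zero (s : ι ≃ μ.cells)
    (h : Module.finrank ℂ ((spechtRep μ ι).IntertwiningMap (spechtRep ν ι)) ≠ 0) :
    ∃ f : Words ι ν.rowLen, IsSemistandard s f.1 := by
  have h1 := (finrank_specht_le_finrank_words (ι := ι) μ ν).trans
    (finrank_intertwiningMap_specht_le s)
  by_contra! h2
  have : IsEmpty {f : Words ι ν.rowLen // IsSemistandard s f.1} := ⟨fun f => h2 f.1 f.2⟩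
  rw [Nat.card_of_isEmpty] at h1
  omega

/-- A nonzero space of maps in one direction means nonzero spaces in both, hence equal row sums. The
semistandard word of content `ν` must then be the row function of `μ`, so the row lengths agree. -/
theorem finrank_specht_of_ne (s : ι ≃ μ.cells) (t : ι ≃ ν.cells) (hne : μ ≠ ν) :
    Module.finrank ℂ ((spechtRep μ ι).IntertwiningMap (spechtRep ν ι)) = 0 := by
  by_contra h
  obtain ⟨f, hf⟩ := exists_isSemistandard_of_finrank_ne_zero s h
  obtain ⟨g, hg⟩ := exists_isSemistandard_of_finrank_ne_zero t
    (by rwa [finrank_intertwiningMap_comm])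
  have h1 := (sum_row_le s t f hf).2 (le_antisymm (sum_row_le s t f hf).1 (sum_row_le t s g hg).1)
  refine hne (youngDiagram_ext_rowLen fun i => ?_)
  rw [← card_row s, ← f.2 i]
  simp only [h1]

/-- The only semistandard word of shape `μ` whose content is the row lengths of `μ` is the row
function, so the dimension is at most one. It is not zero because of the identity map. -/
theorem finrank_specht_self (s : ι ≃ μ.cells) :
    Module.finrank ℂ ((spechtRep μ ι).IntertwiningMap (spechtRep μ ι)) = 1 := by
  have h1 := (finrank_specht_le_finrank_words (ι := ι) μ μ).trans
    (finrank_intertwiningMap_specht_le s)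
  have h2 : Nat.card {f : Words ι μ.rowLen // IsSemistandard s f.1} = 1 := by
    rw [Nat.card_eq_one_iff_unique]
    refine ⟨⟨fun f g => ?_⟩, ⟨⟨⟨fun x => (s x).1.1, card_row s⟩, isSemistandard_row s⟩⟩⟩
    apply Subtype.ext
    apply Subtype.ext
    funext x
    rw [← (sum_row_le s s f.1 f.2).2 rfl x, ← (sum_row_le s s g.1 g.2).2 rfl x]
  -- This needs the polytabloid to be nonzero. If it vanished, so would all maps to words, against
  -- the lower bound of one.
  have h3 : Module.finrank ℂ ((spechtRep μ ι).IntertwiningMap (spechtRep μ ι)) ≠ 0 := by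
    intro h
    have hg : spechtGenerator s ≠ 0 := by
      intro h0
      have h4 := card_le_finrank_intertwiningMap_specht (c := μ.rowLen) s
      rw [h2] at h4
      have : Subsingleton ((spechtRep μ ι).IntertwiningMap (wordRep ι μ.rowLen)) :=
        ⟨fun a b => by
          rw [intertwiningMap_eq_zero s a (by rw [h0, map_zero]),
            intertwiningMap_eq_zero s b (by rw [h0, map_zero])]⟩
      rw [Module.finrank_zero_of_subsingleton] at h4
      omega
    have hfin := intertwiningMap_finite (spechtRep μ ι) (spechtRep μ ι)
    let _ : AddCommGroup ((spechtRep μ ι).IntertwiningMap (spechtRep μ ι)) :=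
      Module.addCommMonoidToAddCommGroup ℂ
    have hsub := Module.finrank_zero_iff.1 h
    have := Subsingleton.elim (Representation.IntertwiningMap.id (spechtRep μ ι)) 0
    exact hg (congrArg (fun θ : (spechtRep μ ι).IntertwiningMap (spechtRep μ ι) =>
      θ (spechtGenerator s)) this)
  omega

end Orthogonality

/-- Orthonormal functions on a group whose number is at least that of the conjugacy classes span the
class functions. -/
theorem eq_sum_of_orthonormal {G L : Type} [Group G] [Fintype G] [Fintype L] [DecidableEq L]
    (hcard : Nat.card (ConjClasses G) ≤ Fintype.card L) (χ : L → G → ℂ)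
    (hχ : ∀ l g h, χ l (h * g * h⁻¹) = χ l g)
    (horth : ∀ l m, (Fintype.card G : ℂ)⁻¹ * ∑ g, χ l g⁻¹ * χ m g = if l = m then 1 else 0)
    (u : G → ℂ) (hu : ∀ g h, u (h * g * h⁻¹) = u g) (g : G) :
    u g = ∑ l, ((Fintype.card G : ℂ)⁻¹ * ∑ g, χ l g⁻¹ * u g) * χ l g := by
  have := Fintype.ofFinite (ConjClasses G)
  -- `P` takes a class function to its scalar products with the `χ l`. Orthonormality makes it
  -- surjective, and the bound on the number of classes then makes it bijective, so a class function
  -- is determined by its coefficients.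
  let P : (ConjClasses G → ℂ) →ₗ[ℂ] (L → ℂ) :=
    { toFun := fun w l => (Fintype.card G : ℂ)⁻¹ * ∑ g, χ l g⁻¹ * w (ConjClasses.mk g)
      map_add' := fun v w => by
        funext l
        simp only [Pi.add_apply, mul_add, Finset.sum_add_distrib]
      map_smul' := fun c v => by
        funext l
        simp only [Pi.smul_apply, smul_eq_mul, RingHom.id_apply, Finset.mul_sum]
        exact Finset.sum_congr rfl fun g _ => by ring }
  have hlift : ∀ v : G → ℂ, (∀ g h, v (h * g * h⁻¹) = v g) →
      ∃ w : ConjClasses G → ℂ, ∀ g, w (ConjClasses.mk g) = v g := fun v hv =>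
    ⟨Quotient.lift v fun a b hab => by
      obtain ⟨c, rfl⟩ := isConj_iff.1 hab
      exact (hv a c).symm, fun _ => rfl⟩
  choose X hX using fun l => hlift (χ l) (hχ l)
  have hPX : ∀ m, P (X m) = Pi.single m 1 := by
    intro m
    funext l
    change (Fintype.card G : ℂ)⁻¹ * ∑ g, χ l g⁻¹ * X m (ConjClasses.mk g) = _
    simp only [hX]
    rw [horth, Pi.single_apply]
  have hsurj : Function.Surjective P := by
    intro y
    refine ⟨∑ m, y m • X m, ?_⟩
    rw [map_sum]
    funext l
    rw [Finset.sum_apply, Finset.sum_eq_single l]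
    · rw [map_smul, hPX]
      simp
    · intro m _ hm
      rw [map_smul, hPX, Pi.smul_apply, Pi.single_eq_of_ne hm.symm, smul_zero]
    · simp
  have hinj : Function.Injective P := by
    refine (LinearMap.injective_iff_surjective_of_finrank_eq_finrank ?_).2 hsurj
    refine le_antisymm ?_ (LinearMap.finrank_le_finrank_of_surjective hsurj)
    rw [Module.finrank_fintype_fun_eq_card, Module.finrank_fintype_fun_eq_card,
      ← Nat.card_eq_fintype_card]
    exact hcard
  obtain ⟨U, hU⟩ := hlift u hu
  have hU2 : U = ∑ m, P U m • X m := by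
    apply hinj
    rw [map_sum]
    simp only [map_smul, hPX]
    funext l
    simp [Finset.sum_apply, Pi.single_apply]
  have h := congrFun hU2 (ConjClasses.mk g)
  rw [hU, Finset.sum_apply] at h
  rw [h]
  refine Finset.sum_congr rfl fun m _ => ?_
  rw [Pi.smul_apply, smul_eq_mul, hX]
  change ((Fintype.card G : ℂ)⁻¹ * ∑ g, χ m g⁻¹ * U (ConjClasses.mk g)) * _ = _
  simp only [hU]

/-- The Young diagrams with `n` cells. -/
abbrev DiagramOf (n : ℕ) : Type := {μ : YoungDiagram // μ.card = n}

instance diagramOf_finite (n : ℕ) : Finite (DiagramOf n) :=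
  Finite.of_injective (fun μ : DiagramOf n =>
    (⟨μ.1.cells, Finset.mem_powerset.2 (youngDiagram_cells_subset _ μ.2.le)⟩ :
      (Finset.range n ×ˢ Finset.range n).powerset)) fun _ _ h =>
    Subtype.ext (YoungDiagram.ext (congrArg Subtype.val h))

instance diagramOf_fintype (n : ℕ) : Fintype (DiagramOf n) := Fintype.ofFinite _

theorem card_cellsOfRowLens (w : List ℕ) : (YoungDiagram.cellsOfRowLens w).card = w.sum := by
  induction w with
  | nil => rfl
  | cons a w ih =>
    rw [YoungDiagram.cellsOfRowLens, Finset.card_union_of_disjoint, Finset.card_map, ih,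
      Finset.card_product, Finset.card_singleton, Finset.card_range, one_mul, List.sum_cons]
    rw [Finset.disjoint_left]
    intro p hp hp'
    rw [Finset.mem_product, Finset.mem_singleton] at hp
    obtain ⟨q, -, rfl⟩ := Finset.mem_map.1 hp'
    exact absurd hp.1 (Nat.succ_ne_zero _)

/-- The cycle type determines the conjugacy class, and the parts of a partition are recovered as the
row lengths of its diagram. An inequality is enough for the spanning argument. -/
theorem card_conjClasses_perm_le (ι : Type) [Fintype ι] [DecidableEq ι] :
    Nat.card (ConjClasses (Equiv.Perm ι)) ≤ Fintype.card (DiagramOf (Fintype.card ι)) := by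
  rw [← Nat.card_eq_fintype_card]
  let F : ConjClasses (Equiv.Perm ι) → (Fintype.card ι).Partition :=
    Quotient.lift Equiv.Perm.partition fun a b hab => Equiv.Perm.partition_eq_of_isConj.1 hab
  have hF : Function.Injective F := by
    intro a b
    induction a using Quotient.inductionOn with | _ a
    induction b using Quotient.inductionOn with | _ b
    intro h
    exact Quotient.sound (Equiv.Perm.partition_eq_of_isConj.2 h)
  let D : (Fintype.card ι).Partition → DiagramOf (Fintype.card ι) := fun p =>
    ⟨YoungDiagram.ofRowLens (p.parts.sort fun a b => a ≥ b)
      (List.sortedGE_iff_pairwise.2 (Multiset.pairwise_sort _ _)), by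
      change (YoungDiagram.cellsOfRowLens _).card = _
      rw [card_cellsOfRowLens, ← Multiset.sum_coe, Multiset.sort_eq, p.parts_sum]⟩
  have hD : Function.Injective D := by
    intro p q h
    have h1 := congrArg (fun d : DiagramOf (Fintype.card ι) => d.1.rowLens) h
    simp only [D] at h1
    rw [YoungDiagram.rowLens_ofRowLens_eq_self, YoungDiagram.rowLens_ofRowLens_eq_self] at h1
    · apply Nat.Partition.ext
      rw [← Multiset.sort_eq p.parts fun a b => a ≥ b, h1, Multiset.sort_eq]
    · exact fun x hx => q.parts_pos ((Multiset.mem_sort _).1 hx)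
    · exact fun x hx => p.parts_pos ((Multiset.mem_sort _).1 hx)
  exact Nat.card_le_card_of_injective _ (hD.comp hF)

/-- The decomposition of a character of the symmetric group into characters of Specht modules. -/
theorem trace_eq_sum_specht {ι : Type} [Fintype ι] [DecidableEq ι] {V : Type} [AddCommMonoid V]
    [Module ℂ V] [Module.Finite ℂ V] (ρ : Representation ℂ (Equiv.Perm ι) V) (σ : Equiv.Perm ι) :
    LinearMap.trace ℂ V (ρ σ) = ∑ μ : DiagramOf (Fintype.card ι),
      (Module.finrank ℂ ((spechtRep μ.1 ι).IntertwiningMap ρ) : ℂ) *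
        LinearMap.trace ℂ _ (spechtRep μ.1 ι σ) := by
  classical
  have t : ∀ μ : DiagramOf (Fintype.card ι), ι ≃ μ.1.cells := fun μ =>
    Fintype.equivOfCardEq (by rw [Fintype.card_coe]; exact μ.2.symm)
  have := eq_sum_of_orthonormal (card_conjClasses_perm_le ι)
    (fun (μ : DiagramOf (Fintype.card ι)) σ => LinearMap.trace ℂ _ (spechtRep μ.1 ι σ))
    (fun μ g h => trace_conj_eq _ _ _) (fun μ ν => by
      rw [← finrank_intertwiningMap_eq]
      split_ifs with h
      · rw [h, finrank_specht_self (t ν), Nat.cast_one]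
      · rw [finrank_specht_of_ne (t μ) (t ν) (fun h' => h (Subtype.ext h')), Nat.cast_zero])
    (fun σ => LinearMap.trace ℂ V (ρ σ)) (fun g h => trace_conj_eq _ _ _) σ
  rw [this]
  refine Finset.sum_congr rfl fun μ _ => ?_
  rw [finrank_intertwiningMap_eq]

/-- Young's rule. -/
theorem trace_wordRep_eq_sum_kostka {ι : Type} [Fintype ι] [DecidableEq ι] (c : ℕ → ℕ)
    (σ : Equiv.Perm ι) :
    LinearMap.trace ℂ _ (wordRep ι c σ) = ∑ μ : DiagramOf (Fintype.card ι),
      (kostka μ.1 c : ℂ) * LinearMap.trace ℂ _ (spechtRep μ.1 ι σ) := by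
  rw [trace_eq_sum_specht]
  refine Finset.sum_congr rfl fun μ _ => ?_
  rw [finrank_intertwiningMap_specht (Fintype.equivOfCardEq (by
    rw [Fintype.card_coe]
    exact μ.2.symm))]

/-! ### Monomial representations on words -/

section ColoredWords

variable {r : ℕ} {ι κ : Type} [Fintype ι] [DecidableEq ι] [Fintype κ] [DecidableEq κ]

theorem GG.ext_mat {g h : GG r ι} (H : g.mat = h.mat) : g = h :=
  Subtype.ext (Units.ext H)

instance GG.finite [NeZero r] : Finite (GG r ι) := by
  have hS : {c : ℂ | c = 0 ∨ c ^ r = 1}.Finite := by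
    refine Set.Finite.subset
      ((Set.finite_singleton 0).union (Polynomial.nthRoots r (1 : ℂ)).toFinset.finite_toSet) ?_
    rintro c (rfl | hc)
    · exact Or.inl rfl
    · right
      rw [Finset.mem_coe, Multiset.mem_toFinset, Polynomial.mem_nthRoots (NeZero.pos r)]
      exact hc
  have := hS.to_subtype
  refine Finite.of_injective (fun (g : GG r ι) (i j : ι) =>
    (⟨g.mat i j, ?_⟩ : {c : ℂ | c = 0 ∨ c ^ r = 1})) fun g h H => ?_
  · by_cases h : g.mat i j = 0
    · exact Or.inl h
    · exact Or.inr (g.2.root i j h)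
  · refine GG.ext_mat (Matrix.ext fun i j => ?_)
    exact congrArg Subtype.val (congrFun (congrFun H i) j)

instance GG.fintype [NeZero r] : Fintype (GG r ι) := Fintype.ofFinite _

/-- Monomial matrices with a given permutation and given nonzero entries. -/
theorem GG.exists_perm_entries (σ : Equiv.Perm ι) (c : ι → ℂ) (hc : ∀ j, c j ≠ 0 ∧ c j ^ r = 1) :
    ∃ g : GG r ι, g.perm = σ ∧ ∀ j, g.mat (σ j) j = c j := by
  have hmul : ∀ (σ τ : Equiv.Perm ι) (c d : ι → ℂ), σ * τ = 1 → (∀ j, c (τ j) * d j = 1) →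
      (Matrix.of fun i j => if i = σ j then c j else 0) *
        (Matrix.of fun i j => if i = τ j then d j else 0) = 1 := by
    intro σ τ c d h hcd
    refine Matrix.ext fun i j => ?_
    have h2 : σ (τ j) = j := by rw [← Equiv.Perm.mul_apply, h, Equiv.Perm.one_apply]
    simp [Matrix.mul_apply, Matrix.one_apply, h2, hcd]
  have hA := (isColoredMonomial_iff (r := r) (Matrix.of fun i j => if i = σ j then c j else 0)).2
    ⟨σ, c, hc, rfl⟩
  have hent : ∀ j, (if σ j = σ j then c j else 0) = c j := fun j => if_pos rfl
  refine ⟨⟨⟨_, _, hmul σ σ⁻¹ c (fun j => (c (σ⁻¹ j))⁻¹) (mul_inv_cancel σ) fun j =>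
    mul_inv_cancel₀ (hc _).1, hmul σ⁻¹ σ _ c (inv_mul_cancel σ) fun j => ?_⟩, hA⟩, ?_, ?_⟩
  · have : σ⁻¹ (σ j) = j := by simp
    rw [this, inv_mul_cancel₀ (hc _).1]
  · refine Equiv.ext fun j => GG.perm_eq_of_ne_zero _ ?_
    change (if σ j = σ j then c j else 0) ≠ 0
    rw [hent]
    exact (hc j).1
  · exact hent

/-- The product of the inverse powers of the nonzero entries of `g`, where `v i` is the exponent for
the entry in row `i`. -/
def GG.weight (g : GG r ι) (v : ι → ℕ) : ℂ := ∏ j, (g.mat (g.perm j) j)⁻¹ ^ v (g.perm j)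

theorem GG.weight_one (v : ι → ℕ) : GG.weight (1 : GG r ι) v = 1 := by
  have : (1 : GG r ι).perm = 1 := map_one GG.permHom
  simp [GG.weight, this, GG.mat_one]

/-- Together with `GG.weight_one`, this is the cocycle identity that makes `coloredWordRep` a
representation. -/
theorem GG.weight_mul (g h : GG r ι) (v : ι → ℕ) :
    (g * h).weight v = g.weight v * h.weight fun j => v (g.perm j) := by
  have h1 : g.weight v = ∏ j, (g.mat (g.perm (h.perm j)) (h.perm j))⁻¹ ^ v (g.perm (h.perm j)) :=
    (Equiv.prod_comp h.perm fun j => (g.mat (g.perm j) j)⁻¹ ^ v (g.perm j)).symm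
  rw [h1, GG.weight, GG.weight, ← Finset.prod_mul_distrib]
  refine Finset.prod_congr rfl fun j _ => ?_
  rw [GG.perm_mul, Equiv.Perm.mul_apply, GG.mat_mul_apply, mul_inv, mul_pow]

theorem GG.weight_const (g : GG r ι) (a : ℕ) :
    g.weight (fun _ => a) = (GG.chi g)⁻¹ ^ a := by
  change ∏ j, (g.mat (g.perm j) j)⁻¹ ^ a = (∏ j, g.mat (g.perm j) j)⁻¹ ^ a
  rw [Finset.prod_pow, Finset.prod_inv_distrib]

/-- The monomial representation of `G_n` on functions on words with letters in `Fin r × ℕ` in which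
each letter `j` occurs `m j` times. A letter `(i, j)` contributes the character of weight
`-(i + 1)`. -/
def coloredWordRep (ι : Type) [Fintype ι] [DecidableEq ι] (m : Fin r × ℕ → ℕ) :
    Representation ℂ (GG r ι) (Words ι m → ℂ) :=
  cocycleRep ((wordAct ι m).comp GG.permHom) (fun g x => g.weight fun j => (x.1 j).1 + 1)
    (fun _ => GG.weight_one _) fun g h x => by
      rw [GG.weight_mul]
      rfl

open Classical in
theorem trace_coloredWordRep (m : Fin r × ℕ → ℕ) (g : GG r ι) :
    LinearMap.trace ℂ _ (coloredWordRep ι m g) = ∑ x : Words ι m,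
      if wordAct ι m g.perm x = x then g.weight fun j => (x.1 j).1 + 1 else 0 :=
  trace_cocycleRep _ _ _ _ _

theorem wordAct_eq_iff {κ : Type} [DecidableEq κ] (m : κ → ℕ) (σ : Equiv.Perm ι) (x : Words ι m) :
    wordAct ι m σ x = x ↔ ∀ j, x.1 (σ j) = x.1 j := by
  rw [Subtype.ext_iff, funext_iff]
  simp only [wordAct_apply]
  constructor
  · intro h j
    simpa using (h (σ j)).symm
  · intro h j
    simpa using (h (σ⁻¹ j)).symm

theorem GG.reindex_mat (e : ι ≃ κ) (g : GG r ι) (i j : ι) :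
    (GG.reindex e g).mat (e i) (e j) = g.mat i j := by
  change Matrix.reindex e e g.mat (e i) (e j) = _
  simp

theorem GG.reindex_perm (e : ι ≃ κ) (g : GG r ι) (j : ι) :
    (GG.reindex e g).perm (e j) = e (g.perm j) := by
  apply GG.perm_eq_of_ne_zero
  rw [GG.reindex_mat]
  exact g.mat_perm_ne_zero j

theorem GG.reindex_weight (e : ι ≃ κ) (g : GG r ι) (v : κ → ℕ) :
    (GG.reindex e g).weight v = g.weight fun j => v (e j) := by
  rw [GG.weight, ← Equiv.prod_comp e]
  refine Finset.prod_congr rfl fun j _ => ?_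
  rw [GG.reindex_perm, GG.reindex_mat]

theorem GG.reindex_injective (e : ι ≃ κ) : Function.Injective (GG.reindex (r := r) e) := by
  intro g h H
  refine GG.ext_mat (Matrix.ext fun i j => ?_)
  rw [← GG.reindex_mat e, H, GG.reindex_mat]

theorem GG.reindex_surjective (e : ι ≃ κ) : Function.Surjective (GG.reindex (r := r) e) := by
  intro g
  refine ⟨GG.reindex e.symm g, GG.ext_mat (Matrix.ext fun i j => ?_)⟩
  obtain ⟨i, rfl⟩ := e.surjective i
  obtain ⟨j, rfl⟩ := e.surjective j
  rw [GG.reindex_mat]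
  conv_lhs => rw [← e.symm_apply_apply i, ← e.symm_apply_apply j]
  rw [GG.reindex_mat]

section BlockPi

variable {I : Type} [Fintype I] [DecidableEq I] {α : I → Type} [∀ i, Fintype (α i)]
    [∀ i, DecidableEq (α i)]

theorem GG.blockPi_mat (g : ∀ i, GG r (α i)) (i : I) (a b : α i) :
    (GG.blockPi g).mat ⟨i, a⟩ ⟨i, b⟩ = (g i).mat a b :=
  Matrix.blockDiagonal'_apply_eq (fun i => (g i).mat) i a b

theorem GG.blockPi_perm (g : ∀ i, GG r (α i)) (i : I) (a : α i) :
    (GG.blockPi g).perm ⟨i, a⟩ = ⟨i, (g i).perm a⟩ := by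
  apply GG.perm_eq_of_ne_zero
  rw [GG.blockPi_mat]
  exact (g i).mat_perm_ne_zero a

theorem GG.blockPi_weight (g : ∀ i, GG r (α i)) (v : (Σ i, α i) → ℕ) :
    (GG.blockPi g).weight v = ∏ i, (g i).weight fun a => v ⟨i, a⟩ := by
  rw [GG.weight, Fintype.prod_sigma]
  refine Finset.prod_congr rfl fun i _ => Finset.prod_congr rfl fun a _ => ?_
  rw [GG.blockPi_perm, GG.blockPi_mat]

theorem GG.blockPi_injective : Function.Injective (GG.blockPi (r := r) (α := α)) := by
  intro g h H
  funext i
  refine GG.ext_mat (Matrix.ext fun a b => ?_)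
  rw [← GG.blockPi_mat, H, GG.blockPi_mat]

/-- A monomial matrix that permutes the elements of each block is block diagonal. -/
theorem GG.exists_blockPi (g : GG r (Σ i, α i)) (hg : ∀ x, (g.perm x).1 = x.1) :
    ∃ h, GG.blockPi h = g := by
  have hinv : ∀ x, (g⁻¹.perm x).1 = x.1 := by
    intro x
    rw [← hg (g⁻¹.perm x), ← Equiv.Perm.mul_apply, ← GG.perm_mul, mul_inv_cancel]
    rw [show (1 : GG r (Σ i, α i)).perm = 1 from map_one GG.permHom]
    rfl
  have hblock : ∀ g : GG r (Σ i, α i), (∀ x, (g.perm x).1 = x.1) →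
      Matrix.blockDiagonal' (fun i => Matrix.of fun a b : α i => g.mat ⟨i, a⟩ ⟨i, b⟩) = g.mat := by
    intro g hg
    refine Matrix.ext ?_
    rintro ⟨i, a⟩ ⟨j, b⟩
    by_cases hij : i = j
    · subst hij
      rw [Matrix.blockDiagonal'_apply_eq]
      rfl
    · rw [Matrix.blockDiagonal'_apply_ne _ _ _ hij, GG.mat_eq, if_neg]
      intro h
      have := congrArg Sigma.fst h
      rw [hg] at this
      exact hij this
  have hone : ∀ g h : GG r (Σ i, α i), (∀ x, (g.perm x).1 = x.1) → (∀ x, (h.perm x).1 = x.1) →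
      g * h = 1 → ∀ i, (Matrix.of fun a b : α i => g.mat ⟨i, a⟩ ⟨i, b⟩) *
        (Matrix.of fun a b : α i => h.mat ⟨i, a⟩ ⟨i, b⟩) = 1 := by
    intro g h hg hh hgh i
    have h1 : g.mat * h.mat = 1 := by rw [← GG.mat_mul, hgh, GG.mat_one]
    rw [← hblock g hg, ← hblock h hh, ← Matrix.blockDiagonal'_mul, ← Matrix.blockDiagonal'_one] at h1
    exact congrFun (Matrix.blockDiagonal'_injective h1) i
  refine ⟨fun i => ⟨⟨Matrix.of fun a b => g.mat ⟨i, a⟩ ⟨i, b⟩,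
    Matrix.of fun a b => g⁻¹.mat ⟨i, a⟩ ⟨i, b⟩, hone g g⁻¹ hg hinv (mul_inv_cancel g) i,
    hone g⁻¹ g hinv hg (inv_mul_cancel g) i⟩, ?_⟩, ?_⟩
  · change IsColoredMonomial r (Matrix.of fun a b => g.mat ⟨i, a⟩ ⟨i, b⟩)
    have hp : ∀ g : GG r (Σ i, α i), (∀ x, (g.perm x).1 = x.1) → ∀ b, ∃ c : α i,
        g.perm ⟨i, b⟩ = ⟨i, c⟩ := by
      intro g hg b
      have := hg ⟨i, b⟩
      rcases h : g.perm ⟨i, b⟩ with ⟨j, c⟩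
      rw [h] at this
      dsimp only at this
      subst this
      exact ⟨c, rfl⟩
    refine ⟨fun a => ?_, fun b => ?_, fun a b h => g.2.root _ _ h⟩
    · obtain ⟨b, hb⟩ := hp g⁻¹ hinv a
      have hb' : g.perm ⟨i, b⟩ = ⟨i, a⟩ := by
        rw [← hb, ← Equiv.Perm.mul_apply, ← GG.perm_mul, mul_inv_cancel]
        exact congrFun (congrArg DFunLike.coe (map_one GG.permHom)) _
      refine ⟨b, ?_, fun c hc => ?_⟩
      · have := g.mat_perm_ne_zero ⟨i, b⟩
        rw [hb'] at this
        exact this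
      · have h1 := (g.perm_eq_of_ne_zero (i := ⟨i, a⟩) (j := ⟨i, c⟩) hc).trans hb'.symm
        simpa using g.perm.injective h1
    · obtain ⟨a, ha⟩ := hp g hg b
      refine ⟨a, ?_, fun c hc => ?_⟩
      · have := g.mat_perm_ne_zero ⟨i, b⟩
        rw [ha] at this
        exact this
      · have h1 := (g.perm_eq_of_ne_zero (i := ⟨i, c⟩) (j := ⟨i, b⟩) hc).symm.trans ha
        simpa using h1
  · exact GG.ext_mat (hblock g hg)

end BlockPi

end ColoredWords

/-- Averages over fixed points for two transitive actions agree if the stabilizers agree. -/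
theorem average_sum_fixed_eq {G A X Y : Type} [Group G] [Group A] [Fintype G] [Fintype A]
    [Fintype X] [Fintype Y] [DecidableEq X] [DecidableEq Y] (ψ : A →* G)
    (hψ : Function.Injective ψ) (π : G →* Equiv.Perm X) (τ : A →* Equiv.Perm Y) (F : G → X → ℂ)
    (E : A → Y → ℂ) (x0 : X) (y0 : Y) (htrans : ∀ x, ∃ g, π g x0 = x) (htrans' : ∀ y, ∃ a, τ a y0 = y)
    (hF : ∀ g h, π g x0 = x0 → F (h * g * h⁻¹) (π h x0) = F g x0)
    (hE : ∀ g h, τ g y0 = y0 → E (h * g * h⁻¹) (τ h y0) = E g y0)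
    (hstab : ∀ g, π g x0 = x0 → ∃ a, ψ a = g) (hiff : ∀ a, π (ψ a) x0 = x0 ↔ τ a y0 = y0)
    (hFE : ∀ a, τ a y0 = y0 → F (ψ a) x0 = E a y0) :
    (Fintype.card A : ℂ)⁻¹ * ∑ a, ∑ y, (if τ a y = y then E a y else 0) =
      (Fintype.card G : ℂ)⁻¹ * ∑ g, ∑ x, (if π g x = x then F g x else 0) := by
  rw [average_sum_fixed π F x0 htrans hF, average_sum_fixed τ E y0 htrans' hE]
  congr 1
  · congr 2
    refine Finset.card_bij (fun a _ => ψ a) ?_ (fun _ _ _ _ h => hψ h) ?_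
    · intro a ha
      simpa [hiff] using ha
    · intro g hg
      obtain ⟨a, rfl⟩ := hstab g (Finset.mem_filter.1 hg).2
      exact ⟨a, by simpa [hiff] using hg, rfl⟩
  · rw [← Finset.sum_filter, ← Finset.sum_filter]
    refine Finset.sum_bij (fun a _ => ψ a) ?_ (fun _ _ _ _ h => hψ h) ?_ ?_
    · intro a ha
      simpa [hiff] using ha
    · intro g hg
      obtain ⟨a, rfl⟩ := hstab g (Finset.mem_filter.1 hg).2
      exact ⟨a, by simpa [hiff] using hg, rfl⟩
    · intro a ha
      exact (hFE a (Finset.mem_filter.1 ha).2).symm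

/-- The values of a cocycle at fixed points are invariant under conjugation. -/
theorem cocycle_conj {G X : Type} [Group G] (π : G →* Equiv.Perm X) (a : G → X → ℂ)
    (ha1 : ∀ x, a 1 x = 1) (ha : ∀ g h x, a (g * h) x = a g x * a h ((π g)⁻¹ x)) (g h : G) (x : X)
    (hx : π g x = x) : a (h * g * h⁻¹) (π h x) = a g x := by
  have h0 : (π h)⁻¹ (π h x) = x := by simp
  have h1 : a h (π h x) * a h⁻¹ x = 1 := by
    have := ha h h⁻¹ (π h x)
    rw [mul_inv_cancel, ha1, h0] at this
    exact this.symm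
  have h2 : (π g)⁻¹ x = x := Equiv.Perm.inv_eq_iff_eq.2 hx.symm
  rw [mul_assoc, ha, h0, ha, h2, mul_comm (a g x), ← mul_assoc, h1, one_mul]

/-! ### The coefficients of Frobenius characters -/

theorem coeff_rSchur {r : ℕ} (l : Fin r → YoungDiagram) (m : Fin r × ℕ →₀ ℕ) :
    MvPowerSeries.coeff m (rSchur l) = ∏ i, (kostka (l i) fun j => m (i, j) : ℚ) := by
  change (Nat.card {T : ∀ i, SemistandardYoungTableau (l i) //
    ∀ i j, ((l i).cells.filter fun c => T i c.1 c.2 = j).card = m (i, j)} : ℚ) = _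
  rw [← Nat.cast_prod, Nat.cast_inj]
  unfold kostka
  rw [← Nat.card_pi]
  exact Nat.card_congr (Equiv.subtypePiEquivPi (p := fun i (T : SemistandardYoungTableau (l i)) =>
    ∀ j, ((l i).cells.filter fun c => T c.1 c.2 = j).card = m (i, j)))

theorem card_eq_sum_of_kostka_ne_zero {μ : YoungDiagram} {c : ℕ → ℕ} {B : Finset ℕ}
    (hB : ∀ j, c j ≠ 0 → j ∈ B) (h : kostka μ c ≠ 0) : μ.card = ∑ j ∈ B, c j := by
  unfold kostka at h
  obtain ⟨T, hT⟩ := (Nat.card_ne_zero.1 h).1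
  rw [YoungDiagram.card, Finset.card_eq_sum_card_fiberwise (f := fun p => T p.1 p.2) (t := B)]
  · exact Finset.sum_congr rfl fun j _ => hT j
  · intro p hp
    refine hB _ ?_
    rw [← hT, ← Nat.pos_iff_ne_zero, Finset.card_pos]
    exact ⟨p, Finset.mem_filter.2 ⟨hp, rfl⟩⟩

theorem trace_wordRep_eq_sum_kostka_fin {a : ℕ} (c : ℕ → ℕ) (σ : Equiv.Perm (Fin a)) :
    LinearMap.trace ℂ _ (wordRep (Fin a) c σ) = ∑ μ : DiagramOf a,
      (kostka μ.1 c : ℂ) * LinearMap.trace ℂ _ (spechtRep μ.1 (Fin a) σ) := by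
  rw [trace_wordRep_eq_sum_kostka]
  refine Fintype.sum_equiv (Equiv.subtypeEquivRight fun μ => by rw [Fintype.card_fin]) _ _ ?_
  exact fun _ => rfl

theorem trace_wreathRep {r : ℕ} {ι : Type} [Fintype ι] [DecidableEq ι] (i : ℕ) {U : Type}
    [AddCommMonoid U] [Module ℂ U] (ρ : Representation ℂ (Equiv.Perm ι) U) (g : GG r ι) :
    LinearMap.trace ℂ U (wreathRep r i ρ g) =
      g.weight (fun _ => i) * LinearMap.trace ℂ U (ρ g.perm) := by
  rw [GG.weight_const]
  change LinearMap.trace ℂ U (((GG.chi g)⁻¹ ^ i) • ρ (GG.permHom g)) = _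
  rw [map_smul, smul_eq_mul]
  rfl

instance spechtTensor_finite {r : ℕ} (l : Fin r → YoungDiagram) :
    Module.Finite ℂ (SpechtTensor l) := by
  have b : ∀ i, Module.Basis (Fin (Module.finrank ℂ (spechtSubmodule (l i) (Fin (l i).card)))) ℂ
      (spechtSubmodule (l i) (Fin (l i).card)) := fun i =>
    let _ : AddCommGroup (spechtSubmodule (l i) (Fin (l i).card)) :=
      Module.addCommMonoidToAddCommGroup ℂ
    Module.finBasis ℂ _
  exact Module.Finite.of_basis (Basis.piTensorProduct b)

/-- Frobenius reciprocity, with the character of an outer tensor product written as a product. The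
sizes `α` are kept apart from `l`, so that all `r`-partitions with these sizes give averages over
the same group and can be summed inside it. -/
theorem finrank_irrRep {r n : ℕ} [NeZero r] {V : Type} [AddCommGroup V] [Module ℂ V]
    [FiniteDimensional ℂ V] (ρ : Representation ℂ (GG r (Fin n)) V) (l : RPartition r n)
    (α : Fin r → ℕ) (hα : ∑ i, α i = n) (hl : ∀ i, (l.1 i).card = α i) :
    (Module.finrank ℂ (Representation.IntertwiningMap (irrRep l) ρ) : ℂ) =
      (Fintype.card (∀ i, GG r (Fin (α i))) : ℂ)⁻¹ * ∑ g : ∀ i, GG r (Fin (α i)),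
        LinearMap.trace ℂ V (ρ (parabolic r α hα g⁻¹)) *
          ∏ i, (g i).weight (fun _ => (i : ℕ) + 1) *
            LinearMap.trace ℂ _ (spechtRep (l.1 i) (Fin (α i)) (g i).perm) := by
  obtain rfl : (fun i => (l.1 i).card) = α := funext hl
  unfold irrRep
  rw [finrank_intertwiningMap_ind, finrank_intertwiningMap_comm, finrank_intertwiningMap_eq]
  congr 1
  refine Finset.sum_congr rfl fun g _ => ?_
  congr 1
  change LinearMap.trace ℂ _ (PiTensorProduct.map _) = _
  rw [trace_piTensorProduct_map]
  exact Finset.prod_congr rfl fun i _ => trace_wreathRep _ _ _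


/-! ### Block diagonal subgroups and words cut into blocks -/

section Parabolic

variable {r n : ℕ} {α : Fin r → ℕ} (hα : ∑ i, α i = n)

theorem parabolic_injective : Function.Injective (parabolic r α hα) :=
  (GG.reindex_injective _).comp GG.blockPi_injective

theorem parabolic_perm (g : ∀ i, GG r (Fin (α i))) (i : Fin r) (a : Fin (α i)) :
    (parabolic r α hα g).perm (finSigmaFinEquiv.trans (finCongr hα) ⟨i, a⟩) =
      finSigmaFinEquiv.trans (finCongr hα) ⟨i, (g i).perm a⟩ := by
  change (GG.reindex (finSigmaFinEquiv.trans (finCongr hα)) (GG.blockPi g)).perm _ = _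
  rw [GG.reindex_perm, GG.blockPi_perm]

theorem parabolic_weight (g : ∀ i, GG r (Fin (α i))) (v : Fin n → ℕ) :
    (parabolic r α hα g).weight v =
      ∏ i, (g i).weight fun a => v (finSigmaFinEquiv.trans (finCongr hα) ⟨i, a⟩) := by
  change (GG.reindex (finSigmaFinEquiv.trans (finCongr hα)) (GG.blockPi g)).weight v = _
  rw [GG.reindex_weight, GG.blockPi_weight]

theorem exists_parabolic (g : GG r (Fin n))
    (hg : ∀ x, ((finSigmaFinEquiv.trans (finCongr hα)).symm (g.perm x)).1 =
      ((finSigmaFinEquiv.trans (finCongr hα)).symm x).1) : ∃ h, parabolic r α hα h = g := by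
  obtain ⟨g', rfl⟩ := GG.reindex_surjective (finSigmaFinEquiv.trans (finCongr hα)) g
  obtain ⟨h, rfl⟩ := GG.exists_blockPi g' fun x => by
    have := hg (finSigmaFinEquiv.trans (finCongr hα) x)
    rwa [GG.reindex_perm, Equiv.symm_apply_apply, Equiv.symm_apply_apply] at this
  exact ⟨h, rfl⟩

/-- The action of `G_α` on families of words, one for each block. -/
def blockWordAct (r : ℕ) {α : Fin r → ℕ} (c : Fin r → ℕ → ℕ) :
    (∀ i, GG r (Fin (α i))) →* Equiv.Perm (∀ i, Words (Fin (α i)) (c i)) where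
  toFun g := Equiv.piCongrRight fun i => wordAct (Fin (α i)) (c i) (GG.permHom (g i))
  map_one' := by
    refine Equiv.ext fun y => funext fun i => ?_
    change wordAct (Fin (α i)) (c i) (GG.permHom 1) (y i) = y i
    rw [map_one, map_one]
    rfl
  map_mul' g h := by
    refine Equiv.ext fun y => funext fun i => ?_
    change wordAct (Fin (α i)) (c i) (GG.permHom (g i * h i)) (y i) = _
    rw [map_mul, map_mul]
    rfl

theorem blockWordAct_eq_iff (c : Fin r → ℕ → ℕ) (g : ∀ i, GG r (Fin (α i)))
    (y : ∀ i, Words (Fin (α i)) (c i)) :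
    blockWordAct r c g y = y ↔ ∀ i a, (y i).1 ((g i).perm a) = (y i).1 a := by
  rw [funext_iff]
  exact forall_congr' fun i => wordAct_eq_iff _ _ _

/-- The words in the blocks as a single word. -/
def glueWords {m : Fin r × ℕ → ℕ} (y : ∀ i, Words (Fin (α i)) fun j => m (i, j)) :
    Words (Fin n) m :=
  ⟨fun x => (((finSigmaFinEquiv.trans (finCongr hα)).symm x).1,
    (y ((finSigmaFinEquiv.trans (finCongr hα)).symm x).1).1
      ((finSigmaFinEquiv.trans (finCongr hα)).symm x).2), by
    rintro ⟨i, j⟩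
    refine Eq.trans ?_ ((y i).2 j)
    refine (Finset.card_bij (fun a _ => finSigmaFinEquiv.trans (finCongr hα) ⟨i, a⟩) ?_ ?_ ?_).symm
    · intro a ha
      rw [Finset.mem_filter]
      dsimp only
      rw [Equiv.symm_apply_apply]
      exact ⟨Finset.mem_univ _, Prod.ext rfl (Finset.mem_filter.1 ha).2⟩
    · intro a _ b _ h
      simpa using h
    · intro x hx
      obtain ⟨⟨i', a⟩, rfl⟩ := (finSigmaFinEquiv.trans (finCongr hα)).surjective x
      rw [Finset.mem_filter] at hx
      dsimp only at hx
      rw [Equiv.symm_apply_apply, Prod.mk.injEq] at hx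
      obtain ⟨-, h1, h2⟩ := hx
      dsimp only at h1
      subst h1
      exact ⟨a, Finset.mem_filter.2 ⟨Finset.mem_univ _, h2⟩, rfl⟩⟩

theorem glueWords_apply {m : Fin r × ℕ → ℕ} (y : ∀ i, Words (Fin (α i)) fun j => m (i, j))
    (i : Fin r) (a : Fin (α i)) :
    (glueWords hα y).1 (finSigmaFinEquiv.trans (finCongr hα) ⟨i, a⟩) = (i, (y i).1 a) := by
  unfold glueWords
  dsimp only
  rw [Equiv.symm_apply_apply]

end Parabolic

/-- In effect `coloredWordRep m` is induced from the module of families of words in the blocks. Both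
`G_α` on such families and `G_n` on words act transitively, and the stabilizer of a glued word is
already contained in `G_α`. By `average_sum_fixed_eq` both scalar products reduce to the same
average over that stabilizer. -/
theorem average_coloredWordRep {r n : ℕ} [NeZero r] {α : Fin r → ℕ} (hα : ∑ i, α i = n)
    {V : Type} [AddCommGroup V] [Module ℂ V] [FiniteDimensional ℂ V]
    (ρ : Representation ℂ (GG r (Fin n)) V) (m : Fin r × ℕ → ℕ)
    (y0 : ∀ i, Words (Fin (α i)) fun j => m (i, j)) :
    (Fintype.card (∀ i, GG r (Fin (α i))) : ℂ)⁻¹ * ∑ g : ∀ i, GG r (Fin (α i)),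
        LinearMap.trace ℂ V (ρ (parabolic r α hα g⁻¹)) *
          ∏ i, (g i).weight (fun _ => (i : ℕ) + 1) *
            LinearMap.trace ℂ _ (wordRep (Fin (α i)) (fun j => m (i, j)) (g i).perm) =
      Module.finrank ℂ (ρ.IntertwiningMap (coloredWordRep (Fin n) m)) := by
  classical
  rw [finrank_intertwiningMap_eq]
  have key := average_sum_fixed_eq (parabolic r α hα) (parabolic_injective hα)
    ((wordAct (Fin n) m).comp GG.permHom) (blockWordAct r fun i j => m (i, j))
    (fun g x => LinearMap.trace ℂ V (ρ g⁻¹) * g.weight fun j => (x.1 j).1 + 1)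
    (fun g _ => LinearMap.trace ℂ V (ρ (parabolic r α hα g⁻¹)) *
      ∏ i, (g i).weight fun _ => (i : ℕ) + 1) (glueWords hα y0) y0 ?_ ?_ ?_ ?_ ?_ ?_ ?_
  · refine Eq.trans ?_ (key.trans ?_)
    · congr 1
      refine Finset.sum_congr rfl fun g _ => ?_
      have h1 : ∀ i, LinearMap.trace ℂ _ (wordRep (Fin (α i)) (fun j => m (i, j)) (g i).perm) =
          ∑ y : Words (Fin (α i)) fun j => m (i, j),
            if wordAct (Fin (α i)) (fun j => m (i, j)) (g i).perm y = y then 1 else 0 :=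
        fun i => trace_cocycleRep _ _ _ _ _
      simp only [h1]
      rw [Finset.prod_mul_distrib, Finset.prod_univ_sum, Fintype.piFinset_univ, Finset.mul_sum,
        Finset.mul_sum]
      refine Finset.sum_congr rfl fun y _ => ?_
      have h2 : (blockWordAct r (fun i j => m (i, j)) g y = y) ↔
          ∀ i ∈ Finset.univ, wordAct (Fin (α i)) (fun j => m (i, j)) (g i).perm (y i) = y i := by
        rw [funext_iff]
        simp only [Finset.mem_univ, true_imp_iff]
        rfl
      rw [Finset.prod_ite_zero]
      simp only [h2]
      split_ifs <;> simp
    · congr 1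
      refine Finset.sum_congr rfl fun g _ => ?_
      rw [trace_coloredWordRep, Finset.mul_sum]
      refine Finset.sum_congr rfl fun x _ => ?_
      rw [mul_ite, mul_zero]
      rfl
  · intro x
    obtain ⟨σ, hσ⟩ := wordAct_transitive m (glueWords hα y0) x
    obtain ⟨g, rfl, -⟩ := GG.exists_perm_entries (r := r) σ (fun _ => 1) (by simp)
    exact ⟨g, hσ⟩
  · intro y
    choose σ hσ using fun i => wordAct_transitive (fun j => m (i, j)) (y0 i) (y i)
    choose g hg _ using fun i => GG.exists_perm_entries (r := r) (σ i) (fun _ => 1) (by simp)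
    refine ⟨g, funext fun i => ?_⟩
    change wordAct (Fin (α i)) _ (g i).perm (y0 i) = y i
    rw [hg, hσ]
  · intro g h hg
    congr 1
    · rw [mul_inv_rev, mul_inv_rev, inv_inv, ← mul_assoc]
      exact trace_conj_eq ρ g⁻¹ h
    · exact cocycle_conj ((wordAct (Fin n) m).comp GG.permHom)
        (fun g x => g.weight fun j => (x.1 j).1 + 1) (fun _ => GG.weight_one _)
        (fun g h x => by
          rw [GG.weight_mul]
          rfl) g h _ hg
  · intro g h _
    congr 1
    · rw [mul_inv_rev, mul_inv_rev, inv_inv, ← mul_assoc]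
      exact trace_conj_eq (ρ.comp (parabolic r α hα)) g⁻¹ h
    · refine Finset.prod_congr rfl fun i _ => ?_
      rw [Pi.mul_apply, Pi.mul_apply, Pi.inv_apply, GG.weight_const, GG.weight_const]
      congr 2
      rw [map_mul, mul_comm, ← map_mul, inv_mul_cancel_left]
  -- The first component of a letter of the glued word names the block of its position. A matrix
  -- fixing the word therefore preserves the blocks.
  · intro g hg
    refine exists_parabolic hα g fun x => ?_
    have := congrArg Prod.fst ((wordAct_eq_iff m _ _).1 hg x)
    exact this
  · intro g
    rw [blockWordAct_eq_iff]
    change wordAct (Fin n) m (parabolic r α hα g).perm _ = _ ↔ _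
    rw [wordAct_eq_iff, ← (finSigmaFinEquiv.trans (finCongr hα)).forall_congr_right]
    rw [Sigma.forall]
    refine forall_congr' fun i => forall_congr' fun a => ?_
    rw [parabolic_perm, glueWords_apply, glueWords_apply, Prod.mk.injEq]
    simp
  · intro g _
    rw [parabolic_weight, ← map_inv]
    congr 1
    refine Finset.prod_congr rfl fun i _ => ?_
    congr 1
    funext a
    rw [glueWords_apply]

/-- The coefficients of the Frobenius character of a module count the equivariant maps to the
monomial representations on words. -/
theorem coeff_frob {r n : ℕ} [NeZero r] {V : Type} [AddCommGroup V] [Module ℂ V]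
    [FiniteDimensional ℂ V] (ρ : Representation ℂ (GG r (Fin n)) V) (m : Fin r × ℕ →₀ ℕ) :
    MvPowerSeries.coeff m (frob ρ) =
      (Module.finrank ℂ (ρ.IntertwiningMap (coloredWordRep (Fin n) m)) : ℚ) := by
  classical
  have h0 : MvPowerSeries.coeff m (frob ρ) = ∑ l : RPartition r n,
      (Module.finrank ℂ (Representation.IntertwiningMap (irrRep l) ρ) : ℚ) *
        ∏ i, (kostka (l.1 i) fun j => m (i, j) : ℚ) := by
    rw [frob, map_sum]
    refine Finset.sum_congr rfl fun l _ => ?_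
    rw [map_smul, coeff_rSchur, smul_eq_mul]
  set B : Finset ℕ := m.support.image Prod.snd with hB
  have hmem : ∀ i j, m (i, j) ≠ 0 → j ∈ B := fun i j h =>
    Finset.mem_image.2 ⟨(i, j), Finsupp.mem_support_iff.2 h, rfl⟩
  -- `α i` is the number of letters that `m` prescribes for component `i`. Kostka numbers vanish
  -- unless the shape has as many cells as the content has letters, so only `r`-partitions with
  -- sizes `α` contribute.
  set α : Fin r → ℕ := fun i => ∑ j ∈ B, m (i, j) with hαdef
  have hprod : ∀ l : RPartition r n, (∏ i, (kostka (l.1 i) fun j => m (i, j) : ℚ)) ≠ 0 →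
      ∀ i, (l.1 i).card = α i := by
    intro l hl i
    refine card_eq_sum_of_kostka_ne_zero (hmem i) ?_
    have := Finset.prod_ne_zero_iff.1 hl i (Finset.mem_univ i)
    exact_mod_cast this
  have hsum : ∑ i, α i = m.sum fun _ a => a := by
    rw [Finsupp.sum, hαdef, ← Finset.sum_product']
    refine (Finset.sum_subset ?_ ?_).symm
    · intro p hp
      exact Finset.mem_product.2 ⟨Finset.mem_univ _, hmem p.1 p.2 (Finsupp.mem_support_iff.1 hp)⟩
    · intro p _ hp
      exact Finsupp.notMem_support_iff.1 hp
  rw [h0]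
  by_cases hα : ∑ i, α i = n
  · have hw : ∀ i, Nonempty (Words (Fin (α i)) fun j => m (i, j)) := fun i =>
      words_nonempty (c := Finsupp.onFinset B (fun j => m (i, j)) (hmem i)) (by
        rw [Finsupp.onFinset_sum _ fun _ => rfl, Fintype.card_fin])
    have y0 := fun i => (hw i).some
    have hC : (((∑ l : RPartition r n,
      (Module.finrank ℂ (Representation.IntertwiningMap (irrRep l) ρ) : ℚ) *
        ∏ i, (kostka (l.1 i) fun j => m (i, j) : ℚ) : ℚ)) : ℂ) =
        ((Module.finrank ℂ (ρ.IntertwiningMap (coloredWordRep (Fin n) m)) : ℚ) : ℂ) := by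
      push_cast
      rw [← average_coloredWordRep hα ρ m y0]
      -- The sum over all `r`-partitions is cut down to those of sizes `α`, where it factors into
      -- one sum for each component and Young's rule applies in each.
      let P : (∀ i, DiagramOf (α i)) → RPartition r n := fun L =>
        ⟨fun i => (L i).1, by simp only [(L _).2, hα]⟩
      rw [← Finset.sum_of_injOn (s := Finset.univ) P (f := fun L =>
        (Module.finrank ℂ (Representation.IntertwiningMap (irrRep (P L)) ρ) : ℂ) *
          ∏ i, (kostka (L i).1 fun j => m (i, j) : ℂ))]
      · have h1 : ∀ L, (Module.finrank ℂ (Representation.IntertwiningMap (irrRep (P L)) ρ) : ℂ) = _ :=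
          fun L => finrank_irrRep ρ (P L) α hα fun i => (L i).2
        simp only [h1, trace_wordRep_eq_sum_kostka_fin, Finset.prod_mul_distrib,
          Finset.prod_univ_sum, Fintype.piFinset_univ, Finset.mul_sum, Finset.sum_mul]
        rw [Finset.sum_comm]
        refine Finset.sum_congr rfl fun g _ => Finset.sum_congr rfl fun L _ => ?_
        ring
      · intro L _ L' _ h
        funext i
        exact Subtype.ext (congrFun (congrArg Subtype.val h) i)
      · intro _ _
        exact Finset.mem_coe.2 (Finset.mem_univ _)
      · intro l _ hl
        by_contra h
        have h2 := hprod l fun h3 => h (by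
          have : (∏ i, (kostka (l.1 i) fun j => m (i, j) : ℂ)) = 0 := by exact_mod_cast h3
          rw [this, mul_zero])
        exact hl ⟨fun i => ⟨l.1 i, h2 i⟩, Finset.mem_coe.2 (Finset.mem_univ _), rfl⟩
      · exact fun _ _ => rfl
    exact_mod_cast hC
  -- If the total degree of `m` is not `n`, both sides vanish: there are no words of content `m` and
  -- no shapes of the right size.
  · have : IsEmpty (Words (Fin n) m) := ⟨fun f => hα (by
      rw [hsum, sum_content_eq_card f, Fintype.card_fin])⟩
    have : Subsingleton (ρ.IntertwiningMap (coloredWordRep (Fin n) m)) := ⟨fun a b => by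
      apply Representation.IntertwiningMap.ext
      exact LinearMap.ext fun x => Subsingleton.elim _ _⟩
    rw [Module.finrank_zero_of_subsingleton, Nat.cast_zero]
    refine Finset.sum_eq_zero fun l _ => ?_
    by_contra h
    have := hprod l (right_ne_zero_of_mul h)
    exact hα (by rw [← l.2]; exact Finset.sum_congr rfl fun i _ => (this i).symm)

/-! ### Multiplicativity of Frobenius characters -/

/-- The content of a word. -/
def wordContent {ι κ : Type} [Fintype ι] (f : ι → κ) : κ →₀ ℕ := ∑ x, Finsupp.single (f x) 1

section Content

variable {ι ι' κ : Type} [Fintype ι] [Fintype ι'] [DecidableEq κ]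

theorem wordContent_apply (f : ι → κ) (j : κ) :
    wordContent f j = (Finset.univ.filter fun x => f x = j).card := by
  rw [wordContent, Finsupp.finsetSum_apply, Finset.card_filter]
  exact Finset.sum_congr rfl fun x _ => Finsupp.single_apply

theorem wordContent_eq_iff (f : ι → κ) (c : κ →₀ ℕ) :
    wordContent f = c ↔ ∀ j, (Finset.univ.filter fun x => f x = j).card = c j := by
  rw [Finsupp.ext_iff]
  simp only [wordContent_apply]

theorem wordContent_sum (f : ι ⊕ ι' → κ) :
    wordContent f = wordContent (fun x => f (Sum.inl x)) + wordContent fun x => f (Sum.inr x) :=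
  Fintype.sum_sum_type _

end Content

section Two

variable {r : ℕ} {ι κ : Type} [Fintype ι] [DecidableEq ι] [Fintype κ] [DecidableEq κ]

theorem GG.blockProd_perm_inl (g : GG r ι × GG r κ) (j : ι) :
    (GG.blockProd g).perm (Sum.inl j) = Sum.inl (g.1.perm j) := by
  apply GG.perm_eq_of_ne_zero
  exact g.1.mat_perm_ne_zero j

theorem GG.blockProd_perm_inr (g : GG r ι × GG r κ) (j : κ) :
    (GG.blockProd g).perm (Sum.inr j) = Sum.inr (g.2.perm j) := by
  apply GG.perm_eq_of_ne_zero
  exact g.2.mat_perm_ne_zero j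

theorem GG.blockProd_weight (g : GG r ι × GG r κ) (v : ι ⊕ κ → ℕ) :
    (GG.blockProd g).weight v =
      g.1.weight (fun j => v (Sum.inl j)) * g.2.weight fun j => v (Sum.inr j) := by
  rw [GG.weight, Fintype.prod_sum_type]
  simp only [GG.blockProd_perm_inl, GG.blockProd_perm_inr]
  rfl

/-- A word on the disjoint union is a pair of words whose contents add up to `m`. A block diagonal
matrix fixes it exactly when each block fixes its half, and the weights multiply. -/
theorem trace_coloredWordRep_blockProd (m : Fin r × ℕ →₀ ℕ) (g : GG r ι × GG r κ) :
    LinearMap.trace ℂ _ (coloredWordRep (ι ⊕ κ) m (GG.blockProd g)) =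
      ∑ p ∈ Finset.HasAntidiagonal.antidiagonal m,
        LinearMap.trace ℂ _ (coloredWordRep ι p.1 g.1) *
          LinearMap.trace ℂ _ (coloredWordRep κ p.2 g.2) := by
  classical
  rw [trace_coloredWordRep, ← Finset.sum_fiberwise_of_maps_to
    (t := Finset.HasAntidiagonal.antidiagonal m)
    (g := fun x => (wordContent fun j => x.1 (Sum.inl j), wordContent fun j => x.1 (Sum.inr j)))]
  · refine Finset.sum_congr rfl fun p hp => ?_
    rw [Finset.HasAntidiagonal.mem_antidiagonal] at hp
    rw [trace_coloredWordRep, trace_coloredWordRep, Finset.sum_mul_sum, ← Finset.sum_product']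
    symm
    refine Finset.sum_bij (fun y _ => ⟨Sum.elim y.1.1 y.2.1, ?_⟩) ?_ ?_ ?_ ?_
    · rw [← wordContent_eq_iff, wordContent_sum, ← hp]
      exact congrArg₂ _ ((wordContent_eq_iff _ _).2 y.1.2) ((wordContent_eq_iff _ _).2 y.2.2)
    · intro y _
      rw [Finset.mem_filter]
      exact ⟨Finset.mem_univ _, Prod.ext ((wordContent_eq_iff _ _).2 y.1.2)
        ((wordContent_eq_iff _ _).2 y.2.2)⟩
    · intro y _ y' _ h
      have h' := congrFun (congrArg Subtype.val h)
      exact Prod.ext (Subtype.ext (funext fun j => h' (Sum.inl j)))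
        (Subtype.ext (funext fun j => h' (Sum.inr j)))
    · intro x hx
      have hx' := (Finset.mem_filter.1 hx).2
      refine ⟨(⟨fun j => x.1 (Sum.inl j), (wordContent_eq_iff _ _).1 (congrArg Prod.fst hx')⟩,
        ⟨fun j => x.1 (Sum.inr j), (wordContent_eq_iff _ _).1 (congrArg Prod.snd hx')⟩),
        Finset.mem_univ _, Subtype.ext ?_⟩
      exact Sum.elim_comp_inl_inr x.1
    · intro y _
      simp only [wordAct_eq_iff, Sum.forall, GG.blockProd_perm_inl, GG.blockProd_perm_inr,
        Sum.elim_inl, Sum.elim_inr, GG.blockProd_weight]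
      split_ifs <;> simp_all
  · intro x _
    rw [Finset.HasAntidiagonal.mem_antidiagonal, ← wordContent_sum]
    exact (wordContent_eq_iff _ _).2 x.2

theorem trace_coloredWordRep_reindex (e : ι ≃ κ) (m : Fin r × ℕ → ℕ) (g : GG r ι) :
    LinearMap.trace ℂ _ (coloredWordRep κ m (GG.reindex e g)) =
      LinearMap.trace ℂ _ (coloredWordRep ι m g) := by
  classical
  rw [trace_coloredWordRep, trace_coloredWordRep]
  refine Fintype.sum_equiv ((e.arrowCongr (Equiv.refl _)).symm.subtypeEquiv fun f =>
    forall_congr' fun j => ?_) _ _ fun x => ?_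
  · rw [show (Finset.univ.filter fun x => f x = j).card =
      (Finset.univ.filter fun x => f (e x) = j).card from
      (Finset.card_bij (fun z _ => e z) (by simp) (fun _ _ _ _ h => e.injective h)
        fun z hz => ⟨e.symm z, by simpa using hz, by simp⟩).symm]
    rfl
  · simp only [wordAct_eq_iff, GG.reindex_weight, ← e.forall_congr_right (q := fun j =>
      x.1 ((GG.reindex e g).perm j) = x.1 j), GG.reindex_perm]
    rfl

end Two

theorem parabolicTwo_injective (r : ℕ) {a z n : ℕ} (h : a + z = n) :
    Function.Injective (parabolicTwo r h) := by
  refine (GG.reindex_injective _).comp ?_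
  intro g g' H
  refine Prod.ext (GG.ext_mat (Matrix.ext fun i j => ?_)) (GG.ext_mat (Matrix.ext fun i j => ?_))
  · exact congrFun (congrFun (congrArg GG.mat H) (Sum.inl i)) (Sum.inl j)
  · exact congrFun (congrFun (congrArg GG.mat H) (Sum.inr i)) (Sum.inr j)

/-- Compare coefficients. Frobenius reciprocity moves the restriction to the word representation,
whose character splits over the antidiagonal of `m`, which is the rule for the coefficients of a
product of power series. -/
theorem frob_ind_parabolicTwo {r a z n : ℕ} [NeZero r] (h : a + z = n) {V : Type} [AddCommGroup V]
    [Module ℂ V] [FiniteDimensional ℂ V] (ρ : Representation ℂ (GG r (Fin a)) V) :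
    frob (Representation.ind (parabolicTwo r h) (ρ.comp (MonoidHom.fst _ (GG r (Fin z))))) =
      frob ρ * frob (Representation.trivial ℂ (GG r (Fin z)) ℂ) := by
  classical
  refine MvPowerSeries.ext fun m => ?_
  rw [MvPowerSeries.coeff_mul, coeff_frob, finrank_intertwiningMap_ind]
  simp only [coeff_frob]
  suffices H : (Module.finrank ℂ (Representation.IntertwiningMap
      (ρ.comp (MonoidHom.fst _ (GG r (Fin z))))
      ((coloredWordRep (Fin n) m).comp (parabolicTwo r h))) : ℂ) =
      ∑ p ∈ Finset.HasAntidiagonal.antidiagonal m,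
        (Module.finrank ℂ (ρ.IntertwiningMap (coloredWordRep (Fin a) p.1)) : ℂ) *
          (Module.finrank ℂ ((Representation.trivial ℂ (GG r (Fin z)) ℂ).IntertwiningMap
            (coloredWordRep (Fin z) p.2)) : ℂ) by
    exact_mod_cast H
  rw [finrank_intertwiningMap_eq]
  simp only [finrank_intertwiningMap_eq]
  have h1 : ∀ g : GG r (Fin a) × GG r (Fin z), LinearMap.trace ℂ _
      (coloredWordRep (Fin n) m (parabolicTwo r h g)) = _ := fun g =>
    (trace_coloredWordRep_reindex _ _ _).trans (trace_coloredWordRep_blockProd m g)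
  have h2 : ∀ g : GG r (Fin z), LinearMap.trace ℂ ℂ (Representation.trivial ℂ (GG r (Fin z)) ℂ g) =
      1 := fun g => by
    refine (LinearMap.trace_one ℂ ℂ).trans ?_
    rw [Module.finrank_self, Nat.cast_one]
  simp only [h2, one_mul]
  have h3 : ∀ g : GG r (Fin a) × GG r (Fin z), LinearMap.trace ℂ _
      (((coloredWordRep (Fin n) m).comp (parabolicTwo r h)) g) = _ := h1
  simp only [h3]
  simp only [Finset.mul_sum (s := Finset.HasAntidiagonal.antidiagonal m)]
  rw [Finset.sum_comm, Finset.mul_sum]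
  refine Finset.sum_congr rfl fun p _ => ?_
  rw [Fintype.card_prod, Nat.cast_mul, mul_inv, Fintype.sum_prod_type, mul_mul_mul_comm,
    Finset.sum_mul_sum]
  congr 1
  refine Finset.sum_congr rfl fun g _ => Finset.sum_congr rfl fun g' _ => ?_
  rw [mul_assoc]
  rfl

/-! ### The Frobenius character of the trivial module -/

theorem card_oneRow (z : ℕ) : (oneRow z).card = z :=
  (card_cellsOfRowLens [z]).trans (by simp)

theorem oneRow_row {z : ℕ} (p : (oneRow z).cells) : p.1.1 = 0 := by
  obtain ⟨h, -⟩ := YoungDiagram.mem_ofRowLens.1 ((YoungDiagram.mem_cells _).1 p.2)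
  simpa using h

/-- Every column has one cell, so the column group is trivial. Hence the Specht module of one row is
the trivial representation. -/
theorem polytabloid_oneRow {ι : Type} [Fintype ι] [DecidableEq ι] {z : ℕ}
    (t : ι ≃ (oneRow z).cells) : polytabloid (oneRow z) t = Finsupp.single (fun _ => 0) 1 := by
  unfold polytabloid
  rw [Finset.sum_eq_single 1]
  · rw [if_pos (show ∀ x, (t ((1 : Equiv.Perm ι) x)).1.2 = (t x).1.2 from fun _ => rfl),
      Equiv.Perm.sign_one]
    simp only [oneRow_row]
    simp
  · intro q _ hq
    rw [if_neg]
    intro h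
    refine hq (Equiv.ext fun x => cell_ext t ?_ (h x))
    rw [oneRow_row, oneRow_row]
  · simp

theorem trace_spechtRep_oneRow {z : ℕ} (σ : Equiv.Perm (Fin z)) :
    LinearMap.trace ℂ _ (spechtRep (oneRow z) (Fin z) σ) = 1 := by
  have t : Fin z ≃ (oneRow z).cells := Fintype.equivOfCardEq (by
    rw [Fintype.card_coe, Fintype.card_fin]
    exact (card_oneRow z).symm)
  have h1 : spechtRep (oneRow z) (Fin z) σ = 1 := by
    refine LinearMap.ext fun x => ?_
    induction x using spechtSubmodule_induction t with
    | hgen τ =>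
      apply Subtype.ext
      change tabloidRep (Fin z) σ (tabloidRep (Fin z) τ (polytabloid _ t)) =
        tabloidRep (Fin z) τ (polytabloid _ t)
      rw [tabloidRep_polytabloid, tabloidRep_polytabloid, polytabloid_oneRow, polytabloid_oneRow]
    | hzero => rw [map_zero, map_zero]
    | hadd x y hx hy => rw [map_add, map_add, hx, hy]
    | hsmul a x hx => rw [map_smul, map_smul, hx]
  have h2 : spechtSubmodule (oneRow z) (Fin z) =
      Submodule.span ℂ {Finsupp.single (fun _ => 0) 1} := by
    unfold spechtSubmodule
    congr 1
    refine Set.eq_singleton_iff_unique_mem.2 ⟨⟨t, polytabloid_oneRow t⟩, ?_⟩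
    rintro _ ⟨T, rfl⟩
    exact polytabloid_oneRow T
  have h3 : Module.finrank ℂ (spechtSubmodule (oneRow z) (Fin z)) = 1 := by
    rw [h2]
    exact finrank_span_singleton (by simp)
  let _ : AddCommGroup (spechtSubmodule (oneRow z) (Fin z)) := Module.addCommMonoidToAddCommGroup ℂ
  rw [h1, LinearMap.trace_one]
  exact_mod_cast h3

open Classical in
-- The Kostka number counts equivariant maps from the trivial module to words of content `c`, hence
-- the orbits on those words, of which there is at most one.
theorem kostka_oneRow (z : ℕ) (c : ℕ → ℕ) :
    kostka (oneRow z) c = if Nonempty (Words (Fin z) c) then 1 else 0 := by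
  have t : Fin z ≃ (oneRow z).cells := Fintype.equivOfCardEq (by
    rw [Fintype.card_coe, Fintype.card_fin]
    exact (card_oneRow z).symm)
  rw [← finrank_intertwiningMap_specht t]
  split_ifs with h
  · obtain ⟨x0⟩ := h
    suffices H : (Module.finrank ℂ ((spechtRep (oneRow z) (Fin z)).IntertwiningMap
        (wordRep (Fin z) c)) : ℂ) = 1 by exact_mod_cast H
    rw [finrank_intertwiningMap_eq]
    simp only [trace_spechtRep_oneRow, one_mul]
    have h1 : ∀ σ, LinearMap.trace ℂ _ (wordRep (Fin z) c σ) =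
        ∑ x, if wordAct (Fin z) c σ x = x then 1 else 0 := fun σ => trace_cocycleRep _ _ _ _ _
    simp only [h1]
    rw [average_sum_fixed (wordAct (Fin z) c) (fun _ _ => 1) x0 (wordAct_transitive c x0)
      fun _ _ _ => rfl, Finset.sum_boole, inv_mul_cancel₀]
    rw [Nat.cast_ne_zero, ← Nat.pos_iff_ne_zero, Finset.card_pos]
    exact ⟨1, by simp⟩
  · have : IsEmpty (Words (Fin z) c) := not_nonempty_iff.1 h
    have : Subsingleton ((spechtRep (oneRow z) (Fin z)).IntertwiningMap (wordRep (Fin z) c)) :=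
      ⟨fun a b => by
        apply Representation.IntertwiningMap.ext
        exact LinearMap.ext fun x => Subsingleton.elim _ _⟩
    exact Module.finrank_zero_of_subsingleton

theorem oneRow_zero : oneRow 0 = ⊥ := by
  refine YoungDiagram.ext ?_
  rw [YoungDiagram.cells_bot, ← Finset.card_eq_zero]
  exact card_oneRow 0

theorem GG.weight_eq_one {r : ℕ} {ι : Type} [Fintype ι] [DecidableEq ι] (g : GG r ι) {v : ι → ℕ} (hv : ∀ j, v j = r) : g.weight v = 1 := by
  refine Finset.prod_eq_one fun j _ => ?_
  have h : g.mat (g.perm j) j ^ r = 1 := g.2.root _ _ (g.mat_perm_ne_zero j)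
  rw [hv, inv_pow, h, inv_one]

open Classical in
/-- The sum of the weights of the elements of a stabilizer vanishes if some exponent is not divisible
by `r`. -/
theorem sum_weight_stabilizer {r : ℕ} [NeZero r] {ι : Type} [Fintype ι] [DecidableEq ι]
    {m : Fin r × ℕ → ℕ} (x : Words ι m) (j : ι) (hj : ((x.1 j).1 : ℕ) + 1 < r) :
    ∑ g : GG r ι, (if wordAct ι m g.perm x = x then g.weight fun j => (x.1 j).1 + 1 else 0) = 0 := by
  have hr : r ≠ 0 := NeZero.ne r
  have hζ := Complex.isPrimitiveRoot_exp r hr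
  set ζ := Complex.exp (2 * Real.pi * Complex.I / r)
  -- The diagonal matrix with a primitive root of unity in position `j` fixes every word. Right
  -- translation by it multiplies the sum by a power of `ζ⁻¹` whose exponent lies strictly between
  -- `0` and `r`, so the sum is zero.
  obtain ⟨t, ht, htc⟩ := GG.exists_perm_entries (r := r) (1 : Equiv.Perm ι)
    (fun i => if i = j then ζ else 1) fun i => by
      split_ifs
      · exact ⟨hζ.ne_zero hr, hζ.pow_eq_one⟩
      · simp
  have hw : ∀ v : ι → ℕ, t.weight v = ζ⁻¹ ^ v j := by
    intro v
    rw [GG.weight, Finset.prod_eq_single j]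
    · have := htc j
      rw [if_pos rfl] at this
      rw [ht, this]
      rfl
    · intro i _ hi
      have := htc i
      rw [if_neg hi] at this
      rw [ht, this, inv_one, one_pow]
    · simp
  set S := ∑ g : GG r ι, (if wordAct ι m g.perm x = x then g.weight fun j => (x.1 j).1 + 1 else 0)
    with hS
  have h1 : S = S * ζ⁻¹ ^ ((x.1 j).1 + 1 : ℕ) := by
    conv_lhs => rw [hS, ← Equiv.sum_comp (Equiv.mulRight t)]
    rw [hS, Finset.sum_mul]
    refine Finset.sum_congr rfl fun g _ => ?_
    rw [Equiv.coe_mulRight, GG.perm_mul, ht, mul_one, GG.weight_mul, hw, ite_mul, zero_mul]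
    split_ifs with h
    · rw [(wordAct_eq_iff m _ _).1 h]
    · rfl
  have h2 : ζ⁻¹ ^ ((x.1 j).1 + 1 : ℕ) ≠ 1 := by
    rw [inv_pow, inv_ne_one]
    exact hζ.pow_ne_one_of_pos_of_lt (Nat.succ_ne_zero _) hj
  by_contra h0
  exact h2 (mul_left_cancel₀ h0 (h1.symm.trans (mul_one S).symm))

/-- The coefficient of `m` is the dimension of the invariants in the monomial representation on
words. The words form a single orbit or none, so it is `1` or `0` according to whether the
stabilizer of a word acts by the trivial character. That happens exactly when all letters belong to
the last component, whose exponent is `r`. The product of one-row Kostka numbers makes the same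
distinction. -/
theorem frob_trivial {r : ℕ} [NeZero r] (z : ℕ) :
    frob (Representation.trivial ℂ (GG r (Fin z)) ℂ) = rSchur (lastRow r z) := by
  classical
  refine MvPowerSeries.ext fun m => ?_
  rw [coeff_frob, coeff_rSchur]
  set α : Fin r → ℕ := fun i => if (i : ℕ) + 1 = r then z else 0 with hα
  have hlast : ∀ i, lastRow r z i = oneRow (α i) := by
    intro i
    simp only [lastRow, hα]
    split_ifs
    · rfl
    · exact oneRow_zero.symm
  have hsum : ∑ i, α i = z := by
    have hr := NeZero.pos r
    rw [Finset.sum_eq_single ⟨r - 1, by omega⟩]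
    · simp only [hα]
      rw [if_pos (by omega)]
    · intro i _ hi
      simp only [hα]
      rw [if_neg]
      intro h
      exact hi (Fin.ext (by dsimp only; omega))
    · simp
  simp only [hlast, kostka_oneRow]
  have htr : (Module.finrank ℂ ((Representation.trivial ℂ (GG r (Fin z)) ℂ).IntertwiningMap
      (coloredWordRep (Fin z) m)) : ℂ) = (Fintype.card (GG r (Fin z)) : ℂ)⁻¹ *
        ∑ g : GG r (Fin z), ∑ x : Words (Fin z) m,
          if wordAct (Fin z) m g.perm x = x then g.weight fun j => (x.1 j).1 + 1 else 0 := by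
    rw [finrank_intertwiningMap_eq]
    congr 1
    refine Finset.sum_congr rfl fun g _ => ?_
    rw [trace_coloredWordRep]
    have : LinearMap.trace ℂ ℂ (Representation.trivial ℂ (GG r (Fin z)) ℂ g⁻¹) = 1 := by
      refine (LinearMap.trace_one ℂ ℂ).trans ?_
      rw [Module.finrank_self, Nat.cast_one]
    rw [this, one_mul]
  have hfix : ∀ x0 : Words (Fin z) m, (Module.finrank ℂ
      ((Representation.trivial ℂ (GG r (Fin z)) ℂ).IntertwiningMap
      (coloredWordRep (Fin z) m)) : ℂ) =
      ((Finset.univ.filter fun g : GG r (Fin z) => wordAct (Fin z) m g.perm x0 = x0).card : ℂ)⁻¹ *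
        ∑ g : GG r (Fin z),
          if wordAct (Fin z) m g.perm x0 = x0 then g.weight fun j => (x0.1 j).1 + 1 else 0 := by
    intro x0
    rw [htr]
    refine average_sum_fixed ((wordAct (Fin z) m).comp GG.permHom)
      (fun g x => g.weight fun j => (x.1 j).1 + 1) x0 (fun x => ?_) fun g h hg => ?_
    · obtain ⟨σ, hσ⟩ := wordAct_transitive m x0 x
      obtain ⟨g, rfl, -⟩ := GG.exists_perm_entries (r := r) σ (fun _ => 1) (by simp)
      exact ⟨g, hσ⟩
    · exact cocycle_conj ((wordAct (Fin z) m).comp GG.permHom)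
        (fun g x => g.weight fun j => (x.1 j).1 + 1) (fun _ => GG.weight_one _)
        (fun g h x => by
          rw [GG.weight_mul]
          rfl) g h _ hg
  by_cases hw : ∀ i, Nonempty (Words (Fin (α i)) fun j => m (i, j))
  · have hR : (∏ i, ((if Nonempty (Words (Fin (α i)) fun j => m (i, j)) then 1 else 0 : ℕ) : ℚ)) =
        1 := Finset.prod_eq_one fun i _ => by rw [if_pos (hw i), Nat.cast_one]
    rw [hR]
    have y0 := fun i => (hw i).some
    have hx : ∀ j, (((glueWords hsum y0).1 j).1 : ℕ) + 1 = r := by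
      intro j
      obtain ⟨⟨i, a⟩, rfl⟩ := (finSigmaFinEquiv.trans (finCongr hsum)).surjective j
      rw [glueWords_apply]
      by_contra h
      have : α i = 0 := if_neg h
      exact absurd (a.2.trans_eq this) (Nat.not_lt_zero _)
    suffices H : (Module.finrank ℂ ((Representation.trivial ℂ (GG r (Fin z)) ℂ).IntertwiningMap
      (coloredWordRep (Fin z) m)) : ℂ) = 1 by exact_mod_cast H
    rw [hfix (glueWords hsum y0)]
    simp only [GG.weight_eq_one _ hx]
    rw [Finset.sum_boole, inv_mul_cancel₀]
    rw [Nat.cast_ne_zero, ← Nat.pos_iff_ne_zero, Finset.card_pos]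
    refine ⟨1, Finset.mem_filter.2 ⟨Finset.mem_univ _, ?_⟩⟩
    rw [show (1 : GG r (Fin z)).perm = 1 from map_one GG.permHom, map_one]
    rfl
  · have hR : (∏ i, ((if Nonempty (Words (Fin (α i)) fun j => m (i, j)) then 1 else 0 : ℕ) : ℚ)) =
        0 := by
      rw [not_forall] at hw
      obtain ⟨i, hi⟩ := hw
      exact Finset.prod_eq_zero (Finset.mem_univ i) (by rw [if_neg hi, Nat.cast_zero])
    rw [hR]
    suffices H : (Module.finrank ℂ ((Representation.trivial ℂ (GG r (Fin z)) ℂ).IntertwiningMap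
      (coloredWordRep (Fin z) m)) : ℂ) = 0 by exact_mod_cast H
    rcases isEmpty_or_nonempty (Words (Fin z) m) with he | ⟨⟨x0⟩⟩
    · rw [htr]
      simp
    -- If all letters belonged to the last component, the word itself would supply words for all
    -- components, against the assumption. So some letter lies elsewhere and the average over the
    -- stabilizer is zero.
    · by_cases hx : ∀ j, ((x0.1 j).1 : ℕ) + 1 = r
      · refine absurd (fun i => ?_) hw
        by_cases hi : (i : ℕ) + 1 = r
        · have : α i = z := if_pos hi
          rw [this]
          refine ⟨⟨fun j => (x0.1 j).2, fun b => ?_⟩⟩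
          dsimp only
          rw [← x0.2 (i, b)]
          congr 1
          refine Finset.filter_congr fun j _ => ?_
          have := hx j
          rw [Prod.ext_iff, Fin.ext_iff]
          constructor
          · exact fun h => ⟨by dsimp only; omega, h⟩
          · exact fun h => h.2
        · have : α i = 0 := if_neg hi
          rw [this]
          refine ⟨⟨fun j => j.elim0, fun b => ?_⟩⟩
          dsimp only
          rw [← x0.2 (i, b), Finset.univ_eq_empty, Finset.filter_empty, Finset.card_empty, eq_comm,
            Finset.card_eq_zero, Finset.filter_eq_empty_iff]
          intro j _ h
          have := hx j
          rw [h] at this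
          exact hi this
      · rw [not_forall] at hx
        obtain ⟨j, hj⟩ := hx
        rw [hfix x0, sum_weight_stabilizer x0 j (by have := (x0.1 j).1.2; omega), mul_zero]

/-! ### Recognition of a direct sum of induced modules -/

section Recognition

theorem indV_mk_smul {G H : Type} [Group G] [Group H] (φ : G →* H) {V : Type} [AddCommGroup V]
    [Module ℂ V] (ρ : Representation ℂ G V) (g : G) (h : H) (a : V) :
    Representation.IndV.mk φ ρ (φ g * h) (ρ g a) = Representation.IndV.mk φ ρ h a := by
  have := Representation.Coinvariants.mk_self_apply
    (ρ := Representation.tprod ((Representation.leftRegular ℂ H).comp φ) ρ) g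
    (MonoidAlgebra.single h 1 ⊗ₜ a)
  simpa using this

open Classical in
/-- The evaluation of an element of an induced module at a group element. -/
def indVEval {G H : Type} [Group G] [Fintype G] [Group H] (φ : G →* H) {V : Type} [AddCommGroup V]
    [Module ℂ V] (ρ : Representation ℂ G V) (h0 : H) : Representation.IndV φ ρ →ₗ[ℂ] V :=
  Representation.Coinvariants.lift _
    (TensorProduct.lift <| (Finsupp.lift _ _ _ fun h => ∑ g, if φ g * h = h0 then ρ g else 0) ∘ₗ
      (MonoidAlgebra.coeffLinearEquiv ℂ).toLinearMap)
    fun g => by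
      ext h x
      simp [Representation.ofMulAction_single]
      rw [← Equiv.sum_comp (Equiv.mulRight g⁻¹)]
      simp only [Equiv.coe_mulRight, map_mul, map_inv, mul_assoc, inv_mul_cancel_left]
      refine Finset.sum_congr rfl fun c _ => ?_
      split_ifs
      · rw [← Module.End.mul_apply, mul_assoc, ← map_mul, inv_mul_cancel, map_one, mul_one]
      · rfl

open Classical in
theorem indVEval_mk {G H : Type} [Group G] [Fintype G] [Group H] (φ : G →* H) {V : Type}
    [AddCommGroup V] [Module ℂ V] (ρ : Representation ℂ G V) (h0 h : H) (a : V) :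
    indVEval φ ρ h0 (Representation.IndV.mk φ ρ h a) = ∑ g, if φ g * h = h0 then ρ g a else 0 := by
  simp only [indVEval, LinearMap.coe_comp, Function.comp_apply, TensorProduct.mk_apply,
    Representation.Coinvariants.lift_mk, TensorProduct.lift.tmul]
  simp only [LinearEquiv.coe_coe, MonoidAlgebra.coeffLinearEquiv_apply, MonoidAlgebra.coeff_single,
    Finsupp.lift_apply, zero_smul, Finsupp.sum_single_index, one_smul, LinearMap.sum_apply]
  refine Finset.sum_congr rfl fun c _ => ?_
  split_ifs <;> rfl

variable {I H W : Type} [Fintype I] [DecidableEq I] [Group H] [Fintype H] [AddCommGroup W] [Module ℂ W]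
  {G V : I → Type} [∀ i, Group (G i)] [∀ i, Fintype (G i)] [∀ i, AddCommGroup (V i)]
  [∀ i, Module ℂ (V i)]

/-- The map to a direct sum of induced modules given by maps to the modules that are induced. -/
def toSumInd (φ : ∀ i, G i →* H) (ρ : ∀ i, Representation ℂ (G i) (V i)) (σ : Representation ℂ H W)
    (π : ∀ i, W →ₗ[ℂ] V i) :
    σ.IntertwiningMap (Representation.directSum fun i => Representation.ind (φ i) (ρ i)) where
  toLinearMap := ∑ i, DirectSum.lof ℂ I (fun i => Representation.IndV (φ i) (ρ i)) i ∘ₗ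
    ∑ h, Representation.IndV.mk (φ i) (ρ i) h ∘ₗ π i ∘ₗ σ h
  isIntertwining' h0 := by
    refine LinearMap.ext fun w => ?_
    rw [LinearMap.comp_apply, LinearMap.comp_apply, LinearMap.sum_apply, LinearMap.sum_apply, map_sum]
    refine Finset.sum_congr rfl fun i _ => ?_
    rw [LinearMap.comp_apply, LinearMap.comp_apply]
    change _ = DirectSum.lmap (fun i => Representation.ind (φ i) (ρ i) h0) _
    rw [DirectSum.lmap_lof]
    congr 1
    rw [LinearMap.sum_apply, LinearMap.sum_apply, map_sum, ← Equiv.sum_comp (Equiv.mulRight h0⁻¹)]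
    refine Finset.sum_congr rfl fun h _ => ?_
    simp only [LinearMap.comp_apply (Representation.IndV.mk (φ i) (ρ i) _)]
    rw [Representation.ind_mk, LinearMap.comp_apply, LinearMap.comp_apply, Equiv.coe_mulRight,
      ← Module.End.mul_apply, ← map_mul, inv_mul_cancel_right]
    rfl

theorem toSumInd_apply (φ : ∀ i, G i →* H) (ρ : ∀ i, Representation ℂ (G i) (V i))
    (σ : Representation ℂ H W) (π : ∀ i, W →ₗ[ℂ] V i) (w : W) :
    toSumInd φ ρ σ π w = ∑ i, DirectSum.lof ℂ I (fun i => Representation.IndV (φ i) (ρ i)) i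
      (∑ h, Representation.IndV.mk (φ i) (ρ i) h (π i (σ h w))) := by
  change (∑ i, DirectSum.lof ℂ I (fun i => Representation.IndV (φ i) (ρ i)) i ∘ₗ
    ∑ h, Representation.IndV.mk (φ i) (ρ i) h ∘ₗ π i ∘ₗ σ h) w = _
  rw [LinearMap.sum_apply]
  refine Finset.sum_congr rfl fun i _ => ?_
  rw [LinearMap.comp_apply, LinearMap.sum_apply]
  rfl

theorem component_toSumInd (φ : ∀ i, G i →* H) (ρ : ∀ i, Representation ℂ (G i) (V i))
    (σ : Representation ℂ H W) (π : ∀ i, W →ₗ[ℂ] V i) (w : W) (i : I) :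
    DirectSum.component ℂ I (fun i => Representation.IndV (φ i) (ρ i)) i (toSumInd φ ρ σ π w) =
      ∑ h, Representation.IndV.mk (φ i) (ρ i) h (π i (σ h w)) := by
  rw [toSumInd_apply, map_sum, Finset.sum_eq_single i]
  · rw [DirectSum.component.lof_self]
  · intro j _ hj
    rw [DirectSum.component.of, dif_neg hj]
  · simp

variable {φ : ∀ i, G i →* H} {ρ : ∀ i, Representation ℂ (G i) (V i)} {σ : Representation ℂ H W}
  {π : ∀ i, W →ₗ[ℂ] V i}

/-- Evaluating component `i` of the image at `h0` returns `π i (σ h0 w)` once for each element of `G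
i`. The image thus determines all these values, and they determine `w`. -/
theorem toSumInd_injective (hπ : ∀ i g w, π i (σ (φ i g) w) = ρ i g (π i w))
    (hinj : ∀ w, (∀ i h, π i (σ h w) = 0) → w = 0) : Function.Injective (toSumInd φ ρ σ π) := by
  classical
  refine (injective_iff_map_eq_zero (toSumInd φ ρ σ π)).2 fun w hw => hinj w fun i h0 => ?_
  have h1 := component_toSumInd φ ρ σ π w i
  rw [hw, map_zero] at h1
  have h2 := congrArg (indVEval (φ i) (ρ i) h0) h1
  simp only [map_zero, map_sum, indVEval_mk] at h2
  rw [Finset.sum_comm] at h2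
  have h3 : ∀ g : G i, (∑ h, if φ i g * h = h0 then ρ i g (π i (σ h w)) else 0) =
      π i (σ h0 w) := by
    intro g
    rw [Finset.sum_eq_single ((φ i g)⁻¹ * h0)]
    · rw [if_pos (mul_inv_cancel_left _ _), ← hπ, ← Module.End.mul_apply, ← map_mul,
        mul_inv_cancel_left]
    · intro h _ hh
      rw [if_neg]
      rintro rfl
      exact hh (inv_mul_cancel_left _ _).symm
    · simp
  simp only [h3, Finset.sum_const, Finset.card_univ] at h2
  rw [← Nat.cast_smul_eq_nsmul ℂ] at h2
  exact (smul_eq_zero.1 h2.symm).resolve_left (by exact_mod_cast Fintype.card_ne_zero)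

/-- A lift `f` of `a` that is invisible outside the subgroup `φ i (G i)` and the index `i` goes to a
nonzero multiple of the class of `1 ⊗ a` in summand `i`. Its translates reach all classes `h ⊗ a`,
which span. Stating this for submodules serves surjectivity and the comparison of gradings at once.
-/
theorem map_toSumInd (hφ : ∀ i, Function.Injective (φ i))
    (hπ : ∀ i g w, π i (σ (φ i g) w) = ρ i g (π i w)) {𝒲 : Submodule ℂ W}
    {𝒱 : ∀ i, Submodule ℂ (V i)} (hσ : ∀ h, 𝒲 ≤ 𝒲.comap (σ h)) (hW : ∀ i, 𝒲 ≤ (𝒱 i).comap (π i))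
    (hsurj : ∀ i, ∀ a ∈ 𝒱 i, ∃ f ∈ 𝒲, π i f = a ∧
      ∀ j h, π j (σ h f) ≠ 0 → j = i ∧ ∃ g, φ i g = h) :
    𝒲.map (toSumInd φ ρ σ π).toLinearMap =
      ⨅ i, (⨆ h, (𝒱 i).map (Representation.IndV.mk (φ i) (ρ i) h)).comap
        (DirectSum.component ℂ I (fun i => Representation.IndV (φ i) (ρ i)) i) := by
  apply le_antisymm
  · rw [Submodule.map_le_iff_le_comap]
    intro w hw
    rw [Submodule.mem_comap, Submodule.mem_iInf]
    intro i
    rw [Submodule.mem_comap]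
    change DirectSum.component ℂ I _ i (toSumInd φ ρ σ π w) ∈ _
    rw [component_toSumInd]
    refine Submodule.sum_mem _ fun h _ => Submodule.mem_iSup_of_mem h ?_
    exact ⟨_, hW i (hσ h hw), rfl⟩
  · classical
    intro x hx
    rw [Submodule.mem_iInf] at hx
    have key : ∀ i h, (𝒱 i).map (Representation.IndV.mk (φ i) (ρ i) h) ≤
        (𝒲.map (toSumInd φ ρ σ π).toLinearMap).comap
          (DirectSum.lof ℂ I (fun i => Representation.IndV (φ i) (ρ i)) i) := by
      rintro i h _ ⟨a, ha, rfl⟩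
      obtain ⟨f, hf, rfl, hf2⟩ := hsurj i a ha
      rw [Submodule.mem_comap]
      have hG : (Fintype.card (G i) : ℂ) ≠ 0 := by exact_mod_cast Fintype.card_ne_zero
      -- The factor is the order of `G i`, since each of its elements contributes the same class to
      -- the sum over `H`. It is invertible in `ℂ`.
      suffices hs : toSumInd φ ρ σ π (σ h⁻¹ f) = (Fintype.card (G i) : ℂ) •
          DirectSum.lof ℂ I (fun i => Representation.IndV (φ i) (ρ i)) i
            (Representation.IndV.mk (φ i) (ρ i) h (π i f)) by
        exact (Submodule.smul_mem_iff _ hG).1 ⟨σ h⁻¹ f, hσ _ hf, hs⟩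
      rw [Representation.IntertwiningMap.isIntertwining, toSumInd_apply]
      have h1 : ∀ j, j ≠ i → ∑ h, Representation.IndV.mk (φ j) (ρ j) h (π j (σ h f)) = 0 := by
        intro j hj
        refine Finset.sum_eq_zero fun h' _ => ?_
        have : π j (σ h' f) = 0 := by
          by_contra h0
          exact hj (hf2 j h' h0).1
        rw [this, map_zero]
      rw [Finset.sum_eq_single i]
      · have h2 : ∑ h, Representation.IndV.mk (φ i) (ρ i) h (π i (σ h f)) =
            (Fintype.card (G i) : ℂ) • Representation.IndV.mk (φ i) (ρ i) 1 (π i f) := by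
          rw [← Finset.sum_of_injOn (s := Finset.univ) (φ i)
            (f := fun _ => Representation.IndV.mk (φ i) (ρ i) 1 (π i f))]
          · rw [Finset.sum_const, Finset.card_univ, Nat.cast_smul_eq_nsmul]
          · exact fun _ _ _ _ h => hφ i h
          · exact fun _ _ => Finset.mem_coe.2 (Finset.mem_univ _)
          · intro h' _ hh'
            have : π i (σ h' f) = 0 := by
              by_contra h0
              obtain ⟨-, g, hg⟩ := hf2 i h' h0
              exact hh' ⟨g, Finset.mem_coe.2 (Finset.mem_univ _), hg⟩
            rw [this, map_zero]
          · intro g _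
            rw [hπ, ← indV_mk_smul (φ i) (ρ i) g 1, mul_one]
        rw [h2]
        change DirectSum.lmap (fun i => Representation.ind (φ i) (ρ i) h⁻¹) _ = _
        rw [DirectSum.lmap_lof, map_smul, Representation.ind_mk, inv_inv, one_mul, map_smul]
      · intro j _ hj
        rw [h1 j hj, map_zero]
      · simp
    rw [← DirectSum.sum_support_of x]
    refine Submodule.sum_mem _ fun i _ => ?_
    have h2 := hx i
    rw [Submodule.mem_comap] at h2
    exact (iSup_le (key i)) h2

theorem toSumInd_surjective (hφ : ∀ i, Function.Injective (φ i))
    (hπ : ∀ i g w, π i (σ (φ i g) w) = ρ i g (π i w))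
    (hsurj : ∀ i a, ∃ f, π i f = a ∧ ∀ j h, π j (σ h f) ≠ 0 → j = i ∧ ∃ g, φ i g = h) :
    Function.Surjective (toSumInd φ ρ σ π) := by
  have h := map_toSumInd (𝒲 := ⊤) (𝒱 := fun _ => ⊤) hφ hπ (fun _ _ _ => Submodule.mem_top)
    (fun _ _ _ => Submodule.mem_top) fun i a _ => by
      obtain ⟨f, hf⟩ := hsurj i a
      exact ⟨f, Submodule.mem_top, hf⟩
  have h2 : ∀ i, (⨆ h, (⊤ : Submodule ℂ (V i)).map (Representation.IndV.mk (φ i) (ρ i) h)) = ⊤ := by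
    intro i
    rw [eq_top_iff]
    rintro x -
    obtain ⟨x, rfl⟩ := Representation.Coinvariants.mk_surjective _ x
    induction x using TensorProduct.induction_on with
    | zero => rw [map_zero]; exact Submodule.zero_mem _
    | add x y hx hy => rw [map_add]; exact Submodule.add_mem _ hx hy
    | tmul b a =>
      induction b using MonoidAlgebra.induction_linear with
      | zero => rw [TensorProduct.zero_tmul, map_zero]; exact Submodule.zero_mem _
      | add b c hb hc => rw [TensorProduct.add_tmul, map_add]; exact Submodule.add_mem _ hb hc
      | single h c =>
        refine Submodule.mem_iSup_of_mem h ⟨c • a, Submodule.mem_top, ?_⟩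
        change Representation.Coinvariants.mk _ (MonoidAlgebra.single h 1 ⊗ₜ (c • a)) = _
        rw [TensorProduct.tmul_smul, TensorProduct.smul_tmul', MonoidAlgebra.smul_single,
          smul_eq_mul, mul_one]
  simp only [h2, Submodule.comap_top, iInf_top] at h
  intro x
  obtain ⟨w, -, hw⟩ : x ∈ (⊤ : Submodule ℂ W).map (toSumInd φ ρ σ π).toLinearMap := by
    rw [h]
    exact Submodule.mem_top
  exact ⟨w, hw⟩

end Recognition

/-- By `coeff_frob` the coefficients are dimensions of spaces of maps out of the module, and a map
out of a direct sum is a family of maps. -/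
theorem frob_eq_sum_of_equiv {r n : ℕ} [NeZero r] {I W : Type} [Fintype I] [DecidableEq I]
    [AddCommGroup W] [Module ℂ W] [FiniteDimensional ℂ W] {V : I → Type} [∀ i, AddCommGroup (V i)]
    [∀ i, Module ℂ (V i)] [∀ i, FiniteDimensional ℂ (V i)]
    {σ : Representation ℂ (GG r (Fin n)) W} {ρ : ∀ i, Representation ℂ (GG r (Fin n)) (V i)}
    (e : σ.Equiv (Representation.directSum ρ)) : frob σ = ∑ i, frob (ρ i) := by
  refine MvPowerSeries.ext fun m => ?_
  rw [map_sum]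
  simp only [coeff_frob]
  rw [← Nat.cast_sum, Nat.cast_inj, ← Module.finrank_pi_fintype]
  have hlof : ∀ g i x, Representation.directSum ρ g (DirectSum.lof ℂ I V i x) =
      DirectSum.lof ℂ I V i (ρ i g x) := fun g i x => DirectSum.lmap_lof _ _ _
  refine LinearEquiv.finrank_eq
    { toFun := fun f i => ⟨f.toLinearMap ∘ₗ e.symm.toLinearMap ∘ₗ DirectSum.lof ℂ I V i, fun g => by
        refine LinearMap.ext fun x => ?_
        change f (e.symm (DirectSum.lof ℂ I V i (ρ i g x))) =
          coloredWordRep (Fin n) m g (f (e.symm (DirectSum.lof ℂ I V i x)))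
        rw [← Representation.IntertwiningMap.isIntertwining]
        congr 1
        rw [← hlof]
        exact Representation.IntertwiningMap.isIntertwining _ _ e.symm.toIntertwiningMap g _⟩
      map_add' := fun _ _ => rfl
      map_smul' := fun _ _ => rfl
      invFun := fun F => ⟨DirectSum.toModule ℂ I _ (fun i => (F i).toLinearMap) ∘ₗ e.toLinearMap,
        fun g => by
          have h1 : DirectSum.toModule ℂ I _ (fun i => (F i).toLinearMap) ∘ₗ
              Representation.directSum ρ g = coloredWordRep (Fin n) m g ∘ₗ
                DirectSum.toModule ℂ I _ (fun i => (F i).toLinearMap) := by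
            refine DirectSum.linearMap_ext ℂ fun i => LinearMap.ext fun x => ?_
            rw [LinearMap.comp_apply, LinearMap.comp_apply, hlof, DirectSum.toModule_lof,
              LinearMap.comp_apply, LinearMap.comp_apply, DirectSum.toModule_lof]
            exact Representation.IntertwiningMap.isIntertwining _ _ (F i) g x
          rw [← LinearMap.comp_assoc, ← h1, LinearMap.comp_assoc, LinearMap.comp_assoc]
          congr 1
          exact e.toIntertwiningMap.isIntertwining' g⟩
      left_inv := fun f => by
        apply Representation.IntertwiningMap.ext
        refine LinearMap.ext fun w => ?_
        change DirectSum.toModule ℂ I _ (fun i => f.toLinearMap ∘ₗ e.symm.toLinearMap ∘ₗ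
          DirectSum.lof ℂ I V i) (e w) = f w
        have h1 : DirectSum.toModule ℂ I _ (fun i => f.toLinearMap ∘ₗ e.symm.toLinearMap ∘ₗ
          DirectSum.lof ℂ I V i) = f.toLinearMap ∘ₗ e.symm.toLinearMap := by
          refine DirectSum.linearMap_ext ℂ fun i => LinearMap.ext fun x => ?_
          rw [LinearMap.comp_apply, DirectSum.toModule_lof]
          rfl
        rw [h1]
        exact congrArg f (e.symm_apply_apply w)
      right_inv := fun F => by
        funext i
        apply Representation.IntertwiningMap.ext
        refine LinearMap.ext fun x => ?_
        change DirectSum.toModule ℂ I _ (fun i => (F i).toLinearMap)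
          (e (e.symm (DirectSum.lof ℂ I V i x))) = F i x
        rw [e.apply_symm_apply, DirectSum.toModule_lof]
        rfl }

/-! ### Elementary symmetric polynomials in subsets of the variables -/

section PowEsymm

variable {ι : Type} [Fintype ι] [DecidableEq ι]

/-- The elementary symmetric polynomial of degree `d` in the `r`-th powers of the variables in
`U`. -/
def powEsymm (r : ℕ) (U : Finset ι) (d : ℕ) : MvPolynomial ι ℂ :=
  ∑ A ∈ U.powersetCard d, ∏ i ∈ A, MvPolynomial.X i ^ r

theorem powEsymm_zero (r : ℕ) (U : Finset ι) : powEsymm r U 0 = 1 := by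
  simp [powEsymm]

theorem powEsymm_eq_zero {r : ℕ} {U : Finset ι} {d : ℕ} (h : U.card < d) : powEsymm r U d = 0 := by
  rw [powEsymm, Finset.powersetCard_eq_empty.2 h, Finset.sum_empty]

theorem powEsymm_insert (r : ℕ) {U : Finset ι} {i : ι} (hi : i ∉ U) (d : ℕ) :
    powEsymm r (insert i U) (d + 1) = powEsymm r U (d + 1) + MvPolynomial.X i ^ r * powEsymm r U d := by
  rw [powEsymm, Finset.powersetCard_succ_insert hi, Finset.sum_union, Finset.sum_image]
  · congr 1
    rw [powEsymm, Finset.mul_sum]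
    refine Finset.sum_congr rfl fun A hA => ?_
    rw [Finset.prod_insert fun h => hi ((Finset.mem_powersetCard.1 hA).1 h)]
  · intro A hA B hB h
    have h1 : i ∉ A := fun h => hi ((Finset.mem_powersetCard.1 hA).1 h)
    have h2 : i ∉ B := fun h => hi ((Finset.mem_powersetCard.1 hB).1 h)
    rw [← Finset.erase_insert h1, h, Finset.erase_insert h2]
  · rw [Finset.disjoint_left]
    intro A hA hA'
    obtain ⟨B, -, rfl⟩ := Finset.mem_image.1 hA'
    exact hi ((Finset.mem_powersetCard.1 hA).1 (Finset.mem_insert_self _ _))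

theorem rename_expand_esymm {κ : Type} [Fintype κ] [DecidableEq κ] (r : ℕ) (j : κ ↪ ι) (d : ℕ) :
    MvPolynomial.rename j (MvPolynomial.expand r (MvPolynomial.esymm κ ℂ d)) =
      powEsymm r (Finset.univ.map j) d := by
  rw [powEsymm, Finset.powersetCard_map, Finset.sum_map, MvPolynomial.esymm, map_sum, map_sum]
  refine Finset.sum_congr rfl fun A _ => ?_
  rw [map_prod, map_prod]
  change _ = ∏ i ∈ A.map j, _
  rw [Finset.prod_map]
  refine Finset.prod_congr rfl fun i _ => ?_
  rw [MvPolynomial.expand_X, map_pow, MvPolynomial.rename_X]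

theorem expand_esymm (r d : ℕ) :
    MvPolynomial.expand r (MvPolynomial.esymm ι ℂ d) = powEsymm r Finset.univ d := by
  have := rename_expand_esymm r (Function.Embedding.refl ι) d
  rw [Finset.map_refl] at this
  rw [← this]
  exact (MvPolynomial.rename_id_apply _).symm

/-- The ideal generated by the elementary symmetric polynomials of degree `d > |U| - k`. -/
def powEsymmIdeal (r k : ℕ) (U : Finset ι) : Ideal (MvPolynomial ι ℂ) :=
  Ideal.span {f | ∃ d, U.card < d + k ∧ f = powEsymm r U d}

theorem powEsymm_mem {r k : ℕ} {U : Finset ι} {d : ℕ} (h : U.card < d + k) :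
    powEsymm r U d ∈ powEsymmIdeal r k U := Ideal.subset_span ⟨d, h, rfl⟩

/-- By the recursion for `e_{d+1}(U ∪ i)`: the bound on the degree drops by one together with the
number of variables, so both `e_{d+1}(U)` and `e_d(U)` are generators. -/
theorem powEsymmIdeal_insert_le (r k : ℕ) {U : Finset ι} {i : ι} (hi : i ∉ U) :
    powEsymmIdeal r k (insert i U) ≤ powEsymmIdeal r k U := by
  rw [powEsymmIdeal, Ideal.span_le]
  rintro _ ⟨d, hd, rfl⟩
  rw [Finset.card_insert_of_notMem hi] at hd
  rcases d with _ | d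
  · rw [powEsymm_zero, ← powEsymm_zero r U]
    exact powEsymm_mem (by omega)
  · rw [powEsymm_insert r hi]
    exact add_mem (powEsymm_mem (by omega)) (Ideal.mul_mem_left _ _ (powEsymm_mem (by omega)))

theorem powEsymmIdeal_univ_le (r k : ℕ) (U : Finset ι) :
    powEsymmIdeal r k Finset.univ ≤ powEsymmIdeal r k U := by
  have h : ∀ T : Finset ι, Disjoint T U → powEsymmIdeal r k (T ∪ U) ≤ powEsymmIdeal r k U := by
    intro T
    induction T using Finset.induction_on with
    | empty => rw [Finset.empty_union]; exact fun _ => le_rfl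
    | insert i T hi ih =>
      intro hT
      rw [Finset.disjoint_insert_left] at hT
      rw [Finset.insert_union]
      refine (powEsymmIdeal_insert_le r k ?_).trans (ih hT.2)
      rw [Finset.mem_union, not_or]
      exact ⟨hi, hT.1⟩
  have := h Uᶜ disjoint_compl_left
  rwa [Finset.union_comm, Finset.union_compl] at this

/-- A converse to the inclusion of ideals, at the price of the factor `x_i^{rk}`. The recursion in
the form `x_i^r e_d(U) = e_{d+1}(U ∪ i) - e_{d+1}(U)` trades one factor `x_i^r` for one degree.
After all `l` factors are used the degree exceeds `|U|` and the last term is zero. -/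
theorem X_pow_mul_powEsymm_mem (r k : ℕ) {U : Finset ι} {i : ι} (hi : i ∉ U) (l : ℕ) (hl : l ≤ k) :
    ∀ d, U.card < d + l →
      (MvPolynomial.X i ^ r) ^ l * powEsymm r U d ∈ powEsymmIdeal r k (insert i U) := by
  induction l with
  | zero =>
    intro d hd
    rw [powEsymm_eq_zero (by omega), mul_zero]
    exact Submodule.zero_mem _
  | succ l ih =>
    intro d hd
    have h : (MvPolynomial.X i ^ r) ^ (l + 1) * powEsymm r U d =
        (MvPolynomial.X i ^ r) ^ l * powEsymm r (insert i U) (d + 1) -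
          (MvPolynomial.X i ^ r) ^ l * powEsymm r U (d + 1) := by
      rw [powEsymm_insert r hi]
      ring
    rw [h]
    refine sub_mem (Ideal.mul_mem_left _ _ (powEsymm_mem ?_)) (ih (by omega) _ (by omega))
    rw [Finset.card_insert_of_notMem hi]
    omega

theorem prod_X_pow_mul_mem (r k : ℕ) (U T : Finset ι) (hTU : Disjoint T U) {f : MvPolynomial ι ℂ}
    (hf : f ∈ powEsymmIdeal r k U) :
    (∏ i ∈ T, (MvPolynomial.X i ^ r) ^ k) * f ∈ powEsymmIdeal r k (T ∪ U) := by
  induction T using Finset.induction_on with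
  | empty => rwa [Finset.prod_empty, one_mul, Finset.empty_union]
  | insert i T hi ih =>
    rw [Finset.disjoint_insert_left] at hTU
    rw [Finset.prod_insert hi, mul_assoc, Finset.insert_union]
    have hi' : i ∉ T ∪ U := by
      rw [Finset.mem_union, not_or]
      exact ⟨hi, hTU.1⟩
    have hle : powEsymmIdeal r k (T ∪ U) ≤ Submodule.comap
        (LinearMap.mulLeft (MvPolynomial ι ℂ) ((MvPolynomial.X i ^ r) ^ k))
        (powEsymmIdeal r k (insert i (T ∪ U))) := by
      rw [powEsymmIdeal, Ideal.span, Submodule.span_le]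
      rintro _ ⟨d, hd, rfl⟩
      exact X_pow_mul_powEsymm_mem r k hi' k le_rfl d hd
    exact hle (ih hTU.2)

theorem powEsymmIdeal_univ_le_coinvIdeal (r n k a : ℕ) :
    powEsymmIdeal r k (Finset.univ : Finset (Fin n)) ≤ coinvIdeal r n k a := by
  rw [powEsymmIdeal, Ideal.span_le]
  rintro _ ⟨d, hd, rfl⟩
  rw [Finset.card_univ, Fintype.card_fin] at hd
  by_cases h : d ≤ n
  · exact Ideal.subset_span (Or.inr ⟨d, hd, h, (expand_esymm r d).symm⟩)
  · rw [powEsymm_eq_zero (by rw [Finset.card_univ, Fintype.card_fin]; omega)]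
    exact Submodule.zero_mem _

theorem monomial_mem_coinvIdeal {r n k a : ℕ} {μ : Fin n →₀ ℕ} {i : Fin n} (h : a ≤ μ i) (c : ℂ) :
    MvPolynomial.monomial μ c ∈ coinvIdeal r n k a := by
  have h1 : μ = (μ - Finsupp.single i a) + Finsupp.single i a := by
    rw [tsub_add_cancel_of_le]
    intro j
    rw [Finsupp.single_apply]
    split_ifs with hj
    · exact hj ▸ h
    · exact Nat.zero_le _
  rw [h1, ← mul_one c, ← MvPolynomial.monomial_mul, ← MvPolynomial.X_pow_eq_monomial]
  exact Ideal.mul_mem_left _ _ (Ideal.subset_span (Or.inl ⟨i, rfl⟩))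

end PowEsymm

/-! ### Extraction of coefficients -/

section Extract

variable {ι κ τ : Type} [Fintype ι] [DecidableEq ι] [Fintype κ] [DecidableEq κ] [Fintype τ]
  [DecidableEq τ] (e : κ ⊕ τ ≃ ι)

/-- The restriction of an exponent to the variables in the first block. -/
def restrictExp (μ : ι →₀ ℕ) : κ →₀ ℕ := Finsupp.equivFunOnFinite.symm fun i => μ (e (Sum.inl i))

theorem restrictExp_apply (μ : ι →₀ ℕ) (i : κ) : restrictExp e μ i = μ (e (Sum.inl i)) := rfl

/-- The coefficient of the product of the `a`-th powers of the variables in the second block. -/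
def extract (a : ℕ) : MvPolynomial ι ℂ →ₗ[ℂ] MvPolynomial κ ℂ :=
  (MvPolynomial.basisMonomials ι ℂ).constr ℂ fun μ =>
    if ∀ t, μ (e (Sum.inr t)) = a then MvPolynomial.monomial (restrictExp e μ) 1 else 0

theorem extract_monomial (a : ℕ) (μ : ι →₀ ℕ) (c : ℂ) :
    extract e a (MvPolynomial.monomial μ c) =
      if ∀ t, μ (e (Sum.inr t)) = a then MvPolynomial.monomial (restrictExp e μ) c else 0 := by
  have h : MvPolynomial.monomial μ c = c • MvPolynomial.basisMonomials ι ℂ μ := by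
    rw [MvPolynomial.coe_basisMonomials, MvPolynomial.smul_monomial, smul_eq_mul, mul_one]
  rw [h, map_smul, extract, Module.Basis.constr_basis]
  split_ifs
  · rw [MvPolynomial.smul_monomial, smul_eq_mul, mul_one]
  · rw [smul_zero]

/-- The inclusion of the first block. -/
def inlEmb : κ ↪ ι := Function.Embedding.inl.trans e.toEmbedding

theorem inlEmb_apply (i : κ) : inlEmb e i = e (Sum.inl i) := rfl

/-- A factor in the variables of the first block leaves the exponents on the second block unchanged.
-/
theorem extract_mul_rename (a : ℕ) (p : MvPolynomial ι ℂ) (s : MvPolynomial κ ℂ) :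
    extract e a (p * MvPolynomial.rename (inlEmb e) s) = extract e a p * s := by
  induction p using MvPolynomial.induction_on' with
  | add p q hp hq => rw [add_mul, map_add, map_add, hp, hq, add_mul]
  | monomial μ c =>
    induction s using MvPolynomial.induction_on' with
    | add p q hp hq => rw [map_add, mul_add, map_add, hp, hq, mul_add]
    | monomial ν b =>
      rw [MvPolynomial.rename_monomial, MvPolynomial.monomial_mul, extract_monomial,
        extract_monomial]
      have h1 : ∀ t, (ν.mapDomain (inlEmb e)) (e (Sum.inr t)) = 0 := by
        intro t
        refine Finsupp.mapDomain_of_notMem_range _ _ ?_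
        rintro ⟨i, hi⟩
        simpa using e.injective hi
      have h2 : restrictExp e (μ + ν.mapDomain (inlEmb e)) = restrictExp e μ + ν := by
        ext i
        rw [restrictExp_apply, Finsupp.add_apply, Finsupp.add_apply, restrictExp_apply,
          ← inlEmb_apply, Finsupp.mapDomain_apply (inlEmb e).injective]
      simp only [Finsupp.add_apply, h1, add_zero, h2]
      split_ifs
      · rw [MvPolynomial.monomial_mul]
      · rw [zero_mul]

/-- The product of the `a`-th powers of the variables in the second block. -/
def blockPow (a : ℕ) : MvPolynomial ι ℂ := ∏ t : τ, MvPolynomial.X (e (Sum.inr t)) ^ a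

theorem monomial_eq_prod {σ : Type} [Fintype σ] (μ : σ →₀ ℕ) (c : ℂ) :
    MvPolynomial.monomial μ c = MvPolynomial.C c * ∏ i, MvPolynomial.X i ^ μ i := by
  rw [MvPolynomial.monomial_eq, Finsupp.prod_fintype _ _ fun _ => pow_zero _]

/-- The extension of an exponent by the value `a` on the second block. -/
def extendExp (ν : κ →₀ ℕ) (a : ℕ) : ι →₀ ℕ :=
  Finsupp.equivFunOnFinite.symm fun x => Sum.elim ν (fun _ => a) (e.symm x)

theorem extendExp_inl (ν : κ →₀ ℕ) (a : ℕ) (i : κ) : extendExp e ν a (e (Sum.inl i)) = ν i := by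
  simp [extendExp]

theorem extendExp_inr (ν : κ →₀ ℕ) (a : ℕ) (t : τ) : extendExp e ν a (e (Sum.inr t)) = a := by
  simp [extendExp]

theorem blockPow_mul_rename_monomial (a : ℕ) (ν : κ →₀ ℕ) (c : ℂ) :
    blockPow e a * MvPolynomial.rename (inlEmb e) (MvPolynomial.monomial ν c) =
      MvPolynomial.monomial (extendExp e ν a) c := by
  rw [monomial_eq_prod, monomial_eq_prod, ← Equiv.prod_comp e, Fintype.prod_sum_type, map_mul,
    map_prod]
  simp only [extendExp_inl, extendExp_inr, map_pow, MvPolynomial.rename_X, inlEmb_apply,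
    MvPolynomial.algHom_C, MvPolynomial.algebraMap_eq, blockPow]
  ring

theorem restrictExp_extendExp (ν : κ →₀ ℕ) (a : ℕ) : restrictExp e (extendExp e ν a) = ν := by
  ext i
  rw [restrictExp_apply, extendExp_inl]

theorem extract_blockPow_mul_rename (a : ℕ) (s : MvPolynomial κ ℂ) :
    extract e a (blockPow e a * MvPolynomial.rename (inlEmb e) s) = s := by
  induction s using MvPolynomial.induction_on' with
  | add p q hp hq => rw [map_add, mul_add, map_add, hp, hq]
  | monomial ν c =>
    rw [blockPow_mul_rename_monomial, extract_monomial, if_pos fun t => extendExp_inr e ν a t,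
      restrictExp_extendExp]

theorem blockPow_mul_rename_extract_monomial (a : ℕ) (μ : ι →₀ ℕ) (c : ℂ) :
    blockPow e a * MvPolynomial.rename (inlEmb e) (extract e a (MvPolynomial.monomial μ c)) =
      if ∀ t, μ (e (Sum.inr t)) = a then MvPolynomial.monomial μ c else 0 := by
  rw [extract_monomial]
  split_ifs with h
  · rw [blockPow_mul_rename_monomial]
    refine congrArg (fun ν => MvPolynomial.monomial ν c) (Finsupp.ext fun x => ?_)
    obtain ⟨x | x, rfl⟩ := e.surjective x
    · rw [extendExp_inl, restrictExp_apply]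
    · rw [extendExp_inr, h]
  · rw [map_zero, mul_zero]

end Extract

/-! ### The action of monomial matrices on monomials -/

section Action

variable {r : ℕ} {ι κ : Type} [Fintype ι] [DecidableEq ι] [Fintype κ] [DecidableEq κ]

/-- The scalar `c` in `g x_i = c x_{perm g i}`. -/
def GG.coef (g : GG r ι) (i : ι) : ℂ := (g⁻¹).mat i (g.perm i)

theorem GG.perm_inv (g : GG r ι) : (g⁻¹).perm = g.perm⁻¹ := map_inv GG.permHom g

theorem GG.coef_mul_mat (g : GG r ι) (i : ι) : g.coef i * g.mat (g.perm i) i = 1 := by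
  have hi : (g⁻¹).perm (g.perm i) = i := by
    rw [GG.perm_inv]
    simp
  have h := GG.mat_mul_apply g⁻¹ g i
  rw [hi, inv_mul_cancel, GG.mat_one, Matrix.one_apply_eq] at h
  exact h.symm

theorem GG.coef_pow (g : GG r ι) (i : ι) : g.coef i ^ r = 1 := by
  have h : g.mat (g.perm i) i ^ r = 1 := g.2.root _ _ (g.mat_perm_ne_zero i)
  have h2 := congrArg (· ^ r) (g.coef_mul_mat i)
  simp only [mul_pow, one_pow] at h2
  rwa [h, mul_one] at h2

theorem glAct_X_eq (g : GG r ι) (i : ι) :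
    glAct (g : GL ι ℂ) (MvPolynomial.X i) =
      MvPolynomial.C (g.coef i) * MvPolynomial.X (g.perm i) := by
  change linSubst _ _ = _
  rw [linSubst_X]
  change ∑ j, MvPolynomial.C ((g⁻¹).mat i j) * MvPolynomial.X j = _
  rw [Finset.sum_eq_single (g.perm i)]
  · rfl
  · intro j _ hj
    rw [GG.mat_eq, if_neg, MvPolynomial.C_0, zero_mul]
    rw [GG.perm_inv]
    intro h
    exact hj (by rw [h]; simp)
  · simp

theorem glAct_monomial (g : GG r ι) (μ : ι →₀ ℕ) (c : ℂ) :
    glAct (g : GL ι ℂ) (MvPolynomial.monomial μ c) =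
      MvPolynomial.monomial (μ.equivMapDomain g.perm) (c * ∏ i, g.coef i ^ μ i) := by
  rw [monomial_eq_prod, monomial_eq_prod, map_mul, map_prod,
    ← Equiv.prod_comp g.perm fun i => MvPolynomial.X i ^ (μ.equivMapDomain g.perm) i]
  simp only [map_pow, glAct_X_eq, mul_pow, Finset.prod_mul_distrib, MvPolynomial.algHom_C,
    MvPolynomial.algebraMap_eq, map_mul, map_prod, Finsupp.equivMapDomain_apply,
    Equiv.symm_apply_apply]
  ring

theorem GG.blockProd_coef_inl (g : GG r ι × GG r κ) (i : ι) :
    (GG.blockProd g).coef (Sum.inl i) = g.1.coef i := by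
  rw [GG.coef, GG.blockProd_perm_inl, ← map_inv]
  rfl

theorem GG.reindex_coef (e : ι ≃ κ) (g : GG r ι) (i : ι) : (GG.reindex e g).coef (e i) = g.coef i := by
  rw [GG.coef, GG.reindex_perm, ← map_inv, GG.reindex_mat]
  rfl

/-- The second block permutes its variables, which carry equal exponents, and multiplies them by
`r`-th roots of unity, which disappear because the exponent is a multiple of `r`. This is why the
second factor acts trivially on the summand. -/
theorem extract_glAct {τ : Type} [Fintype τ] [DecidableEq τ] (e : κ ⊕ τ ≃ ι) (a : ℕ)
    (g : GG r κ × GG r τ) (f : MvPolynomial ι ℂ) :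
    extract e (a * r) (glAct (GG.reindex e (GG.blockProd g) : GL ι ℂ) f) =
      glAct (g.1 : GL κ ℂ) (extract e (a * r) f) := by
  induction f using MvPolynomial.induction_on' with
  | add p q hp hq => rw [map_add, map_add, map_add, map_add, hp, hq]
  | monomial μ c =>
    rw [glAct_monomial, extract_monomial, extract_monomial]
    have hr : ∀ t, (GG.reindex e (GG.blockProd g)).perm.symm (e (Sum.inr (g.2.perm t))) =
        e (Sum.inr t) := by
      intro t
      rw [Equiv.symm_apply_eq, GG.reindex_perm, GG.blockProd_perm_inr]
    have hl : ∀ i, (GG.reindex e (GG.blockProd g)).perm.symm (e (Sum.inl (g.1.perm i))) =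
        e (Sum.inl i) := by
      intro i
      rw [Equiv.symm_apply_eq, GG.reindex_perm, GG.blockProd_perm_inl]
    have hiff : (∀ t, (μ.equivMapDomain (GG.reindex e (GG.blockProd g)).perm) (e (Sum.inr t)) =
        a * r) ↔ ∀ t, μ (e (Sum.inr t)) = a * r := by
      rw [← g.2.perm.forall_congr_right]
      simp only [Finsupp.equivMapDomain_apply, hr]
    by_cases h : ∀ t, μ (e (Sum.inr t)) = a * r
    · rw [if_pos (hiff.2 h), if_pos h, glAct_monomial]
      refine congrArg₂ (fun ν (b : ℂ) => MvPolynomial.monomial ν b) (Finsupp.ext fun i => ?_) ?_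
      · obtain ⟨i, rfl⟩ := g.1.perm.surjective i
        rw [restrictExp_apply, Finsupp.equivMapDomain_apply, hl, Finsupp.equivMapDomain_apply,
          Equiv.symm_apply_apply, restrictExp_apply]
      · congr 1
        rw [← Equiv.prod_comp e, Fintype.prod_sum_type]
        simp only [GG.reindex_coef, GG.blockProd_coef_inl, h, restrictExp_apply]
        rw [Finset.prod_eq_one (s := (Finset.univ : Finset τ)), mul_one]
        intro t _
        rw [← GG.reindex_coef e, mul_comm a r, pow_mul, GG.coef_pow, one_pow]
    · rw [if_neg fun h' => h (hiff.1 h'), if_neg h, map_zero]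

end Action

/-- Extraction is not multiplicative. The polynomials all of whose multiples are extracted into the
ideal of `S_{m,k}` nevertheless form an ideal `B`, and it suffices to find the generators in it.
Multiples of `x_t^{kr+1}` with `t` in the second block are extracted to zero. The symmetric
generators lie in the ideal generated by those in the first block alone, over whose polynomials
extraction is linear. -/
theorem extract_mem_coinvIdeal {r n k m z : ℕ} (e : Fin m ⊕ Fin z ≃ Fin n) {f : MvPolynomial (Fin n) ℂ}
    (hf : f ∈ coinvIdeal r n k (k * r + 1)) :
    extract e (k * r) f ∈ coinvIdeal r m k (k * r) := by
  let B : Ideal (MvPolynomial (Fin n) ℂ) :=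
    { carrier := {f | ∀ p, extract e (k * r) (p * f) ∈ coinvIdeal r m k (k * r)}
      zero_mem' := fun p => by
        rw [mul_zero, map_zero]
        exact Submodule.zero_mem _
      add_mem' := fun ha hb p => by
        rw [mul_add, map_add]
        exact add_mem (ha p) (hb p)
      smul_mem' := fun c x hx p => by
        rw [smul_eq_mul, ← mul_assoc]
        exact hx _ }
  have hren : ∀ s ∈ coinvIdeal r m k (k * r), MvPolynomial.rename (inlEmb e) s ∈ B := by
    intro s hs p
    rw [extract_mul_rename]
    exact Ideal.mul_mem_left _ _ hs
  have hB : coinvIdeal r n k (k * r + 1) ≤ B := by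
    rw [coinvIdeal, Ideal.span_le]
    rintro _ (⟨x, rfl⟩ | ⟨d, hd, hd', rfl⟩)
    · obtain ⟨i | t, rfl⟩ := e.surjective x
      · have := hren (MvPolynomial.X i ^ (k * r + 1)) (by
          rw [pow_succ]
          exact Ideal.mul_mem_right _ _ (Ideal.subset_span (Or.inl ⟨i, rfl⟩)))
        rwa [map_pow, MvPolynomial.rename_X] at this
      · intro p
        induction p using MvPolynomial.induction_on' with
        | add p q hp hq =>
          rw [add_mul, map_add]
          exact add_mem hp hq
        | monomial μ c =>
          rw [MvPolynomial.X_pow_eq_monomial, MvPolynomial.monomial_mul, extract_monomial, if_neg]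
          · exact Submodule.zero_mem _
          · intro h
            have := h t
            rw [Finsupp.add_apply, Finsupp.single_eq_same] at this
            omega
    · rw [expand_esymm]
      have hle : powEsymmIdeal r k (Finset.univ.map (inlEmb e)) ≤ B := by
        rw [powEsymmIdeal, Ideal.span_le]
        rintro _ ⟨d, hd, rfl⟩
        rw [Finset.card_map, Finset.card_univ, Fintype.card_fin] at hd
        rw [← rename_expand_esymm]
        refine hren _ ?_
        rw [expand_esymm]
        exact powEsymmIdeal_univ_le_coinvIdeal r m k _
          (powEsymm_mem (by rwa [Finset.card_univ, Fintype.card_fin]))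
      exact hle (powEsymmIdeal_univ_le r k _ (powEsymm_mem (by
        rwa [Finset.card_univ, Fintype.card_fin])))
  have := hB hf 1
  rwa [one_mul] at this

/-! ### Membership in the ideal of `R_{n,k}` -/

/-- The monomial ideal of the monomials in which at least `t` exponents are at least `a`. -/
def highIdeal (n a t : ℕ) : Ideal (MvPolynomial (Fin n) ℂ) :=
  Ideal.span ((fun μ => MvPolynomial.monomial μ 1) ''
    {μ : Fin n →₀ ℕ | t ≤ (Finset.univ.filter fun i => a ≤ μ i).card})

theorem mem_highIdeal {n a t : ℕ} {f : MvPolynomial (Fin n) ℂ} :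
    f ∈ highIdeal n a t ↔
      ∀ μ ∈ f.support, t ≤ (Finset.univ.filter fun i => a ≤ μ i).card := by
  rw [highIdeal, MvPolynomial.mem_ideal_span_monomial_image]
  refine forall_congr' fun μ => imp_congr_right fun _ => ⟨?_, fun h => ⟨μ, h, le_rfl⟩⟩
  rintro ⟨ν, hν, hle⟩
  refine le_trans hν (Finset.card_le_card fun i hi => ?_)
  rw [Finset.mem_filter] at hi ⊢
  exact ⟨hi.1, hi.2.trans (hle i)⟩

theorem monomial_mem_highIdeal {n a t : ℕ} {μ : Fin n →₀ ℕ}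
    (h : t ≤ (Finset.univ.filter fun i => a ≤ μ i).card) (c : ℂ) :
    MvPolynomial.monomial μ c ∈ highIdeal n a t := by
  rw [mem_highIdeal]
  intro ν hν
  rwa [Finset.mem_singleton.1 (MvPolynomial.support_monomial_subset hν)]

/-- Check the generators of the ideal of `S_{m,k}`. Times the block power, `x_i^{kr}` acquires one
more exponent that is at least `kr`. A symmetric generator in the first block lands in the ideal of
`R_{n,k}` itself, as each factor `x_t^{kr}` adjoins a variable (`prod_X_pow_mul_mem`). -/
theorem blockPow_mul_rename_mem {r n k m z : ℕ} (e : Fin m ⊕ Fin z ≃ Fin n)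
    {s : MvPolynomial (Fin m) ℂ} (hs : s ∈ coinvIdeal r m k (k * r)) :
    blockPow e (k * r) * MvPolynomial.rename (inlEmb e) s ∈
      coinvIdeal r n k (k * r + 1) ⊔ highIdeal n (k * r) (z + 1) := by
  let B : Ideal (MvPolynomial (Fin n) ℂ) := Submodule.comap
    (LinearMap.mulLeft (MvPolynomial (Fin n) ℂ) (blockPow e (k * r)))
    (coinvIdeal r n k (k * r + 1) ⊔ highIdeal n (k * r) (z + 1))
  have hB : coinvIdeal r m k (k * r) ≤ B.comap (MvPolynomial.rename (inlEmb e)) := by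
    rw [coinvIdeal, Ideal.span_le]
    rintro _ (⟨i, rfl⟩ | ⟨d, hd, hd', rfl⟩)
    · change blockPow e (k * r) * MvPolynomial.rename (inlEmb e) (MvPolynomial.X i ^ (k * r)) ∈
        coinvIdeal r n k (k * r + 1) ⊔ highIdeal n (k * r) (z + 1)
      rw [MvPolynomial.X_pow_eq_monomial, blockPow_mul_rename_monomial]
      refine Ideal.mem_sup_right (monomial_mem_highIdeal ?_ _)
      have h1 : ((insert (Sum.inl i) (Finset.univ.map Function.Embedding.inr)).map
          e.toEmbedding).card = z + 1 := by
        rw [Finset.card_map, Finset.card_insert_of_notMem (by simp), Finset.card_map,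
          Finset.card_univ, Fintype.card_fin]
      rw [← h1]
      refine Finset.card_le_card fun x hx => ?_
      rw [Finset.mem_filter]
      refine ⟨Finset.mem_univ _, ?_⟩
      obtain ⟨y, hy, rfl⟩ := Finset.mem_map.1 hx
      rcases Finset.mem_insert.1 hy with rfl | hy
      · change _ ≤ extendExp e _ _ (e (Sum.inl i))
        rw [extendExp_inl, Finsupp.single_eq_same]
      · obtain ⟨t, -, rfl⟩ := Finset.mem_map.1 hy
        change _ ≤ extendExp e _ _ (e (Sum.inr t))
        rw [extendExp_inr]
    · change blockPow e (k * r) * MvPolynomial.rename (inlEmb e)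
        (MvPolynomial.expand r (MvPolynomial.esymm (Fin m) ℂ d)) ∈
        coinvIdeal r n k (k * r + 1) ⊔ highIdeal n (k * r) (z + 1)
      rw [rename_expand_esymm]
      refine Ideal.mem_sup_left (powEsymmIdeal_univ_le_coinvIdeal r n k _ ?_)
      have h1 : blockPow e (k * r) = ∏ i ∈ Finset.univ.map (Function.Embedding.inr.trans e.toEmbedding),
          (MvPolynomial.X i ^ r) ^ k := by
        rw [Finset.prod_map, blockPow]
        refine Finset.prod_congr rfl fun t _ => ?_
        rw [← pow_mul, mul_comm k r]
        rfl
      have h2 : (Finset.univ : Finset (Fin n)) =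
          Finset.univ.map (Function.Embedding.inr.trans e.toEmbedding) ∪
            Finset.univ.map (inlEmb e) := by
        refine (Finset.eq_univ_of_forall fun x => ?_).symm
        obtain ⟨i | t, rfl⟩ := e.surjective x
        · exact Finset.mem_union_right _ (Finset.mem_map.2 ⟨i, Finset.mem_univ _, rfl⟩)
        · exact Finset.mem_union_left _ (Finset.mem_map.2 ⟨t, Finset.mem_univ _, rfl⟩)
      rw [h1, h2]
      refine prod_X_pow_mul_mem r k _ _ ?_ (powEsymm_mem ?_)
      · rw [Finset.disjoint_left]
        intro x hx hx'
        obtain ⟨t, -, rfl⟩ := Finset.mem_map.1 hx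
        obtain ⟨i, -, hi⟩ := Finset.mem_map.1 hx'
        simpa using e.injective hi
      · rwa [Finset.card_map, Finset.card_univ, Fintype.card_fin]
  exact hB hs

/-- The projection to the span of the monomials in which all exponents in `T` are equal to `a`. -/
def expProj {n : ℕ} (T : Finset (Fin n)) (a : ℕ) :
    MvPolynomial (Fin n) ℂ →ₗ[ℂ] MvPolynomial (Fin n) ℂ :=
  (MvPolynomial.basisMonomials (Fin n) ℂ).constr ℂ fun μ =>
    if ∀ i ∈ T, μ i = a then MvPolynomial.monomial μ 1 else 0

theorem expProj_monomial {n : ℕ} (T : Finset (Fin n)) (a : ℕ) (μ : Fin n →₀ ℕ) (c : ℂ) :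
    expProj T a (MvPolynomial.monomial μ c) =
      if ∀ i ∈ T, μ i = a then MvPolynomial.monomial μ c else 0 := by
  have h : MvPolynomial.monomial μ c = c • MvPolynomial.basisMonomials (Fin n) ℂ μ := by
    rw [MvPolynomial.coe_basisMonomials, MvPolynomial.smul_monomial, smul_eq_mul, mul_one]
  rw [h, map_smul, expProj, Module.Basis.constr_basis]
  split_ifs
  · rw [MvPolynomial.coe_basisMonomials]
  · rw [smul_zero]

theorem expProj_eq {n m z : ℕ} (e : Fin m ⊕ Fin z ≃ Fin n) {T : Finset (Fin n)}
    (hT : ∀ x, x ∈ T ↔ ∃ t, e (Sum.inr t) = x) (a : ℕ) (f : MvPolynomial (Fin n) ℂ) :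
    expProj T a f = blockPow e a * MvPolynomial.rename (inlEmb e) (extract e a f) := by
  induction f using MvPolynomial.induction_on' with
  | add p q hp hq => rw [map_add, map_add, map_add, mul_add, hp, hq]
  | monomial μ c =>
    rw [blockPow_mul_rename_extract_monomial, expProj_monomial]
    congr 1
    simp only [hT, forall_exists_index, forall_apply_eq_imp_iff]

theorem exists_block_equiv {n t : ℕ} {T : Finset (Fin n)} (hT : T.card = t) :
    ∃ e : Fin (n - t) ⊕ Fin t ≃ Fin n, ∀ x, x ∈ T ↔ ∃ s, e (Sum.inr s) = x := by
  have e1 : Fin t ≃ {x // x ∈ T} := Fintype.equivOfCardEq (by simp [hT])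
  have e2 : Fin (n - t) ≃ {x // ¬ x ∈ T} := Fintype.equivOfCardEq (by
    rw [Fintype.card_fin, Fintype.card_subtype_compl, Fintype.card_coe, hT, Fintype.card_fin])
  refine ⟨(Equiv.sumComm _ _).trans ((Equiv.sumCongr e1 e2).trans (Equiv.sumCompl (· ∈ T))),
    fun x => ⟨fun hx => ⟨e1.symm ⟨x, hx⟩, by simp⟩, ?_⟩⟩
  rintro ⟨s, rfl⟩
  exact (e1 s).2

/-- With more than `t` exponents at least `kr`, every term lies in `highIdeal`. With exactly `t`,
only the set of their positions can give a nonzero projection. Either all these exponents equal `kr`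
and the difference is zero, or one exceeds `kr` and the monomial lies in the ideal of `R_{n,k}`. -/
theorem monomial_sub_sum_expProj_mem {r n k t : ℕ} {μ : Fin n →₀ ℕ}
    (h : t ≤ (Finset.univ.filter fun i => k * r ≤ μ i).card) (c : ℂ) :
    MvPolynomial.monomial μ c - ∑ T ∈ Finset.univ.powersetCard t,
      expProj T (k * r) (MvPolynomial.monomial μ c) ∈
        coinvIdeal r n k (k * r + 1) ⊔ highIdeal n (k * r) (t + 1) := by
  simp only [expProj_monomial]
  rcases h.lt_or_eq with h | h
  · have h1 : MvPolynomial.monomial μ c ∈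
        coinvIdeal r n k (k * r + 1) ⊔ highIdeal n (k * r) (t + 1) :=
      Ideal.mem_sup_right (monomial_mem_highIdeal h c)
    refine sub_mem h1 (sum_mem fun T _ => ?_)
    split_ifs
    · exact h1
    · exact Submodule.zero_mem _
  · rw [Finset.sum_eq_single (Finset.univ.filter fun i => k * r ≤ μ i)]
    · split_ifs with h2
      · rw [sub_self]
        exact Submodule.zero_mem _
      · push Not at h2
        obtain ⟨i, hi, hne⟩ := h2
        rw [sub_zero]
        refine Ideal.mem_sup_left (monomial_mem_coinvIdeal (i := i) ?_ c)
        have := (Finset.mem_filter.1 hi).2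
        omega
    · intro T hT hne
      rw [if_neg]
      intro h2
      refine hne (Finset.eq_of_subset_of_card_le (fun i hi => ?_) ?_)
      · exact Finset.mem_filter.2 ⟨Finset.mem_univ _, (h2 i hi).ge⟩
      · rw [← h, (Finset.mem_powersetCard.1 hT).2]
    · intro h2
      exact absurd (Finset.mem_powersetCard.2 ⟨Finset.subset_univ _, h.symm⟩) h2

/-- The core of injectivity. By induction on `t`, the polynomial lies in the ideal plus the span of
the monomials with at least `t` exponents that are at least `kr`. For `t = n + 1` there are no such
monomials. -/
theorem mem_coinvIdeal_of_extract {r n k : ℕ} {f : MvPolynomial (Fin n) ℂ}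
    (hf : ∀ (m z : ℕ) (e : Fin m ⊕ Fin z ≃ Fin n),
      extract e (k * r) f ∈ coinvIdeal r m k (k * r)) :
    f ∈ coinvIdeal r n k (k * r + 1) := by
  have key : ∀ t, f ∈ coinvIdeal r n k (k * r + 1) ⊔ highIdeal n (k * r) t := by
    intro t
    induction t with
    | zero => exact Ideal.mem_sup_right (mem_highIdeal.2 fun _ _ => Nat.zero_le _)
    | succ t ih =>
      obtain ⟨a, ha, g, hg, rfl⟩ := Submodule.mem_sup.1 ih
      refine add_mem (Ideal.mem_sup_left ha) ?_
      -- The hypothesis passes from `f = a + g` to `g`, because the extractions of `a` lie in the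
      -- ideals already. The projection of `g` at `T` is the block power times the extraction, so it
      -- can be pushed one step further.
      have hQ : ∀ T ∈ Finset.univ.powersetCard t, expProj T (k * r) g ∈
          coinvIdeal r n k (k * r + 1) ⊔ highIdeal n (k * r) (t + 1) := by
        intro T hT
        obtain ⟨e, he⟩ := exists_block_equiv (Finset.mem_powersetCard.1 hT).2
        rw [expProj_eq e he]
        refine blockPow_mul_rename_mem e ?_
        have h1 := hf _ _ e
        rw [map_add] at h1
        exact (Submodule.add_mem_iff_right _ (extract_mem_coinvIdeal e ha)).1 h1
      rw [← sub_add_cancel g (∑ T ∈ Finset.univ.powersetCard t, expProj T (k * r) g)]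
      refine add_mem ?_ (sum_mem hQ)
      have h2 : g - ∑ T ∈ Finset.univ.powersetCard t, expProj T (k * r) g =
          ∑ μ ∈ g.support, (MvPolynomial.monomial μ (g.coeff μ) -
            ∑ T ∈ Finset.univ.powersetCard t,
              expProj T (k * r) (MvPolynomial.monomial μ (g.coeff μ))) := by
        rw [Finset.sum_sub_distrib, MvPolynomial.support_sum_monomial_coeff, Finset.sum_comm]
        simp only [← map_sum, MvPolynomial.support_sum_monomial_coeff]
      rw [h2]
      exact sum_mem fun μ hμ => monomial_sub_sum_expProj_mem (mem_highIdeal.1 hg μ hμ) _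
  obtain ⟨a, ha, g, hg, rfl⟩ := Submodule.mem_sup.1 (key (n + 1))
  have hg0 : g = 0 := by
    rw [← MvPolynomial.support_eq_empty, Finset.eq_empty_iff_forall_notMem]
    intro μ hμ
    have h1 := mem_highIdeal.1 hg μ hμ
    have h2 := Finset.card_filter_le (Finset.univ : Finset (Fin n)) fun i => k * r ≤ μ i
    rw [Finset.card_univ, Fintype.card_fin] at h2
    omega
  rw [hg0, add_zero]
  exact ha

/-- A permutation matrix carries one choice of blocks to another, so extractions at the last
variables, taken on all translates, capture the extractions at arbitrary sets. -/
theorem exists_extract_eq {r n m z : ℕ} (e e0 : Fin m ⊕ Fin z ≃ Fin n) (a : ℕ) :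
    ∃ h : GG r (Fin n), ∀ f, extract e a f = extract e0 a (glAct (h : GL (Fin n) ℂ) f) := by
  obtain ⟨h, hp, hc⟩ := GG.exists_perm_entries (r := r) (e.symm.trans e0) (fun _ => 1) (by simp)
  refine ⟨h, fun f => ?_⟩
  induction f using MvPolynomial.induction_on' with
  | add p q hp hq => rw [map_add, map_add, map_add, hp, hq]
  | monomial μ c =>
    have hcoef : ∀ i, h.coef i = 1 := by
      intro i
      have := h.coef_mul_mat i
      rwa [hp, hc, mul_one] at this
    have he : ∀ x, μ.equivMapDomain h.perm (e0 x) = μ (e x) := by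
      intro x
      rw [Finsupp.equivMapDomain_apply, hp]
      simp
    rw [glAct_monomial, extract_monomial, extract_monomial]
    simp only [he, hcoef, one_pow, Finset.prod_const_one, mul_one]
    congr 1
    refine congrArg (fun ν => MvPolynomial.monomial ν c) (Finsupp.ext fun i => ?_)
    rw [restrictExp_apply, restrictExp_apply, he]

/-! ### Elements with prescribed coefficients -/

theorem GG.ext_perm_entries {r : ℕ} {ι : Type} [Fintype ι] [DecidableEq ι] {g h : GG r ι}
    (hp : g.perm = h.perm) (hm : ∀ j, g.mat (g.perm j) j = h.mat (h.perm j) j) : g = h := by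
  refine GG.ext_mat (Matrix.ext fun i j => ?_)
  rw [GG.mat_eq, GG.mat_eq h, hm, hp]

theorem exists_parabolicTwo {r m z n : ℕ} (hmz : m + z = n) (h : GG r (Fin n))
    (hh : ∀ x, ((finSumFinEquiv.trans (finCongr hmz)).symm x).isRight =
      ((finSumFinEquiv.trans (finCongr hmz)).symm (h.perm x)).isRight) :
    ∃ g, parabolicTwo r hmz g = h := by
  obtain ⟨h, rfl⟩ := GG.reindex_surjective (finSumFinEquiv.trans (finCongr hmz)) h
  have hp : ∀ x, x.isRight = (h.perm x).isRight := by
    intro x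
    have := hh (finSumFinEquiv.trans (finCongr hmz) x)
    rwa [GG.reindex_perm, Equiv.symm_apply_apply, Equiv.symm_apply_apply] at this
  obtain ⟨⟨σ, τ⟩, hστ⟩ := Equiv.Perm.mem_sumCongrHom_range_of_perm_mapsTo_inl (σ := h.perm) (by
    rintro _ ⟨x, rfl⟩
    have := hp (Sum.inl x)
    rcases hx : h.perm (Sum.inl x) with y | y
    · exact ⟨y, rfl⟩
    · rw [hx] at this
      cases this)
  have h1 : ∀ i, h.perm (Sum.inl i) = Sum.inl (σ i) := fun i => by rw [← hστ]; rfl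
  have h2 : ∀ i, h.perm (Sum.inr i) = Sum.inr (τ i) := fun i => by rw [← hστ]; rfl
  obtain ⟨g1, hg1, hc1⟩ := GG.exists_perm_entries (r := r) σ
    (fun i => h.mat (h.perm (Sum.inl i)) (Sum.inl i)) fun i =>
      ⟨h.mat_perm_ne_zero _, h.2.root _ _ (h.mat_perm_ne_zero _)⟩
  obtain ⟨g2, hg2, hc2⟩ := GG.exists_perm_entries (r := r) τ
    (fun i => h.mat (h.perm (Sum.inr i)) (Sum.inr i)) fun i =>
      ⟨h.mat_perm_ne_zero _, h.2.root _ _ (h.mat_perm_ne_zero _)⟩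
  refine ⟨(g1, g2), congrArg (GG.reindex (finSumFinEquiv.trans (finCongr hmz))) ?_⟩
  refine GG.ext_perm_entries (Equiv.ext fun x => ?_) fun x => ?_
  · rcases x with i | i
    · rw [GG.blockProd_perm_inl, h1, hg1]
    · rw [GG.blockProd_perm_inr, h2, hg2]
  · rcases x with i | i
    · rw [GG.blockProd_perm_inl, hg1]
      exact hc1 i
    · rw [GG.blockProd_perm_inr, hg2]
      exact hc2 i

theorem card_isRight {n m z : ℕ} (e : Fin m ⊕ Fin z ≃ Fin n) :
    (Finset.univ.filter fun x => (e.symm x).isRight = true).card = z := by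
  have : (Finset.univ.filter fun x => (e.symm x).isRight = true) =
      Finset.univ.map (Function.Embedding.inr.trans e.toEmbedding) := by
    ext x
    obtain ⟨i | i, rfl⟩ := e.surjective x <;> simp
  rw [this, Finset.card_map, Finset.card_univ, Fintype.card_fin]

/-- The variables of the monomial with exponent at least `a` are exactly the second block of `e`. A
nonzero extraction forces exponent `a` on the second block of `e'` after the action of `h`, and a
result outside the ideal forbids exponents at least `a` elsewhere. So `h` carries one block onto the
other. -/
theorem isRight_iff_of_extract {r n k a m z m' z' : ℕ} (e : Fin m ⊕ Fin z ≃ Fin n)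
    (e' : Fin m' ⊕ Fin z' ≃ Fin n) (h : GG r (Fin n)) {ν : Fin m →₀ ℕ} (hν : ∀ i, ν i < a) (c : ℂ)
    (hne : extract e' a (glAct (h : GL (Fin n) ℂ) (MvPolynomial.monomial (extendExp e ν a) c)) ∉
      coinvIdeal r m' k a) :
    z' = z ∧ ∀ x, (e.symm x).isRight = (e'.symm (h.perm x)).isRight := by
  rw [glAct_monomial, extract_monomial] at hne
  split_ifs at hne with h1
  · have h2 : ∀ x, a ≤ extendExp e ν a x ↔ (e.symm x).isRight = true := by
      intro x
      obtain ⟨i | i, rfl⟩ := e.surjective x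
      · rw [extendExp_inl, Equiv.symm_apply_apply]
        simpa using hν i
      · rw [extendExp_inr, Equiv.symm_apply_apply]
        simp
    have h3 : ∀ y, a ≤ (extendExp e ν a).equivMapDomain h.perm y ↔ (e'.symm y).isRight = true := by
      intro y
      obtain ⟨i | i, rfl⟩ := e'.surjective y
      · rw [Equiv.symm_apply_apply]
        simp only [Sum.isRight_inl, Bool.false_eq_true, iff_false]
        intro hle
        exact hne (monomial_mem_coinvIdeal (i := i) (by rwa [restrictExp_apply]) _)
      · rw [Equiv.symm_apply_apply, h1]
        simp
    have h4 : ∀ x, (e.symm x).isRight = (e'.symm (h.perm x)).isRight := by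
      intro x
      rw [Bool.eq_iff_iff, ← h2, ← h3, Finsupp.equivMapDomain_apply, Equiv.symm_apply_apply]
    refine ⟨?_, h4⟩
    rw [← card_isRight e, ← card_isRight e']
    simp only [h4]
    symm
    exact Finset.card_bij (fun x _ => h.perm x) (by simp) (fun _ _ _ _ h' => h.perm.injective h')
      fun y hy => ⟨h.perm.symm y, by simpa using hy, by simp⟩
  · exact absurd (Submodule.zero_mem _) hne

/-- Monomials with an exponent at least `a` lie in the ideal and are dropped. The inclusion of
supports keeps the representative homogeneous when `p` is. -/
theorem exists_reduced {r m k a : ℕ} (p : MvPolynomial (Fin m) ℂ) :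
    ∃ q, p - q ∈ coinvIdeal r m k a ∧ (∀ μ ∈ q.support, ∀ i, μ i < a) ∧ q.support ⊆ p.support := by
  set s := p.support.filter fun μ => ∀ i, μ i < a with hs
  set q := ∑ μ ∈ s, MvPolynomial.monomial μ (p.coeff μ) with hq
  have hsupp : q.support ⊆ s := by
    intro μ hμ
    rw [MvPolynomial.mem_support_iff, hq, MvPolynomial.coeff_sum] at hμ
    obtain ⟨ν, hν, h⟩ := Finset.exists_ne_zero_of_sum_ne_zero hμ
    rw [MvPolynomial.coeff_monomial] at h
    split_ifs at h with h2
    · exact h2 ▸ hν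
    · exact absurd rfl h
  refine ⟨q, ?_, fun μ hμ => (Finset.mem_filter.1 (hsupp hμ)).2, fun μ hμ =>
    (Finset.mem_filter.1 (hsupp hμ)).1⟩
  have h1 : p - q = ∑ μ ∈ p.support.filter fun μ => ¬ ∀ i, μ i < a,
      MvPolynomial.monomial μ (p.coeff μ) := by
    rw [sub_eq_iff_eq_add', hq, hs, Finset.sum_filter_add_sum_filter_not,
      MvPolynomial.support_sum_monomial_coeff]
  rw [h1]
  refine sum_mem fun μ hμ => ?_
  have h2 := (Finset.mem_filter.1 hμ).2
  push Not at h2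
  obtain ⟨i, hi⟩ := h2
  exact monomial_mem_coinvIdeal hi _

theorem blockPow_mul_rename_eq_sum {n m z : ℕ} (e : Fin m ⊕ Fin z ≃ Fin n) (a : ℕ)
    (q : MvPolynomial (Fin m) ℂ) :
    blockPow e a * MvPolynomial.rename (inlEmb e) q =
      ∑ ν ∈ q.support, MvPolynomial.monomial (extendExp e ν a) (q.coeff ν) := by
  conv_lhs => rw [← MvPolynomial.support_sum_monomial_coeff q, map_sum, Finset.mul_sum]
  exact Finset.sum_congr rfl fun ν _ => blockPow_mul_rename_monomial e a ν _

theorem blockPow_mul_rename_isHomogeneous {n m z : ℕ} (e : Fin m ⊕ Fin z ≃ Fin n) (a : ℕ)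
    {q : MvPolynomial (Fin m) ℂ} {d : ℕ} (hq : q.IsHomogeneous d) :
    (blockPow e a * MvPolynomial.rename (inlEmb e) q).IsHomogeneous (a * z + d) := by
  refine MvPolynomial.IsHomogeneous.mul ?_ (hq.rename_isHomogeneous)
  have := MvPolynomial.IsHomogeneous.prod (Finset.univ : Finset (Fin z))
    (fun t => (MvPolynomial.X (e (Sum.inr t)) : MvPolynomial (Fin n) ℂ) ^ a) (fun _ => a)
    fun t _ => MvPolynomial.isHomogeneous_X_pow _ _
  rw [Finset.sum_const, Finset.card_univ, Fintype.card_fin, smul_eq_mul, mul_comm] at this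
  exact this

/-- Extraction removes a factor of degree `a * z`. Degrees below that are treated separately because
subtraction of natural numbers truncates. -/
theorem extract_isHomogeneous {n m z : ℕ} (e : Fin m ⊕ Fin z ≃ Fin n) (a : ℕ)
    {f : MvPolynomial (Fin n) ℂ} {d : ℕ} (hf : f.IsHomogeneous d) :
    (a * z ≤ d → (extract e a f).IsHomogeneous (d - a * z)) ∧ (d < a * z → extract e a f = 0) := by
  have hdeg : ∀ μ ∈ f.support, (∀ t, μ (e (Sum.inr t)) = a) → (restrictExp e μ).degree + a * z = d := by
    intro μ hμ h
    have h1 : μ.degree = d := by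
      rw [Finsupp.degree_eq_weight_one]
      exact hf (MvPolynomial.mem_support_iff.1 hμ)
    rw [Finsupp.degree_eq_sum, ← Equiv.sum_comp e,
      Fintype.sum_sum_type] at h1
    simp only [h, Finset.sum_const, Finset.card_univ, Fintype.card_fin, smul_eq_mul] at h1
    rw [Finsupp.degree_eq_sum, mul_comm a z]
    exact h1
  have hsum : extract e a f = ∑ μ ∈ f.support,
      if ∀ t, μ (e (Sum.inr t)) = a then MvPolynomial.monomial (restrictExp e μ) (f.coeff μ)
        else 0 := by
    conv_lhs => rw [← MvPolynomial.support_sum_monomial_coeff f, map_sum]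
    exact Finset.sum_congr rfl fun μ _ => (extract_monomial e a μ _).trans (by congr)
  rw [hsum]
  constructor
  · intro hd
    refine MvPolynomial.IsHomogeneous.sum _ _ _ fun μ hμ => ?_
    split_ifs with h
    · have := hdeg μ hμ h
      exact MvPolynomial.isHomogeneous_monomial _ (by omega)
    · exact MvPolynomial.isHomogeneous_zero _ _ _
  · intro hd
    refine Finset.sum_eq_zero fun μ hμ => if_neg fun h => ?_
    have := hdeg μ hμ h
    omega

/-! ### The maps `R_{n,k} → S_{n-z,k}` -/

/-- The identification of `Fin n` with two blocks used in `parabolicTwo`. -/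
def tailEquiv {n z : ℕ} (hz : z ≤ n) : Fin (n - z) ⊕ Fin z ≃ Fin n :=
  finSumFinEquiv.trans (finCongr (Nat.sub_add_cancel hz))

/-- The map `R_{n,k} → S_{n-z,k}` that extracts the coefficient of the `kr`-th power of the product
of the last `z` variables. -/
def projS (r k : ℕ) {n z : ℕ} (hz : z ≤ n) :
    CoinvQuot r n k (k * r + 1) →ₗ[ℂ] CoinvQuot r (n - z) k (k * r) :=
  ((coinvIdeal r n k (k * r + 1)).restrictScalars ℂ).liftQ
    ((Ideal.Quotient.mkₐ ℂ (coinvIdeal r (n - z) k (k * r))).toLinearMap ∘ₗ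
      extract (tailEquiv hz) (k * r))
    (fun _ hf => Ideal.Quotient.eq_zero_iff_mem.2 (extract_mem_coinvIdeal (tailEquiv hz) hf)) ∘ₗ
  (Submodule.Quotient.restrictScalarsEquiv ℂ (coinvIdeal r n k (k * r + 1))).symm.toLinearMap

theorem projS_mk (r k : ℕ) {n z : ℕ} (hz : z ≤ n) (f : MvPolynomial (Fin n) ℂ) :
    projS r k hz (Ideal.Quotient.mk _ f) =
      Ideal.Quotient.mk _ (extract (tailEquiv hz) (k * r) f) := rfl

theorem projS_parabolicTwo (r k : ℕ) {n z : ℕ} (hz : z ≤ n)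
    (g : GG r (Fin (n - z)) × GG r (Fin z)) (w : CoinvQuot r n k (k * r + 1)) :
    projS r k hz (repR r n k (parabolicTwo r (Nat.sub_add_cancel hz) g) w) =
      repS r (n - z) k g.1 (projS r k hz w) := by
  obtain ⟨f, rfl⟩ := Ideal.Quotient.mk_surjective w
  exact congrArg (Ideal.Quotient.mk _) (extract_glAct (tailEquiv hz) k g f)

theorem eq_zero_of_projS {r n k : ℕ} (w : CoinvQuot r n k (k * r + 1))
    (hw : ∀ (z : Fin (n - k + 1)) h, projS r k (summand_le z) (repR r n k h w) = 0) : w = 0 := by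
  obtain ⟨f, rfl⟩ := Ideal.Quotient.mk_surjective w
  refine Ideal.Quotient.eq_zero_iff_mem.2 (mem_coinvIdeal_of_extract fun m z e => ?_)
  have hmz : m + z = n := by simpa using Fintype.card_congr e
  obtain rfl : m = n - z := by omega
  have hz : z ≤ n := by omega
  by_cases hk : z < n - k + 1
  · obtain ⟨h, hh⟩ := exists_extract_eq (r := r) e (tailEquiv hz) (k * r)
    rw [hh]
    exact Ideal.Quotient.eq_zero_iff_mem.1 (hw ⟨z, hk⟩ h)
  -- If `z > n - k`, fewer than `k` variables remain and `e_0 = 1` is among the generators. The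
  -- target is zero, so the summands with `z ≤ n - k` suffice.
  · have h1 : (1 : MvPolynomial (Fin (n - z)) ℂ) ∈ coinvIdeal r (n - z) k (k * r) := by
      refine Ideal.subset_span (Or.inr ⟨0, by omega, Nat.zero_le _, ?_⟩)
      rw [MvPolynomial.esymm_zero, map_one]
    rw [(Ideal.eq_top_iff_one _).2 h1]
    exact Submodule.mem_top

/-- The lift is a representative with all exponents below `kr`, times the `kr`-th power of the last
`z` variables. By `isRight_iff_of_extract` no other summand and no other coset sees any of its
monomials. -/
theorem exists_lift_projS {r n k z : ℕ} (hz : z ≤ n) (p : MvPolynomial (Fin (n - z)) ℂ) :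
    ∃ f : MvPolynomial (Fin n) ℂ, projS r k hz (Ideal.Quotient.mk _ f) = Ideal.Quotient.mk _ p ∧
      (∀ d, p.IsHomogeneous d → f.IsHomogeneous (k * r * z + d)) ∧
      ∀ z' (hz' : z' ≤ n) h, projS r k hz' (repR r n k h (Ideal.Quotient.mk _ f)) ≠ 0 →
        z' = z ∧ ∃ g, parabolicTwo r (Nat.sub_add_cancel hz') g = h := by
  obtain ⟨q, hpq, hq, hsupp⟩ := exists_reduced (r := r) (k := k) (a := k * r) p
  refine ⟨blockPow (tailEquiv hz) (k * r) * MvPolynomial.rename (inlEmb (tailEquiv hz)) q, ?_,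
    fun d hd => ?_, fun z' hz' h hne => ?_⟩
  · rw [projS_mk, extract_blockPow_mul_rename]
    exact (Ideal.Quotient.eq.2 hpq).symm
  · refine blockPow_mul_rename_isHomogeneous _ _ fun μ hμ => hd ?_
    exact MvPolynomial.mem_support_iff.1 (hsupp (MvPolynomial.mem_support_iff.2 hμ))
  · have h1 : extract (tailEquiv hz') (k * r) (glAct (h : GL (Fin n) ℂ)
        (blockPow (tailEquiv hz) (k * r) * MvPolynomial.rename (inlEmb (tailEquiv hz)) q)) ∉
          coinvIdeal r (n - z') k (k * r) :=
      fun hmem => hne (Ideal.Quotient.eq_zero_iff_mem.2 hmem)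
    rw [blockPow_mul_rename_eq_sum, map_sum, map_sum] at h1
    obtain ⟨ν, hν, h2⟩ : ∃ ν ∈ q.support, extract (tailEquiv hz') (k * r) (glAct (h : GL (Fin n) ℂ)
        (MvPolynomial.monomial (extendExp (tailEquiv hz) ν (k * r)) (q.coeff ν))) ∉
          coinvIdeal r (n - z') k (k * r) := by
      by_contra hcon
      push Not at hcon
      exact h1 (sum_mem hcon)
    obtain ⟨rfl, h3⟩ := isRight_iff_of_extract (tailEquiv hz) (tailEquiv hz') h (hq ν hν) _ h2
    exact ⟨rfl, exists_parabolicTwo (Nat.sub_add_cancel hz') h h3⟩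

/-- The grading of `S_{m,k}` shifted by `krz`. -/
def shiftS (r k m z d : ℕ) : Submodule ℂ (CoinvQuot r m k (k * r)) :=
  if k * r * z ≤ d then gradS r m k (d - k * r * z) else ⊥

theorem shiftS_stable (r k m z d : ℕ) (g : GG r (Fin m)) :
    shiftS r k m z d ≤ (shiftS r k m z d).comap (repS r m k g) := by
  unfold shiftS
  split_ifs
  · exact quotGrading_stable r m k (k * r) _ g
  · exact bot_le

theorem gradR_le_comap_projS (r k : ℕ) {n z : ℕ} (hz : z ≤ n) (d : ℕ) :
    gradR r n k d ≤ (shiftS r k (n - z) z d).comap (projS r k hz) := by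
  rintro _ ⟨f, hf, rfl⟩
  rw [Submodule.mem_comap]
  change Ideal.Quotient.mk _ (extract (tailEquiv hz) (k * r) f) ∈ _
  obtain ⟨h1, h2⟩ := extract_isHomogeneous (tailEquiv hz) (k * r) hf
  rw [shiftS]
  split_ifs with h
  · exact ⟨_, h1 h, rfl⟩
  · rw [h2 (not_le.1 h), map_zero]
    exact Submodule.zero_mem _

theorem exists_lift_shiftS {r n k z d : ℕ} (hz : z ≤ n) {a : CoinvQuot r (n - z) k (k * r)}
    (ha : a ∈ shiftS r k (n - z) z d) :
    ∃ f ∈ gradR r n k d, projS r k hz f = a ∧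
      ∀ z' (hz' : z' ≤ n) h, projS r k hz' (repR r n k h f) ≠ 0 →
        z' = z ∧ ∃ g, parabolicTwo r (Nat.sub_add_cancel hz') g = h := by
  rw [shiftS] at ha
  split_ifs at ha with hd
  · obtain ⟨p, hp, rfl⟩ := ha
    obtain ⟨f, hf, hf1, hf2⟩ := exists_lift_projS (r := r) (k := k) hz p
    refine ⟨Ideal.Quotient.mk _ f, ⟨f, ?_, rfl⟩, hf, hf2⟩
    have := hf1 _ hp
    rwa [Nat.add_sub_cancel' hd] at this
  · rw [Submodule.mem_bot] at ha
    subst ha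
    refine ⟨0, Submodule.zero_mem _, map_zero _, fun z' hz' h hne => ?_⟩
    rw [map_zero, map_zero] at hne
    exact absurd rfl hne

/-- Only the pair `(d - krz, krz)` of the antidiagonal contributes, since the second factor is
concentrated in degree `krz`. Tensoring with it is a shift of degrees. -/
theorem gradSC_eq (r k m z d : ℕ) :
    gradSC r k m z d =
      (shiftS r k m z d).map (TensorProduct.rid ℂ (CoinvQuot r m k (k * r))).symm.toLinearMap := by
  apply le_antisymm
  · refine iSup₂_le fun p hp => ?_
    rintro _ ⟨x, rfl⟩
    induction x using TensorProduct.induction_on with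
    | zero => rw [map_zero]; exact Submodule.zero_mem _
    | add x y hx hy => rw [map_add]; exact Submodule.add_mem _ hx hy
    | tmul s c =>
      obtain ⟨s, hs⟩ := s
      obtain ⟨c, hc⟩ := c
      change s ⊗ₜ c ∈ _
      have hpd := Finset.HasAntidiagonal.mem_antidiagonal.1 hp
      rw [concGrading] at hc
      split_ifs at hc with hz
      · refine ⟨c • s, ?_, ?_⟩
        · rw [shiftS, if_pos (by omega)]
          have : d - k * r * z = p.1 := by omega
          rw [this]
          exact Submodule.smul_mem _ _ hs
        · change (c • s) ⊗ₜ[ℂ] (1 : ℂ) = s ⊗ₜ c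
          rw [TensorProduct.smul_tmul, smul_eq_mul, mul_one]
      · rw [Submodule.mem_bot] at hc
        rw [hc, TensorProduct.tmul_zero]
        exact Submodule.zero_mem _
  · rw [Submodule.map_le_iff_le_comap]
    intro s hs
    rw [shiftS] at hs
    split_ifs at hs with hd
    · refine Submodule.mem_iSup_of_mem (d - k * r * z, k * r * z) (Submodule.mem_iSup_of_mem
        (Finset.HasAntidiagonal.mem_antidiagonal.2 (Nat.sub_add_cancel hd)) ?_)
      refine ⟨(⟨s, hs⟩ : gradS r m k (d - k * r * z)) ⊗ₜ (⟨1, ?_⟩ : concGrading ℂ (k * r * z) _), ?_⟩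
      · rw [concGrading, if_pos rfl]
        exact Submodule.mem_top
      · rfl
    · rw [(Submodule.mem_bot ℂ).1 hs]
      exact Submodule.zero_mem _

/-! ### The isomorphism of graded modules -/

theorem gradedIso_sumInd {I H W : Type} [Fintype I] [DecidableEq I] [Group H] [Fintype H]
    [AddCommGroup W] [Module ℂ W] {G V : I → Type} [∀ i, Group (G i)] [∀ i, Fintype (G i)]
    [∀ i, AddCommGroup (V i)] [∀ i, Module ℂ (V i)] {φ : ∀ i, G i →* H}
    {ρ : ∀ i, Representation ℂ (G i) (V i)} {σ : Representation ℂ H W} (π : ∀ i, W →ₗ[ℂ] V i)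
    {𝒲 : ℕ → Submodule ℂ W} {𝒱 : ∀ i, ℕ → Submodule ℂ (V i)}
    (hφ : ∀ i, Function.Injective (φ i)) (hπ : ∀ i g w, π i (σ (φ i g) w) = ρ i g (π i w))
    (hinj : ∀ w, (∀ i h, π i (σ h w) = 0) → w = 0)
    (hsurj : ∀ i a, ∃ f, π i f = a ∧ ∀ j h, π j (σ h f) ≠ 0 → j = i ∧ ∃ g, φ i g = h)
    (hσ : ∀ d h, 𝒲 d ≤ (𝒲 d).comap (σ h)) (hW : ∀ d i, 𝒲 d ≤ (𝒱 i d).comap (π i))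
    (hsurj' : ∀ d i, ∀ a ∈ 𝒱 i d, ∃ f ∈ 𝒲 d, π i f = a ∧
      ∀ j h, π j (σ h f) ≠ 0 → j = i ∧ ∃ g, φ i g = h) :
    GradedIso σ 𝒲 (Representation.directSum fun i => Representation.ind (φ i) (ρ i))
      (sumGrading fun i => indGrading (φ i) (ρ i) (𝒱 i)) :=
  ⟨(toSumInd φ ρ σ π).ofBijective ⟨toSumInd_injective hπ hinj, toSumInd_surjective hφ hπ hsurj⟩,
    fun d => map_toSumInd (𝒱 := fun i => 𝒱 i d) hφ hπ (hσ d) (hW d) (hsurj' d)⟩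

/-- The map `projS` with values in `S_{n-z,k} ⊗ ℂ`. -/
def projSC (r k : ℕ) {n z : ℕ} (hz : z ≤ n) :
    CoinvQuot r n k (k * r + 1) →ₗ[ℂ] CoinvQuot r (n - z) k (k * r) ⊗[ℂ] ℂ :=
  (TensorProduct.rid ℂ (CoinvQuot r (n - z) k (k * r))).symm.toLinearMap ∘ₗ projS r k hz

theorem projSC_eq_zero {r k n z : ℕ} {hz : z ≤ n} {w : CoinvQuot r n k (k * r + 1)} :
    projSC r k hz w = 0 ↔ projS r k hz w = 0 :=
  (TensorProduct.rid ℂ (CoinvQuot r (n - z) k (k * r))).symm.map_eq_zero_iff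

theorem projSC_eq {r k n z : ℕ} {hz : z ≤ n} {w : CoinvQuot r n k (k * r + 1)}
    {a : CoinvQuot r (n - z) k (k * r)} (h : projS r k hz w = a) :
    projSC r k hz w = (TensorProduct.rid ℂ (CoinvQuot r (n - z) k (k * r))).symm a := by
  rw [← h]
  rfl

theorem projSC_parabolicTwo (r k : ℕ) {n z : ℕ} (hz : z ≤ n)
    (g : GG r (Fin (n - z)) × GG r (Fin z)) (w : CoinvQuot r n k (k * r + 1)) :
    projSC r k hz (repR r n k (parabolicTwo r (Nat.sub_add_cancel hz) g) w) =
      repSC r k (n - z) z g (projSC r k hz w) :=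
  projSC_eq (projS_parabolicTwo r k hz g w)

theorem index_eq_of_projS {r n k : ℕ} {z : Fin (n - k + 1)} {f : CoinvQuot r n k (k * r + 1)}
    (hf : ∀ z' (hz' : z' ≤ n) h, projS r k hz' (repR r n k h f) ≠ 0 →
      z' = z ∧ ∃ g, parabolicTwo r (Nat.sub_add_cancel hz') g = h)
    (z' : Fin (n - k + 1)) (h : GG r (Fin n))
    (hne : projS r k (summand_le z') (repR r n k h f) ≠ 0) :
    z' = z ∧ ∃ g, parabolicTwo r (Nat.sub_add_cancel (summand_le z)) g = h := by
  obtain ⟨h1, h2⟩ := hf z' (summand_le z') h hne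
  obtain rfl := Fin.ext h1
  exact ⟨rfl, h2⟩

theorem gradedIso_repR (r n k : ℕ) [NeZero r] :
    GradedIso (repR r n k) (gradR r n k)
      (Representation.directSum fun z : Fin (n - k + 1) => repInd r n k z (summand_le z))
      (sumGrading fun z : Fin (n - k + 1) => gradInd r n k z (summand_le z)) := by
  refine gradedIso_sumInd (fun z : Fin (n - k + 1) => projSC r k (summand_le z))
    (fun z => parabolicTwo_injective r _) (fun z => projSC_parabolicTwo r k (summand_le z))
    (fun w hw => eq_zero_of_projS w fun z h => projSC_eq_zero.1 (hw z h)) (fun z a => ?_)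
    (quotGrading_stable r n k (k * r + 1)) (fun d z w hw => ?_) (fun d z a ha => ?_)
  · obtain ⟨a, rfl⟩ := (TensorProduct.rid ℂ (CoinvQuot r (n - z) k (k * r))).symm.surjective a
    obtain ⟨p, rfl⟩ := Ideal.Quotient.mk_surjective a
    obtain ⟨f, hf, -, hf2⟩ := exists_lift_projS (r := r) (k := k) (summand_le z) p
    exact ⟨_, projSC_eq hf, fun z' h hne => index_eq_of_projS hf2 z' h (mt projSC_eq_zero.2 hne)⟩
  · rw [Submodule.mem_comap, gradSC_eq]
    exact ⟨_, gradR_le_comap_projS r k (summand_le z) d hw, rfl⟩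
  · rw [gradSC_eq] at ha
    obtain ⟨a, ha, rfl⟩ := ha
    obtain ⟨f, hf, hf1, hf2⟩ := exists_lift_shiftS (summand_le z) ha
    exact ⟨f, hf, projSC_eq hf1, fun z' h hne =>
      index_eq_of_projS hf2 z' h (mt projSC_eq_zero.2 hne)⟩

/-! ### The identity of graded Frobenius characters -/

instance finiteDimensional_quotGrading (r n k a d : ℕ) :
    FiniteDimensional ℂ (quotGrading r n k a d) := by
  have : FiniteDimensional ℂ (MvPolynomial.homogeneousSubmodule (Fin n) ℂ d) :=
    Module.Finite.iff_fg.2 (MvPolynomial.homogeneousSubmodule_fg _ _ _)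
  unfold quotGrading
  infer_instance

instance finiteDimensional_shiftS (r k m z d : ℕ) : FiniteDimensional ℂ (shiftS r k m z d) := by
  by_cases h : k * r * z ≤ d
  · rw [shiftS, if_pos h]
    infer_instance
  · rw [shiftS, if_neg h]
    infer_instance

theorem frob_subrepresentation_bot {r n : ℕ} {V : Type} [AddCommGroup V] [Module ℂ V]
    (ρ : Representation ℂ (GG r (Fin n)) V) (h : ∀ g, (⊥ : Submodule ℂ V) ≤ (⊥ : Submodule ℂ V).comap (ρ g)) :
    frob (ρ.subrepresentation ⊥ h) = 0 := by
  refine Finset.sum_eq_zero fun l _ => ?_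
  have : Subsingleton ((irrRep l).IntertwiningMap (ρ.subrepresentation ⊥ h)) :=
    ⟨fun f g => Representation.IntertwiningMap.ext (LinearMap.ext fun x => Subsingleton.elim _ _)⟩
  rw [Module.finrank_zero_of_subsingleton, Nat.cast_zero, zero_smul]

theorem frob_subrepresentation_congr {r n : ℕ} {V : Type} [AddCommGroup V] [Module ℂ V]
    (ρ : Representation ℂ (GG r (Fin n)) V) {𝒱 𝒲 : Submodule ℂ V} (e : 𝒱 = 𝒲)
    (h𝒱 : ∀ g, 𝒱 ≤ 𝒱.comap (ρ g)) (h𝒲 : ∀ g, 𝒲 ≤ 𝒲.comap (ρ g)) :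
    frob (ρ.subrepresentation 𝒱 h𝒱) = frob (ρ.subrepresentation 𝒲 h𝒲) := by
  subst e
  rfl

theorem frob_shiftS (r k m z d : ℕ) :
    frob ((repS r m k).subrepresentation (shiftS r k m z d) (shiftS_stable r k m z d)) =
      if k * r * z ≤ d then frob ((repS r m k).subrepresentation (gradS r m k (d - k * r * z))
        (quotGrading_stable r m k (k * r) _)) else 0 := by
  split_ifs with h
  · exact frob_subrepresentation_congr _ (if_pos h) _ _
  · exact (frob_subrepresentation_congr _ (if_neg h) _ fun _ => bot_le).trans
      (frob_subrepresentation_bot _ _)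

/-- The recognition of a sum of induced modules, read on Frobenius characters. It is applied to one
homogeneous component at a time, where the modules are finite-dimensional. -/
theorem frob_eq_sum_of_projections {r n : ℕ} [NeZero r] {I W : Type} [Fintype I] [DecidableEq I]
    [AddCommGroup W] [Module ℂ W] [FiniteDimensional ℂ W] {V : I → Type} [∀ i, AddCommGroup (V i)]
    [∀ i, Module ℂ (V i)] [∀ i, FiniteDimensional ℂ (V i)] {m z : I → ℕ} (hmz : ∀ i, m i + z i = n)
    {τ : ∀ i, Representation ℂ (GG r (Fin (m i))) (V i)} {σ : Representation ℂ (GG r (Fin n)) W}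
    (π : ∀ i, W →ₗ[ℂ] V i)
    (hπ : ∀ i g w, π i (σ (parabolicTwo r (hmz i) g) w) = τ i g.1 (π i w))
    (hinj : ∀ w, (∀ i h, π i (σ h w) = 0) → w = 0)
    (hsurj : ∀ i a, ∃ f, π i f = a ∧
      ∀ j h, π j (σ h f) ≠ 0 → j = i ∧ ∃ g, parabolicTwo r (hmz i) g = h) :
    frob σ = ∑ i, frob (τ i) * rSchur (lastRow r (z i)) := by
  have hφ : ∀ i, Function.Injective (parabolicTwo r (hmz i)) :=
    fun i => parabolicTwo_injective r (hmz i)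
  refine (frob_eq_sum_of_equiv ((toSumInd (fun i => parabolicTwo r (hmz i))
    (fun i => (τ i).comp (MonoidHom.fst _ (GG r (Fin (z i))))) σ π).ofBijective
      ⟨toSumInd_injective hπ hinj, toSumInd_surjective hφ hπ hsurj⟩)).trans
        (Finset.sum_congr rfl fun i _ => ?_)
  rw [← frob_trivial]
  exact frob_ind_parabolicTwo _ (τ i)

/-- The map `projS` on the homogeneous components. -/
def projSHom (r k : ℕ) {n z : ℕ} (hz : z ≤ n) (d : ℕ) :
    gradR r n k d →ₗ[ℂ] shiftS r k (n - z) z d :=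
  (projS r k hz).restrict (gradR_le_comap_projS r k hz d)

theorem frob_gradR (r n k d : ℕ) [NeZero r] :
    frob ((repR r n k).subrepresentation (gradR r n k d)
        (quotGrading_stable r n k (k * r + 1) d)) =
      ∑ z : Fin (n - k + 1),
        frob ((repS r (n - z) k).subrepresentation (shiftS r k (n - z) z d)
          (shiftS_stable r k (n - z) z d)) * rSchur (lastRow r z) := by
  have h := frob_eq_sum_of_projections (V := fun z : Fin (n - k + 1) => shiftS r k (n - z) z d)
    (m := fun z => n - z) (z := fun z => z) (fun z => Nat.sub_add_cancel (summand_le z))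
    (τ := fun z => (repS r (n - z) k).subrepresentation (shiftS r k (n - z) z d)
      (shiftS_stable r k (n - z) z d))
    (σ := (repR r n k).subrepresentation (gradR r n k d)
      (quotGrading_stable r n k (k * r + 1) d))
    (fun z => projSHom r k (summand_le z) d)
  refine h (fun z g w => ?_) (fun w hw => ?_) fun z a => ?_
  · exact Subtype.ext (projS_parabolicTwo r k (summand_le z) g w)
  · exact Subtype.ext (eq_zero_of_projS w.1 fun z h => congrArg Subtype.val (hw z h))
  · obtain ⟨f, hf, hf1, hf2⟩ := exists_lift_shiftS (summand_le z) a.2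
    exact ⟨⟨f, hf⟩, Subtype.ext hf1, fun z' h hne =>
      index_eq_of_projS hf2 z' h fun h0 => hne (Subtype.ext h0)⟩

end

/-! ### The main theorem -/

theorem mainTheorem9 (r n k : ℕ) (hr : 2 ≤ r) (hn : 1 ≤ n) (hk : k ≤ n) :
    GradedIso (repR r n k) (gradR r n k)
      (Representation.directSum fun z : Fin (n - k + 1) => repInd r n k z (summand_le z))
      (sumGrading fun z : Fin (n - k + 1) => gradInd r n k z (summand_le z)) ∧
    grFrob (repR r n k) (gradR r n k) (quotGrading_stable r n k (k * r + 1)) =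
      ∑ z ∈ Finset.range (n - k + 1),
        PowerSeries.X ^ (k * r * z) * PowerSeries.C (rSchur (lastRow r z)) *
          grFrob (repS r (n - z) k) (gradS r (n - z) k)
            (quotGrading_stable r (n - z) k (k * r)) := by
  have : NeZero r := ⟨by omega⟩
  refine ⟨gradedIso_repR r n k, PowerSeries.ext fun d => ?_⟩
  rw [map_sum, grFrob, PowerSeries.coeff_mk, frob_gradR, Finset.sum_range]
  refine Finset.sum_congr rfl fun z _ => ?_
  -- Multiplication by `q^{krz}` shifts coefficients and gives zero below degree `krz`, which is the
  -- same case distinction as in `frob_shiftS`.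
  rw [mul_assoc, PowerSeries.coeff_X_pow_mul', PowerSeries.coeff_C_mul, grFrob,
    PowerSeries.coeff_mk, frob_shiftS]
  split_ifs
  · rw [mul_comm]
  · rw [zero_mul]
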